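/- Let $n\ge 3$ be an integer and let $p>1$ be real. A convex body in $\mathbb R^n$ is a nonempty compact convex set; let $\mathcal K^n_o$ be the set of convex bodies containing the origin and let $\mathcal P^n$ be the set of all convex polytopes in $\mathbb R^n$, i.e. convex hulls of nonempty finite sets of points (of any dimension, not necessarily containing the origin). For a convex body $K$ let $h_K(u)=\max_{x\in K}\langle x,u\rangle$ be its support function. For $K,L\in\mathcal K^n_o$ let $K+_pL\in\mathcal K^n_o$ be the unique convex body with $h_{K+_pL}^p=h_K^p+h_L^p$, and let $cK=\{cx: x\in K\}$ for $c\ge 0$. For $P\in\mathcal P^n$ and a unit vector $v$ put $F(P,v)=\{x\in P:\langle x,v\rangle=h_P(v)\}$, and let $\mathcal N(P)$ be the (finite) set of all unit vectors $v$ for which $F(P,v)$ has dimension $n-1$ (so if $\dim P=n-1$, both unit normals of the affine hull of $P$ belong to $\mathcal N(P)$). Writing $t_+=\max\{t,0\}$ and $t_-=\max\{-t,0\}$, define $\Pi_p^{\pm,>}P,\ \Pi_p^{\pm,<}P\in\mathcal K^n_o$ by $$h_{\Pi_p^{\pm,>}P}(u)^p=\sum_{v\in\mathcal N(P),\ h_P(v)>0}\mathrm{vol}_{n-1}(F(P,v))\,h_P(v)^{1-p}\,\langle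 v,u\rangle_{\pm}^p,$$ $$h_{\Pi_p^{\pm,<}P}(u)^p=\sum_{v\in\mathcal N(P),\ h_P(v)<0}\mathrm{vol}_{n-1}(F(P,v))\,|h_P(v)|^{1-p}\,\langle v,u\rangle_{\pm}^p$$ for all $u\in\mathbb R^n$. A map $\Phi:\mathcal P^n\to\mathcal K^n_o$ is called $SL(n)$-contravariant if $\Phi(\phi P)=\phi^{-t}\,\Phi(P)$ for all $P\in\mathcal P^n$ and $\phi\in SL(n)$ (where $\phi^{-t}$ is the inverse transpose), and an $L_p$-Minkowski valuation if $\Phi(P\cup Q)+_p\Phi(P\cap Q)=\Phi(P)+_p\Phi(Q)$ for all $P,Q\in\mathcal P^n$ with $P\cup Q,\,P\cap Q\in\mathcal P^n$. **Theorem.** A map $\Phi:\mathcal P^n\to\mathcal K^n_o$ is an $SL(n)$-contravariant $L_p$-Minkowski valuation if and only if there exist constants $c_1,c_2,c_3,c_4\ge 0$ such that $$\Phi P=c_1\,\Pi_p^{+,>}P+_p c_2\,\Pi_p^{-,>}P+_p c_3\,\Pi_p^{+,<}P+_p c_4\,\Pi_p^{-,<}P$$ for all $P\in\mathcal P^n$.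 -/

import Mathlib

open scoped RealInnerProductSpace MeasureTheory

noncomputable section

namespace SLContra

/-- Euclidean space `ℝⁿ`. -/
abbrev E (n : ℕ) : Type := EuclideanSpace ℝ (Fin n)

/-- Convex bodies in `ℝⁿ` (nonempty compact convex sets) containing the origin. -/
structure ConvexBodyO (n : ℕ) : Type where
  /-- the underlying convex body -/
  body : ConvexBody (E n)
  zero_mem : (0 : E n) ∈ body

/-- Convex polytopes in `ℝⁿ`: convex bodies which are the convex hull of a finite set of points.
No condition on the dimension or on the position of the origin is imposed. -/
structure Polytope (n : ℕ) : Type where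
  /-- the underlying convex body -/
  body : ConvexBody (E n)
  exists_finset : ∃ s : Finset (E n), (body : Set (E n)) = convexHull ℝ (s : Set (E n))

/-- The underlying set of a convex body containing the origin. -/
def ConvexBodyO.toSet {n : ℕ} (K : ConvexBodyO n) : Set (E n) := (K.1 : Set (E n))

/-- The underlying set of a polytope. -/
def Polytope.toSet {n : ℕ} (P : Polytope n) : Set (E n) := (P.1 : Set (E n))

/-- The support function `h_K(u) = max_{x ∈ K} ⟨x, u⟩`. -/
def supp {n : ℕ} (K : ConvexBody (E n)) (u : E n) : ℝ :=
  sSup ((fun x : E n => ⟪x, u⟫) '' (K : Set (E n)))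

/-- The supremum defining the support function is attained, i.e. it is a maximum. -/
theorem supp_isGreatest {n : ℕ} (K : ConvexBody (E n)) (u : E n) :
    IsGreatest ((fun x : E n => ⟪x, u⟫) '' (K : Set (E n))) (supp K u) :=
  (K.isCompact.image (by fun_prop)).isGreatest_sSup (K.nonempty.image _)

/-- A convex body is determined by its support function. -/
theorem ext_supp {n : ℕ} {K L : ConvexBody (E n)} (h : ∀ u, supp K u = supp L u) : K = L := by
  have key : ∀ K L : ConvexBody (E n), (∀ u, supp K u = supp L u) →
      (K : Set (E n)) ⊆ (L : Set (E n)) := by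
    intro K L h x hx
    by_contra hxL
    obtain ⟨f, c, hf, hc⟩ := geometric_hahn_banach_closed_point L.convex L.isClosed hxL
    obtain ⟨y, hy, hyu⟩ := (supp_isGreatest L ((InnerProductSpace.toDual ℝ (E n)).symm f)).1
    have h1 := (supp_isGreatest K ((InnerProductSpace.toDual ℝ (E n)).symm f)).2 ⟨x, hx, rfl⟩
    have h2 := hf y hy
    have e : ∀ z : E n, ⟪z, (InnerProductSpace.toDual ℝ (E n)).symm f⟫ = f z := by
      intro z
      rw [real_inner_comm, InnerProductSpace.toDual_symm_apply]
    simp only [e, h] at h1 hyu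
    linarith
  exact ConvexBody.ext (Set.Subset.antisymm (key K L h) (key L K fun u => (h u).symm))

/-- The support function of a convex body containing the origin is nonnegative. -/
theorem supp_nonneg {n : ℕ} (K : ConvexBodyO n) (u : E n) : 0 ≤ supp K.1 u :=
  (supp_isGreatest K.1 u).2 ⟨0, K.2, by simp⟩

/-- The convex body `{x | ⟨x, u⟩ ≤ f u for all u}` for a nonnegative function `f`. If `f` is
sublinear, this is the unique convex body with support function `f`, see `supp_bodyOf`. -/
def bodyOf {n : ℕ} (f : E n → ℝ) (hf : ∀ u, 0 ≤ f u) : ConvexBodyO n :=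
  ⟨{ carrier := {x | ∀ u, ⟪x, u⟫ ≤ f u}
     convex' := by
       intro x hx y hy a b ha hb hab u
       rw [inner_add_left, real_inner_smul_left, real_inner_smul_left]
       have h1 := mul_le_mul_of_nonneg_left (hx u) ha
       have h2 := mul_le_mul_of_nonneg_left (hy u) hb
       have h3 : a * f u + b * f u = f u := by rw [← add_mul, hab, one_mul]
       linarith
     isCompact' := by
       refine Metric.isCompact_of_isClosed_isBounded ?_ ?_
       · rw [Set.ofPred_forall]
         exact isClosed_iInter fun u => isClosed_le (by fun_prop) continuous_const
       · rw [isBounded_iff_forall_norm_le]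
         let b := EuclideanSpace.basisFun (Fin n) ℝ
         refine ⟨∑ i, max (f (b i)) (f (-b i)), fun x hx => ?_⟩
         rw [← b.sum_repr' x]
         refine (norm_sum_le _ _).trans (Finset.sum_le_sum fun i _ => ?_)
         rw [norm_smul, b.norm_eq_one, mul_one, Real.norm_eq_abs, real_inner_comm]
         refine abs_le'.2 ⟨(hx _).trans (le_max_left _ _), ?_⟩
         rw [← inner_neg_right]
         exact (hx _).trans (le_max_right _ _)
     nonempty' := ⟨0, fun u => by simpa using hf u⟩ },
   fun u => by simpa using hf u⟩

theorem supp_bodyOf {n : ℕ} (f : E n → ℝ) (hf : ∀ u, 0 ≤ f u)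
    (hadd : ∀ u v, f (u + v) ≤ f u + f v)
    (hsmul : ∀ (s : ℝ) (u : E n), 0 < s → f (s • u) = s * f u) (u : E n) :
    supp (bodyOf f hf).1 u = f u := by
  apply le_antisymm
  · obtain ⟨x, hx, hxu⟩ := (supp_isGreatest (bodyOf f hf).1 u).1
    rw [← hxu]
    exact hx u
  · rcases eq_or_ne u 0 with rfl | hu
    · have h := hsmul 2 0 (by norm_num)
      rw [smul_zero] at h
      have h0 : f 0 = 0 := by linarith
      rw [h0]
      exact supp_nonneg _ _
    · obtain ⟨g, hg1, hg2⟩ := exists_extension_of_le_sublinear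
        (LinearPMap.mkSpanSingleton (K := ℝ) u (f u) hu) f (fun c hc x => hsmul c x hc) hadd (by
          rintro ⟨x, hx⟩
          obtain ⟨t, rfl⟩ := Submodule.mem_span_singleton.1 hx
          have hval : LinearPMap.mkSpanSingleton (K := ℝ) u (f u) hu ⟨t • u, hx⟩ = t * f u :=
            LinearPMap.mkSpanSingleton'_apply (σ := RingHom.id ℝ) _ _ _ _ _
          rw [hval]
          rcases lt_trichotomy t 0 with ht | rfl | ht
          · exact (mul_nonpos_of_nonpos_of_nonneg ht.le (hf u)).trans (hf _)
          · simpa using hf 0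
          · exact (hsmul t u ht).ge)
      have hgu : g u = f u := by
        have h := hg1 ⟨u, Submodule.mem_span_singleton_self u⟩
        rw [h]
        exact LinearPMap.mkSpanSingleton_apply ℝ ℝ hu (f u)
      let x : E n := (InnerProductSpace.toDual ℝ (E n)).symm (LinearMap.toContinuousLinearMap g)
      have hx : ∀ v, ⟪x, v⟫ = g v := fun v => by
        simp [x]
      have hmem : x ∈ (bodyOf f hf).1 := fun v => (hx v).trans_le (hg2 v)
      rw [← hgu, ← hx]
      exact (supp_isGreatest (bodyOf f hf).1 u).2 ⟨x, hmem, rfl⟩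

/-- The `L_p` norm of finitely many nonnegative sublinear functions is the support function of a
convex body. -/
theorem supp_bodyOf_lp {n : ℕ} {p : ℝ} (hp : 1 ≤ p) {ι : Type*} (s : Finset ι) (w : ι → ℝ)
    (g : ι → E n → ℝ) (hw : ∀ i ∈ s, 0 ≤ w i) (hg : ∀ i u, 0 ≤ g i u)
    (hadd : ∀ i u v, g i (u + v) ≤ g i u + g i v)
    (hsmul : ∀ i (c : ℝ) (u : E n), 0 < c → g i (c • u) = c * g i u)
    (F : E n → ℝ) (hF : ∀ u, F u = (∑ i ∈ s, w i * g i u ^ p) ^ (1 / p)) (hF0 : ∀ u, 0 ≤ F u)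
    (u : E n) : supp (bodyOf F hF0).1 u ^ p = ∑ i ∈ s, w i * g i u ^ p := by
  have hp0 : p ≠ 0 := by positivity
  have hnn : ∀ u, 0 ≤ ∑ i ∈ s, w i * g i u ^ p := fun u =>
    Finset.sum_nonneg fun i hi => mul_nonneg (hw i hi) (Real.rpow_nonneg (hg i u) p)
  have hterm : ∀ i ∈ s, ∀ x : ℝ, 0 ≤ x → w i * x ^ p = (w i ^ (1 / p) * x) ^ p := by
    intro i hi x hx
    rw [Real.mul_rpow (Real.rpow_nonneg (hw i hi) _) hx, ← Real.rpow_mul (hw i hi),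
      one_div_mul_cancel hp0, Real.rpow_one]
  rw [supp_bodyOf, hF, ← Real.rpow_mul (hnn u), one_div_mul_cancel hp0, Real.rpow_one]
  · intro a b
    have e : ∀ u, F u = (∑ i ∈ s, (w i ^ (1 / p) * g i u) ^ p) ^ (1 / p) := fun u => by
      rw [hF, Finset.sum_congr rfl fun i hi => hterm i hi _ (hg i u)]
    rw [e a, e b]
    refine le_trans ?_ (Real.Lp_add_le_of_nonneg s hp
      (fun i hi => mul_nonneg (Real.rpow_nonneg (hw i hi) _) (hg i a))
      (fun i hi => mul_nonneg (Real.rpow_nonneg (hw i hi) _) (hg i b)))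
    rw [hF]
    refine Real.rpow_le_rpow (hnn _) (Finset.sum_le_sum fun i hi => ?_) (by positivity)
    rw [← mul_add, ← hterm i hi _ (add_nonneg (hg i a) (hg i b))]
    exact mul_le_mul_of_nonneg_left
      (Real.rpow_le_rpow (hg i _) (hadd i a b) (by positivity)) (hw i hi)
  · intro c v hc
    rw [hF, hF]
    have h : ∑ i ∈ s, w i * g i (c • v) ^ p = c ^ p * ∑ i ∈ s, w i * g i v ^ p := by
      rw [Finset.mul_sum]
      refine Finset.sum_congr rfl fun i _ => ?_
      rw [hsmul i c v hc, Real.mul_rpow hc.le (hg i v)]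
      ring
    rw [h, Real.mul_rpow (by positivity) (hnn v), ← Real.rpow_mul hc.le,
      mul_one_div_cancel hp0, Real.rpow_one]

theorem supp_add_le {n : ℕ} (K : ConvexBody (E n)) (u v : E n) :
    supp K (u + v) ≤ supp K u + supp K v := by
  obtain ⟨x, hx, h⟩ := (supp_isGreatest K (u + v)).1
  rw [← h]
  simp only [inner_add_right]
  exact add_le_add ((supp_isGreatest K u).2 ⟨x, hx, rfl⟩) ((supp_isGreatest K v).2 ⟨x, hx, rfl⟩)

theorem supp_smul {n : ℕ} (K : ConvexBody (E n)) (c : ℝ) (u : E n) (hc : 0 < c) :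
    supp K (c • u) = c * supp K u := by
  apply le_antisymm
  · obtain ⟨x, hx, h⟩ := (supp_isGreatest K (c • u)).1
    rw [← h]
    simp only [real_inner_smul_right]
    exact mul_le_mul_of_nonneg_left ((supp_isGreatest K u).2 ⟨x, hx, rfl⟩) hc.le
  · obtain ⟨x, hx, h⟩ := (supp_isGreatest K u).1
    rw [← h]
    simp only [← real_inner_smul_right]
    exact (supp_isGreatest K (c • u)).2 ⟨x, hx, rfl⟩

/-- The `L_p`-Minkowski sum `K +_p L`: the convex body with support function
`(h_K^p + h_L^p)^(1/p)`. -/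
def lpAdd {n : ℕ} (p : ℝ) (K L : ConvexBodyO n) : ConvexBodyO n :=
  bodyOf (fun u => (supp K.1 u ^ p + supp L.1 u ^ p) ^ (1 / p)) fun u =>
    Real.rpow_nonneg (add_nonneg (Real.rpow_nonneg (supp_nonneg K u) p)
      (Real.rpow_nonneg (supp_nonneg L u) p)) _

/-- The characterizing property of the `L_p`-Minkowski sum. -/
theorem supp_lpAdd {n : ℕ} {p : ℝ} (hp : 1 ≤ p) (K L : ConvexBodyO n) (u : E n) :
    supp (lpAdd p K L).1 u ^ p = supp K.1 u ^ p + supp L.1 u ^ p := by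
  have h := supp_bodyOf_lp hp (Finset.univ : Finset Bool) (fun _ => (1 : ℝ))
    (fun i u => supp (cond i K L).1 u) (fun _ _ => zero_le_one) (fun i u => supp_nonneg _ u)
    (fun i u v => supp_add_le _ u v) (fun i c u hc => supp_smul _ c u hc)
    (fun u => (supp K.1 u ^ p + supp L.1 u ^ p) ^ (1 / p)) (fun u => by simp)
    (fun u => Real.rpow_nonneg (add_nonneg (Real.rpow_nonneg (supp_nonneg K u) p)
      (Real.rpow_nonneg (supp_nonneg L u) p)) _) u
  simpa [lpAdd] using h

/-- The dilate `cK = {c x | x ∈ K}`. -/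
instance {n : ℕ} : SMul ℝ (ConvexBodyO n) where
  smul c K := ⟨c • K.1, ⟨0, K.2, smul_zero c⟩⟩

/-- The face `F(P, v) = P ∩ {x | ⟨x, v⟩ = h_P(v)}`. -/
def face {n : ℕ} (P : Polytope n) (v : E n) : Set (E n) :=
  {x | x ∈ P.toSet ∧ ⟪x, v⟫ = supp P.1 v}

/-- `𝒩(P)`: the unit vectors `v` such that `F(P, v)` is a facet, i.e. has dimension `n - 1`.
If `P` itself has dimension `n - 1`, then both unit normals of its affine hull belong
to `𝒩(P)`. -/
def facetNormals {n : ℕ} (P : Polytope n) : Set (E n) :=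
  {v | ‖v‖ = 1 ∧ Module.finrank ℝ (vectorSpan ℝ (face P v)) + 1 = n}

/-- The `(n-1)`-dimensional volume of the face `F(P, v)`. The Euclidean Hausdorff measure
`μHE[n - 1]` is normalized to agree with Lebesgue measure on `(n-1)`-dimensional subspaces. -/
def faceVol {n : ℕ} (P : Polytope n) (v : E n) : ℝ :=
  (μHE[n - 1] (face P v)).toReal

/-- The sum `∑ vol_{n-1}(F(P,v)) |h_P(v)|^(1-p) g(⟨v, u⟩)^p` over all `v ∈ 𝒩(P)` whose support
number `h_P(v)` satisfies the condition `C`; this is a finite sum by `facetNormals_finite`. -/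
def facetSum {n : ℕ} (p : ℝ) (C : ℝ → Prop) (g : ℝ → ℝ) (P : Polytope n) (u : E n) : ℝ :=
  ∑ᶠ v ∈ {v | v ∈ facetNormals P ∧ C (supp P.1 v)},
    faceVol P v * |supp P.1 v| ^ (1 - p) * g ⟪v, u⟫ ^ p

theorem facetSum_nonneg {n : ℕ} (p : ℝ) (C : ℝ → Prop) (g : ℝ → ℝ) (hg : ∀ t, 0 ≤ g t)
    (P : Polytope n) (u : E n) : 0 ≤ facetSum p C g P u :=
  finsum_mem_induction (0 ≤ ·) le_rfl (fun _ _ => add_nonneg) fun _ _ => mul_nonneg (mul_nonneg ENNReal.toReal_nonneg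
    (Real.rpow_nonneg (abs_nonneg _) _)) (Real.rpow_nonneg (hg _) _)

/-- The convex body whose support function is the `p`-th root of `facetSum p C g P`. -/
def facetBody {n : ℕ} (p : ℝ) (C : ℝ → Prop) (g : ℝ → ℝ) (hg : ∀ t, 0 ≤ g t)
    (P : Polytope n) : ConvexBodyO n :=
  bodyOf (fun u => facetSum p C g P u ^ (1 / p)) fun u =>
    Real.rpow_nonneg (facetSum_nonneg p C g hg P u) _

/-- `Π_p^{+,>}`: facets with `h_P(v) > 0`, positive part of `⟨v, ·⟩`. -/
def projPosGt {n : ℕ} (p : ℝ) (P : Polytope n) : ConvexBodyO n :=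
  facetBody p (fun t => 0 < t) (fun t => max t 0) (fun _ => le_max_right _ _) P

/-- `Π_p^{-,>}`: facets with `h_P(v) > 0`, negative part of `⟨v, ·⟩`. -/
def projNegGt {n : ℕ} (p : ℝ) (P : Polytope n) : ConvexBodyO n :=
  facetBody p (fun t => 0 < t) (fun t => max (-t) 0) (fun _ => le_max_right _ _) P

/-- `Π_p^{+,<}`: facets with `h_P(v) < 0`, positive part of `⟨v, ·⟩`. -/
def projPosLt {n : ℕ} (p : ℝ) (P : Polytope n) : ConvexBodyO n :=
  facetBody p (fun t => t < 0) (fun t => max t 0) (fun _ => le_max_right _ _) P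

/-- `Π_p^{-,<}`: facets with `h_P(v) < 0`, negative part of `⟨v, ·⟩`. -/
def projNegLt {n : ℕ} (p : ℝ) (P : Polytope n) : ConvexBodyO n :=
  facetBody p (fun t => t < 0) (fun t => max (-t) 0) (fun _ => le_max_right _ _) P

theorem face_eq_convexHull {n : ℕ} (P : Polytope n) (s : Finset (E n))
    (hs : (P.1 : Set (E n)) = convexHull ℝ (s : Set (E n))) (v : E n) :
    face P v = convexHull ℝ {y | y ∈ s ∧ ⟪y, v⟫ = supp P.1 v} := by
  have hle : ∀ y ∈ s, ⟪y, v⟫ ≤ supp P.1 v := fun y hy =>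
    (supp_isGreatest P.1 v).2 ⟨y, by rw [hs]; exact subset_convexHull ℝ _ hy, rfl⟩
  apply Set.Subset.antisymm
  · rintro x ⟨hxP, hx⟩
    rw [Polytope.toSet, hs, Finset.mem_convexHull'] at hxP
    obtain ⟨w, hw0, hw1, rfl⟩ := hxP
    have hz : ∀ y ∈ s, w y * (supp P.1 v - ⟪y, v⟫) = 0 := by
      refine (Finset.sum_eq_zero_iff_of_nonneg fun y hy =>
        mul_nonneg (hw0 y hy) (sub_nonneg.2 (hle y hy))).1 ?_
      rw [sum_inner] at hx
      simp only [real_inner_smul_left] at hx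
      simp only [mul_sub, Finset.sum_sub_distrib, ← Finset.sum_mul, hw1, hx]
      ring
    have hmem : ∀ y ∈ s, w y ≠ 0 → y ∈ {y | y ∈ s ∧ ⟪y, v⟫ = supp P.1 v} := by
      intro y hy hne
      rcases mul_eq_zero.1 (hz y hy) with h | h
      · exact absurd h hne
      · exact ⟨hy, by linarith⟩
    rw [← Finset.sum_filter_of_ne (p := fun y => w y ≠ 0)
      (fun y _ h hy0 => h (by rw [hy0, zero_smul]))]
    refine (convex_convexHull ℝ _).sum_mem (fun y hy => hw0 y (Finset.mem_filter.1 hy).1) ?_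
      fun y hy => subset_convexHull ℝ _
        (hmem y (Finset.mem_filter.1 hy).1 (Finset.mem_filter.1 hy).2)
    rw [Finset.sum_filter_ne_zero, hw1]
  · refine convexHull_min ?_ ?_
    · rintro y ⟨hy, hyv⟩
      refine ⟨?_, hyv⟩
      rw [Polytope.toSet, hs]
      exact subset_convexHull ℝ _ hy
    · refine P.1.convex.inter ?_
      intro x hx y hy a b _ _ hab
      change ⟪x, v⟫ = _ at hx
      change ⟪y, v⟫ = _ at hy
      change ⟪a • x + b • y, v⟫ = _
      rw [inner_add_left, real_inner_smul_left, real_inner_smul_left, hx, hy, ← add_mul, hab,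
        one_mul]

/-- A polytope has only finitely many facets. -/
theorem facetNormals_finite {n : ℕ} (P : Polytope n) : (facetNormals P).Finite := by
  classical
  obtain ⟨s, hs⟩ := P.2
  have horth : ∀ v, vectorSpan ℝ (face P v) ≤ (ℝ ∙ v)ᗮ := by
    intro v
    rw [vectorSpan_def, Submodule.span_le]
    rintro _ ⟨x, hx, y, hy, rfl⟩
    rw [SetLike.mem_coe, Submodule.mem_orthogonal_singleton_iff_inner_left]
    change ⟪x - y, v⟫ = 0
    rw [inner_sub_left, hx.2, hy.2, sub_self]
  refine Set.Finite.subset (s := ⋃ A ∈ s.powerset,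
    {v | v ∈ facetNormals P ∧ s.filter (fun y => ⟪y, v⟫ = supp P.1 v) = A})
    (Set.Finite.biUnion s.powerset.finite_toSet fun A _ => ?_) ?_
  · rcases Set.eq_empty_or_nonempty
      {v | v ∈ facetNormals P ∧ s.filter (fun y => ⟪y, v⟫ = supp P.1 v) = A} with h | ⟨v, hv, hvA⟩
    · rw [h]; exact Set.finite_empty
    refine Set.Finite.subset (s := {v, -v}) (by simp) ?_
    rintro w ⟨hw, hwA⟩
    have hface : face P w = face P v := by
      rw [face_eq_convexHull P s hs, face_eq_convexHull P s hs]
      congr 1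
      ext y
      have h := Finset.ext_iff.1 (hwA.trans hvA.symm) y
      rw [Finset.mem_filter, Finset.mem_filter] at h
      exact h
    have hv0 : v ≠ 0 := by
      rintro rfl
      simpa using hv.1
    have hV : vectorSpan ℝ (face P v) = (ℝ ∙ v)ᗮ := by
      refine Submodule.eq_of_le_of_finrank_eq (horth v) ?_
      have h1 := (ℝ ∙ v).finrank_add_finrank_orthogonal
      rw [finrank_span_singleton hv0, finrank_euclideanSpace_fin] at h1
      have h2 := hv.2
      omega
    have hwv : (ℝ ∙ v)ᗮ ≤ (ℝ ∙ w)ᗮ := by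
      rw [← hV, ← hface]
      exact horth w
    have hmem : w ∈ ℝ ∙ v := by
      have h := Submodule.orthogonal_le hwv
      rw [Submodule.orthogonal_orthogonal, Submodule.orthogonal_orthogonal] at h
      exact h (Submodule.mem_span_singleton_self w)
    obtain ⟨c, rfl⟩ := Submodule.mem_span_singleton.1 hmem
    have hc := hw.1
    rw [norm_smul, hv.1, mul_one, Real.norm_eq_abs] at hc
    rcases eq_or_eq_neg_of_abs_eq hc with h | h <;> simp [h]
  · intro v hv
    simp only [Set.mem_iUnion]
    exact ⟨_, Finset.mem_powerset.2 (Finset.filter_subset _ _), hv, rfl⟩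

/-- The characterizing property of the operators: the `p`-th power of the support function is
given by the sum over the facets. -/
theorem supp_facetBody {n : ℕ} {p : ℝ} (hp : 1 ≤ p) (C : ℝ → Prop) (g : ℝ → ℝ)
    (hg : ∀ t, 0 ≤ g t) (hadd : ∀ a b, g (a + b) ≤ g a + g b)
    (hmul : ∀ c a, 0 < c → g (c * a) = c * g a) (P : Polytope n) (u : E n) :
    supp (facetBody p C g hg P).1 u ^ p = facetSum p C g P u := by
  have hfin : {v | v ∈ facetNormals P ∧ C (supp P.1 v)}.Finite :=
    (facetNormals_finite P).subset fun v hv => hv.1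
  have e : ∀ u, facetSum p C g P u = ∑ v ∈ hfin.toFinset,
      faceVol P v * |supp P.1 v| ^ (1 - p) * g ⟪v, u⟫ ^ p := fun u =>
    finsum_mem_eq_finite_toFinset_sum _ hfin
  rw [e]
  refine supp_bodyOf_lp hp hfin.toFinset (fun v => faceVol P v * |supp P.1 v| ^ (1 - p))
    (fun v u => g ⟪v, u⟫) (fun v _ => mul_nonneg ENNReal.toReal_nonneg
      (Real.rpow_nonneg (abs_nonneg _) _)) (fun v u => hg _) ?_ ?_ _ (fun u => by rw [e]) _ u
  · intro v a b
    rw [inner_add_right]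
    exact hadd _ _
  · intro v c a hc
    rw [real_inner_smul_right]
    exact hmul c _ hc

/-- The image `φP` of a polytope under `φ ∈ SL(n)`. -/
def Polytope.image {n : ℕ} (φ : Matrix.SpecialLinearGroup (Fin n) ℝ) (P : Polytope n) :
    Polytope n :=
  ⟨{ carrier := Matrix.toEuclideanLin (φ : Matrix (Fin n) (Fin n) ℝ) '' P.toSet
     convex' := P.1.convex.linear_image _
     isCompact' := P.1.isCompact.image (LinearMap.continuous_of_finiteDimensional _)
     nonempty' := P.1.nonempty.image _ }, by
    classical
    obtain ⟨s, hs⟩ := P.2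
    refine ⟨s.image (Matrix.toEuclideanLin (φ : Matrix (Fin n) (Fin n) ℝ)), ?_⟩
    rw [Finset.coe_image, ← LinearMap.image_convexHull, ← hs]
    rfl⟩

/-- `Φ` is `SL(n)`-contravariant: `Φ(φP) = φ^{-t} Φ(P)`. -/
def IsSLContravariant {n : ℕ} (Φ : Polytope n → ConvexBodyO n) : Prop :=
  ∀ (φ : Matrix.SpecialLinearGroup (Fin n) ℝ) (P : Polytope n),
    (Φ (P.image φ)).toSet =
      Matrix.toEuclideanLin ((φ : Matrix (Fin n) (Fin n) ℝ)⁻¹.transpose) '' (Φ P).toSet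

/-- `Φ` is an `L_p`-Minkowski valuation: `Φ(P ∪ Q) +_p Φ(P ∩ Q) = Φ(P) +_p Φ(Q)` whenever
`P`, `Q`, `P ∪ Q` and `P ∩ Q` are polytopes. -/
def IsLpMinkowskiValuation {n : ℕ} (p : ℝ) (Φ : Polytope n → ConvexBodyO n) : Prop :=
  ∀ P Q U I : Polytope n, U.toSet = P.toSet ∪ Q.toSet → I.toSet = P.toSet ∩ Q.toSet →
    lpAdd p (Φ U) (Φ I) = lpAdd p (Φ P) (Φ Q)

end SLContra

end

/-!
For an `SL(n)`-contravariant `L_p`-Minkowski valuation `Φ` put `Z(P, u) = h_{ΦP}(u)^p` (and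
`Z(∅, u) = 0`). For fixed `u`, this is a real valuation in `P` with respect to dissections by
hyperplanes (`CutVal`); moreover `Z(φ P, φ u) = Z(P, u)` for `φ ∈ SL(n)`, and `Z(P, ·)` is
nonnegative, continuous and positively homogeneous of degree `p` (`ContraVal`). The classification
of such `Z` rests on three facts.

*Reduction to simplices.* A valuation which vanishes on polytopes in linear hyperplanes is zero once
it vanishes on the simplices `conv {v₁, …, vₙ}` and `conv {0, v₁, …, vₙ}` for all bases `v`
(`CutVal.eq_zero_of_bases`). The linear hyperplanes given by the facet functionals of a polytope and
their differences dissect it into truncated cones, which are differences of pyramids with apex the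
origin (`CutVal.eq_zero_of_pyramids`); the bases of the pyramids are treated by induction on the
dimension.

*Hyperplanes.* `Z` vanishes on polytopes in linear hyperplanes (`ContraVal.eq_zero_of_hyperplane`).
By the previous fact it is enough to consider a simplex spanned by a basis of the hyperplane. Shears
and continuity take care of `u` in the hyperplane and of lower-dimensional sections. For the other
`u`, both halves of the simplex, cut at the midpoint of an edge, are images of the simplex under
elements of `SL(n)` which double `u`, so that they carry the fraction `2⁻ᵖ ≠ 1/2` of the value.

*Functional equation.* By contravariance, `Z(conv (o ∪ {v₁, …, vₙ}), ∑ xᵢ vᵢ)` with `o = ∅` or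
`o = {0}` depends only on the determinant of `v` and on the coordinates `x`, and dissecting an edge
gives a functional equation (`SplitEq`). For `n ≥ 3` its solutions are
`|det v| (a (∑ xᵢ)₊^p + b (∑ xᵢ)₋^p)` (`SplitEq.eq`, `ContraVal.simplex_eq`).

Hence `Z` is determined by the four numbers `a`, `b` for the two kinds of simplices. The operators
`Π_p^{±,>}` and `Π_p^{±,<}` are contravariant valuations: the valuation property holds separately
for every unit vector (`facetTerm_valuation`), and contravariance follows from the behaviour of the
areas of facets under volume-preserving maps (`facetSum_image`), which is obtained from the volumes of
prisms. On standard simplices only the facet `conv {e₁, …, eₙ}` contributes to them, and so some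
linear combination of the four operators takes the same values as `Z`. Its coefficients are
nonnegative because `a` and `b` are at least as large for `conv {e₁, …, eₙ}` as for `conv {0, e₁, …, eₙ}`
(`ContraVal.le_simplex`).
-/

noncomputable section

namespace SLContra

/-! ### Polytopes in a finite-dimensional vector space -/

section Poly

variable {V W : Type*} [AddCommGroup V] [Module ℝ V] [AddCommGroup W] [Module ℝ W]

/-- A (possibly empty) convex polytope: the convex hull of a finite set. -/
def IsPoly (P : Set V) : Prop := ∃ s : Set V, s.Finite ∧ P = convexHull ℝ s

theorem IsPoly.convex {P : Set V} (h : IsPoly P) : Convex ℝ P := by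
  obtain ⟨s, -, rfl⟩ := h
  exact convex_convexHull ℝ s

theorem isPoly_convexHull {s : Set V} (hs : s.Finite) : IsPoly (convexHull ℝ s) := ⟨s, hs, rfl⟩

theorem IsPoly.image {P : Set V} (h : IsPoly P) (f : V →ₗ[ℝ] W) : IsPoly (f '' P) := by
  obtain ⟨s, hs, rfl⟩ := h
  exact ⟨f '' s, hs.image _, f.image_convexHull s⟩

theorem IsPoly.hull_insert {P : Set V} (h : IsPoly P) (x : V) :
    IsPoly (convexHull ℝ (insert x P)) := by
  obtain ⟨s, hs, rfl⟩ := h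
  refine ⟨insert x s, hs.insert x, ?_⟩
  rw [Set.insert_eq, Set.insert_eq]
  exact (convexHull ℝ).closure_sup_closure_right {x} s

theorem IsPoly.add_left {P : Set V} (h : IsPoly P) (x : V) : IsPoly ((fun y => x + y) '' P) := by
  obtain ⟨s, hs, rfl⟩ := h
  refine ⟨(fun y => x + y) '' s, hs.image _, ?_⟩
  have := (AffineEquiv.constVAdd ℝ V x).toAffineMap.image_convexHull s
  simpa using this

/-- A linear functional is bounded above on a polytope. -/
theorem IsPoly.bddAbove {P : Set V} (h : IsPoly P) (f : V →ₗ[ℝ] ℝ) : ∃ M, ∀ x ∈ P, f x ≤ M := by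
  obtain ⟨s, hs, rfl⟩ := h
  obtain ⟨M, hM⟩ := (hs.image f).bddAbove
  refine ⟨M, fun x hx => ?_⟩
  have : convexHull ℝ s ⊆ {x | f x ≤ M} :=
    convexHull_min (fun y hy => hM ⟨y, hy, rfl⟩) (convex_halfSpace_le f.isLinear M)
  exact this hx

/-- The point where the segment from `a` to `b` crosses the hyperplane `f = c`. -/
def crossPt (f : V →ₗ[ℝ] ℝ) (c : ℝ) (a b : V) : V :=
  (f b - f a)⁻¹ • ((f b - c) • a + (c - f a) • b)

theorem apply_crossPt {f : V →ₗ[ℝ] ℝ} {c : ℝ} {a b : V} (h : f a < f b) :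
    f (crossPt f c a b) = c := by
  have : f b - f a ≠ 0 := (sub_pos.2 h).ne'
  simp only [crossPt, map_smul, map_add, smul_eq_mul]
  field_simp
  ring

theorem crossPt_mem_segment {f : V →ₗ[ℝ] ℝ} {c : ℝ} {a b : V} (ha : f a ≤ c) (hb : c < f b) :
    crossPt f c a b ∈ segment ℝ a b := by
  have h : 0 < f b - f a := by linarith
  refine ⟨(f b - f a)⁻¹ * (f b - c), (f b - f a)⁻¹ * (c - f a), ?_, ?_, ?_, ?_⟩
  · exact mul_nonneg (inv_nonneg.2 h.le) (by linarith)
  · exact mul_nonneg (inv_nonneg.2 h.le) (by linarith)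
  · field_simp
    ring
  · simp only [crossPt, smul_add, smul_smul]

/-- The map `a ↦ crossPt f c a b` is projective, so preimages of convex sets are convex. -/
theorem convex_crossPt_left {C : Set V} (hC : Convex ℝ C) (f : V →ₗ[ℝ] ℝ) (c : ℝ) {b : V}
    (hb : c < f b) : Convex ℝ {a | f a ≤ c ∧ crossPt f c a b ∈ C} := by
  rintro x ⟨hx, hxC⟩ y ⟨hy, hyC⟩ s t hs ht hst
  have h : f (s • x + t • y) = s * f x + t * f y := by simp
  have hle : s * f x + t * f y ≤ c := by
    calc _ ≤ s * c + t * c := by gcongr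
      _ = c := by rw [← add_mul, hst, one_mul]
  refine ⟨h ▸ hle, ?_⟩
  have hpos : 0 < f b - (s * f x + t * f y) := by linarith
  have hx' : 0 < f b - f x := by linarith
  have hy' : 0 < f b - f y := by linarith
  have key : crossPt f c (s • x + t • y) b =
      (s * (f b - f x) / (f b - (s * f x + t * f y))) • crossPt f c x b +
      (t * (f b - f y) / (f b - (s * f x + t * f y))) • crossPt f c y b := by
    simp only [crossPt, h]
    match_scalars
    · field_simp
    · field_simp
    · obtain rfl : t = 1 - s := by linarith
      field_simp
      ring
  rw [key]
  refine hC hxC hyC (by positivity) (by positivity) ?_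
  rw [← add_div, div_eq_one_iff_eq hpos.ne']
  linear_combination (f b) * hst

theorem convex_crossPt_right {C : Set V} (hC : Convex ℝ C) (f : V →ₗ[ℝ] ℝ) (c : ℝ) {a : V}
    (ha : f a ≤ c) : Convex ℝ {b | c < f b ∧ crossPt f c a b ∈ C} := by
  rintro x ⟨hx, hxC⟩ y ⟨hy, hyC⟩ s t hs ht hst
  have h : f (s • x + t • y) = s * f x + t * f y := by simp
  have hle : c < s * f x + t * f y :=
    h ▸ (convex_halfSpace_gt f.isLinear c) hx hy hs ht hst
  refine ⟨h ▸ hle, ?_⟩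
  have hpos : 0 < (s * f x + t * f y) - f a := by linarith
  have hx' : 0 < f x - f a := by linarith
  have hy' : 0 < f y - f a := by linarith
  have key : crossPt f c a (s • x + t • y) =
      (s * (f x - f a) / ((s * f x + t * f y) - f a)) • crossPt f c a x +
      (t * (f y - f a) / ((s * f x + t * f y) - f a)) • crossPt f c a y := by
    simp only [crossPt, h]
    match_scalars
    · obtain rfl : t = 1 - s := by linarith
      field_simp
      ring
    · field_simp
    · field_simp
  rw [key]
  refine hC hxC hyC (by positivity) (by positivity) ?_
  rw [← add_div, div_eq_one_iff_eq hpos.ne']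
  linear_combination (-f a) * hst

/-- The part of the convex hull of `s` in the half-space `f ≤ c` is the convex hull of the points
of `s` in that half-space and of the points where segments between points of `s` cross `f = c`. -/
theorem convexHull_inter_halfSpace (s : Set V) (f : V →ₗ[ℝ] ℝ) (c : ℝ) :
    convexHull ℝ s ∩ {x | f x ≤ c} =
      convexHull ℝ ({x ∈ s | f x ≤ c} ∪
        Set.image2 (crossPt f c) {x ∈ s | f x < c} {x ∈ s | c < f x}) := by
  set X := {x ∈ s | f x ≤ c} ∪ Set.image2 (crossPt f c) {x ∈ s | f x < c} {x ∈ s | c < f x}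
    with hX
  have hA : {x ∈ s | f x ≤ c} ⊆ convexHull ℝ X :=
    Set.subset_union_left.trans (subset_convexHull ℝ X)
  apply Set.Subset.antisymm
  · rintro x ⟨hx, hxc⟩
    have hs : s = {x ∈ s | f x ≤ c} ∪ {x ∈ s | c < f x} := by
      ext y
      simp only [Set.mem_union, Set.mem_ofPred_eq]
      have := le_or_gt (f y) c
      tauto
    have hcross : ∀ a ∈ convexHull ℝ {x ∈ s | f x ≤ c}, ∀ b ∈ convexHull ℝ {x ∈ s | c < f x},
        f a ≤ c ∧ c < f b ∧ crossPt f c a b ∈ convexHull ℝ X := by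
      have h1 : ∀ a ∈ {x ∈ s | f x ≤ c}, ∀ b ∈ {x ∈ s | c < f x},
          crossPt f c a b ∈ convexHull ℝ X := by
        rintro a ⟨ha, hac⟩ b ⟨hb, hbc⟩
        rcases hac.lt_or_eq with h | h
        · exact subset_convexHull ℝ X (Or.inr ⟨a, ⟨ha, h⟩, b, ⟨hb, hbc⟩, rfl⟩)
        · have h2 : f b - c ≠ 0 := (sub_pos.2 hbc).ne'
          have : crossPt f c a b = a := by
            rw [crossPt, h, sub_self, zero_smul, add_zero, smul_smul, inv_mul_cancel₀ h2, one_smul]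
          rw [this]
          exact hA ⟨ha, hac⟩
      have h2 : ∀ b ∈ {x ∈ s | c < f x}, ∀ a ∈ convexHull ℝ {x ∈ s | f x ≤ c},
          f a ≤ c ∧ crossPt f c a b ∈ convexHull ℝ X := fun b hb =>
        convexHull_min (fun a ha => ⟨ha.2, h1 a ha b hb⟩)
          (convex_crossPt_left (convex_convexHull ℝ X) f c hb.2)
      intro a ha b hb
      have hac : f a ≤ c := convexHull_min (fun y hy => hy.2) (convex_halfSpace_le f.isLinear c) ha
      have h3 : convexHull ℝ {x ∈ s | c < f x} ⊆ {b | c < f b ∧ crossPt f c a b ∈ convexHull ℝ X} :=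
        convexHull_min (fun b hb => ⟨hb.2, (h2 b hb a ha).2⟩)
          (convex_crossPt_right (convex_convexHull ℝ X) f c hac)
      exact ⟨hac, h3 hb⟩
    rcases Set.eq_empty_or_nonempty {x ∈ s | f x ≤ c} with hAe | hAn
    · exfalso
      rw [hs, hAe, Set.empty_union] at hx
      have : c < f x := convexHull_min (fun y hy => hy.2) (convex_halfSpace_gt f.isLinear c) hx
      exact absurd hxc (not_le.2 this)
    rcases Set.eq_empty_or_nonempty {x ∈ s | c < f x} with hBe | hBn
    · rw [hs, hBe, Set.union_empty] at hx
      exact convexHull_min hA (convex_convexHull ℝ X) hx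
    rw [hs, convexHull_union hAn hBn, mem_convexJoin] at hx
    obtain ⟨a, ha, b, hb, s', t', hs', ht', hst, rfl⟩ := hx
    obtain ⟨hac, hbc, hcr⟩ := hcross a ha b hb
    have haX : a ∈ convexHull ℝ X := convexHull_min hA (convex_convexHull ℝ X) ha
    -- the point lies between `a` and the crossing point
    have hfx : s' * f a + t' * f b ≤ c := by simpa using hxc
    rcases hac.lt_or_eq with h | h
    · have h3 : 0 < c - f a := sub_pos.2 h
      have h4 : 0 < f b - f a := by linarith
      have key : s' • a + t' • b = (1 - t' * (f b - f a) / (c - f a)) • a +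
          (t' * (f b - f a) / (c - f a)) • crossPt f c a b := by
        obtain rfl : s' = 1 - t' := by linarith
        simp only [crossPt]
        match_scalars
        · field_simp
          ring
        · field_simp
      rw [key]
      refine convex_convexHull ℝ X haX hcr ?_ (by positivity) (by ring)
      rw [sub_nonneg, div_le_one h3]
      obtain rfl : s' = 1 - t' := by linarith
      linarith
    · have : t' * (f b - c) ≤ 0 := by
        obtain rfl : s' = 1 - t' := by linarith
        rw [h] at hfx
        linarith
      have ht0 : t' = 0 := by
        by_contra hne
        have : 0 < t' * (f b - c) := mul_pos (ht'.lt_of_ne (Ne.symm hne)) (sub_pos.2 hbc)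
        linarith
      obtain rfl : s' = 1 := by linarith
      simpa [ht0] using haX
  · refine convexHull_min ?_ ((convex_convexHull ℝ s).inter (convex_halfSpace_le f.isLinear c))
    rintro x (⟨hx, hxc⟩ | ⟨a, ⟨ha, hac⟩, b, ⟨hb, hbc⟩, rfl⟩)
    · exact ⟨subset_convexHull ℝ s hx, hxc⟩
    · exact ⟨(convex_convexHull ℝ s).segment_subset (subset_convexHull ℝ s ha)
        (subset_convexHull ℝ s hb) (crossPt_mem_segment hac.le hbc),
        (apply_crossPt (hac.trans hbc)).le⟩

theorem IsPoly.inter_le {P : Set V} (h : IsPoly P) (f : V →ₗ[ℝ] ℝ) (c : ℝ) :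
    IsPoly (P ∩ {x | f x ≤ c}) := by
  obtain ⟨s, hs, rfl⟩ := h
  exact ⟨_, (hs.subset (Set.sep_subset _ _)).union
    (Set.Finite.image2 _ (hs.subset (Set.sep_subset _ _)) (hs.subset (Set.sep_subset _ _))),
    convexHull_inter_halfSpace s f c⟩

theorem IsPoly.inter_ge {P : Set V} (h : IsPoly P) (f : V →ₗ[ℝ] ℝ) (c : ℝ) :
    IsPoly (P ∩ {x | c ≤ f x}) := by
  have : {x | c ≤ f x} = {x | (-f) x ≤ -c} := by ext; simp
  rw [this]
  exact h.inter_le _ _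

theorem IsPoly.inter_eq {P : Set V} (h : IsPoly P) (f : V →ₗ[ℝ] ℝ) (c : ℝ) :
    IsPoly (P ∩ {x | f x = c}) := by
  have : P ∩ {x | f x = c} = P ∩ {x | f x ≤ c} ∩ {x | c ≤ f x} := by
    ext x
    simp only [Set.mem_inter_iff, Set.mem_ofPred_eq, and_assoc, le_antisymm_iff]
  rw [this]
  exact (h.inter_le _ _).inter_ge _ _

/-- Fourier–Motzkin elimination: a finitely generated convex cone is an intersection of finitely
many half-spaces. -/
theorem exists_halfSpaces_of_cone [FiniteDimensional ℝ V] [DecidableEq V] (s : Finset V) :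
    ∃ S : Finset (V →ₗ[ℝ] ℝ), ∀ x, (∃ w : V → ℝ, (∀ i ∈ s, 0 ≤ w i) ∧ ∑ i ∈ s, w i • i = x) ↔
      ∀ f ∈ S, f x ≤ 0 := by
  classical
  induction s using Finset.induction_on with
  | empty =>
    let b := Module.finBasis ℝ V
    refine ⟨Finset.univ.image b.coord ∪ Finset.univ.image (fun i => -b.coord i), fun x => ?_⟩
    constructor
    · rintro ⟨w, -, rfl⟩ f -
      simp
    · intro h
      refine ⟨0, by simp, ?_⟩
      rw [Finset.sum_empty]
      symm
      rw [← b.forall_coord_eq_zero_iff]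
      intro i
      have h1 := h (b.coord i) (by simp)
      have h2 := h (-b.coord i) (by simp)
      rw [LinearMap.neg_apply] at h2
      linarith
  | insert a s ha ih =>
    obtain ⟨S, hS⟩ := ih
    refine ⟨S.filter (fun f => f a ≤ 0) ∪ ((S.filter (fun f => f a < 0)) ×ˢ
      (S.filter (fun f => 0 < f a))).image (fun q => q.2 a • q.1 - q.1 a • q.2), fun x => ?_⟩
    have h1 : (∃ w : V → ℝ, (∀ i ∈ insert a s, 0 ≤ w i) ∧ ∑ i ∈ insert a s, w i • i = x) ↔
        ∃ t : ℝ, 0 ≤ t ∧ ∀ f ∈ S, f x ≤ t * f a := by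
      constructor
      · rintro ⟨w, hw, rfl⟩
        refine ⟨w a, hw a (by simp), fun f hf => ?_⟩
        have := (hS (∑ i ∈ s, w i • i)).1 ⟨w, fun i hi => hw i (by simp [hi]), rfl⟩ f hf
        rw [Finset.sum_insert ha, map_add, map_smul, smul_eq_mul]
        linarith
      · rintro ⟨t, ht, h⟩
        obtain ⟨w, hw, hwx⟩ := (hS (x - t • a)).2 fun f hf => by
          rw [map_sub, map_smul, smul_eq_mul]
          linarith [h f hf]
        refine ⟨Function.update w a t, fun i hi => ?_, ?_⟩
        · rcases eq_or_ne i a with rfl | hne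
          · simpa using ht
          · rw [Function.update_of_ne hne]
            exact hw i (Finset.mem_of_mem_insert_of_ne hi hne)
        · rw [Finset.sum_insert ha, Function.update_self]
          have : ∑ i ∈ s, Function.update w a t i • i = ∑ i ∈ s, w i • i :=
            Finset.sum_congr rfl fun i hi => by
              rw [Function.update_of_ne (ne_of_mem_of_not_mem hi ha)]
          rw [this, hwx]
          abel
    rw [h1]
    constructor
    · rintro ⟨t, ht, h⟩ f hf
      rw [Finset.mem_union, Finset.mem_filter, Finset.mem_image] at hf
      rcases hf with ⟨hf, hfa⟩ | ⟨⟨f, g⟩, hq, rfl⟩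
      · exact (h f hf).trans (mul_nonpos_of_nonneg_of_nonpos ht hfa)
      · rw [Finset.mem_product, Finset.mem_filter, Finset.mem_filter] at hq
        obtain ⟨⟨hf, hfa⟩, ⟨hg, hga⟩⟩ := hq
        simp only at hf hfa hg hga
        have h2 := mul_le_mul_of_nonneg_left (h f hf) hga.le
        have h3 := mul_le_mul_of_nonneg_left (h g hg) (neg_pos.2 hfa).le
        simp only [LinearMap.sub_apply, LinearMap.smul_apply, smul_eq_mul]
        linarith
    · intro h
      -- the admissible `t` are bounded below by `0` and the quotients with `0 < f a`, and bounded
      -- above by the quotients with `f a < 0`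
      let B := insert 0 ((S.filter (fun f => 0 < f a)).image fun f => f x / f a)
      have hB : B.Nonempty := Finset.insert_nonempty _ _
      refine ⟨B.max' hB, Finset.le_max' _ _ (by simp [B]), fun f hf => ?_⟩
      rcases lt_trichotomy (f a) 0 with hfa | hfa | hfa
      · have h4 : B.max' hB ≤ f x / f a := by
          rw [Finset.max'_le_iff]
          intro y hy
          rw [Finset.mem_insert, Finset.mem_image] at hy
          rcases hy with rfl | ⟨g, hg, rfl⟩
          · exact div_nonneg_of_nonpos
              (h f (Finset.mem_union_left _ (Finset.mem_filter.2 ⟨hf, hfa.le⟩))) hfa.le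
          · rw [Finset.mem_filter] at hg
            have := h (g a • f - f a • g) (Finset.mem_union_right _ (Finset.mem_image.2
              ⟨(f, g), by simp [hf, hfa, hg.1, hg.2], rfl⟩))
            simp only [LinearMap.sub_apply, LinearMap.smul_apply, smul_eq_mul] at this
            rw [div_le_iff₀ hg.2, div_mul_eq_mul_div, le_div_iff_of_neg hfa]
            linarith
        rw [le_div_iff_of_neg hfa] at h4
        exact h4
      · have := h f (Finset.mem_union_left _ (Finset.mem_filter.2 ⟨hf, hfa.le⟩))
        rw [hfa, mul_zero]
        exact this
      · have h4 : f x / f a ≤ B.max' hB := by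
          have hfS : f ∈ S.filter (fun f => 0 < f a) := Finset.mem_filter.2 ⟨hf, hfa⟩
          exact Finset.le_max' B _ (Finset.mem_insert_of_mem (Finset.mem_image_of_mem _ hfS))
        rwa [div_le_iff₀ hfa] at h4

/-- Minkowski–Weyl: a polytope is an intersection of finitely many half-spaces. -/
theorem IsPoly.exists_halfSpaces [FiniteDimensional ℝ V] {P : Set V} (h : IsPoly P) :
    ∃ S : Finset ((V →ₗ[ℝ] ℝ) × ℝ), P = {x | ∀ q ∈ S, q.1 x ≤ q.2} := by
  classical
  obtain ⟨s, hs, rfl⟩ := h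
  lift s to Finset V using hs
  -- homogenize: pass to the cone over `s × {1}`
  obtain ⟨S, hS⟩ := exists_halfSpaces_of_cone (s.image fun x : V => (x, (1 : ℝ)))
  refine ⟨S.image fun f => (f ∘ₗ LinearMap.inl ℝ V ℝ, -f (0, 1)), ?_⟩
  ext x
  have e : ∀ f : V × ℝ →ₗ[ℝ] ℝ, f (x, 1) = f (x, 0) + f (0, 1) := fun f => by
    rw [← map_add]; simp
  have : x ∈ convexHull ℝ (s : Set V) ↔ ∃ w : V × ℝ → ℝ,
      (∀ i ∈ s.image (fun x : V => (x, (1 : ℝ))), 0 ≤ w i) ∧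
        ∑ i ∈ s.image (fun x : V => (x, (1 : ℝ))), w i • i = (x, 1) := by
    rw [Finset.mem_convexHull']
    have hinj : Set.InjOn (fun x : V => (x, (1 : ℝ))) (s : Set V) :=
      fun a _ b _ hab => (Prod.ext_iff.1 hab).1
    simp only [Finset.forall_mem_image, Finset.sum_image hinj]
    constructor
    · rintro ⟨w, hw, hw1, hwx⟩
      refine ⟨fun q => w q.1, hw, ?_⟩
      simp [Prod.ext_iff, Prod.fst_sum, Prod.snd_sum, hwx, hw1]
    · rintro ⟨w, hw, hwx⟩
      simp only [Prod.ext_iff, Prod.fst_sum, Prod.snd_sum, Prod.smul_mk, smul_eq_mul,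
        mul_one] at hwx
      exact ⟨fun y => w (y, 1), fun y hy => hw hy, hwx.2, hwx.1⟩
  rw [this, hS]
  simp only [Set.mem_ofPred_eq, Finset.forall_mem_image, LinearMap.comp_apply,
    LinearMap.inl_apply, e]
  exact forall₂_congr fun f _ => ⟨fun h => by linarith, fun h => by linarith⟩

end Poly

/-! ### Valuations with respect to hyperplane cuts -/

section Cut

universe u

variable {V : Type u} [AddCommGroup V] [Module ℝ V]

/-- A real function on polytopes, extended to the empty set by `0`, which satisfies the valuation
identity for dissections of a polytope by a hyperplane. -/
structure CutVal (D : Set V → ℝ) : Prop where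
  empty : D ∅ = 0
  cut : ∀ P, IsPoly P → ∀ (f : V →ₗ[ℝ] ℝ) (c : ℝ),
    D P + D (P ∩ {x | f x = c}) = D (P ∩ {x | f x ≤ c}) + D (P ∩ {x | c ≤ f x})

/-- Convex cones, as subsets; the origin is included. -/
structure IsCone (K : Set V) : Prop where
  convex : Convex ℝ K
  zero_mem : (0 : V) ∈ K
  smul_mem : ∀ t : ℝ, 0 < t → ∀ x ∈ K, t • x ∈ K

theorem IsCone.inter {K L : Set V} (hK : IsCone K) (hL : IsCone L) : IsCone (K ∩ L) :=
  ⟨hK.convex.inter hL.convex, ⟨hK.zero_mem, hL.zero_mem⟩,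
    fun t ht x hx => ⟨hK.smul_mem t ht x hx.1, hL.smul_mem t ht x hx.2⟩⟩

theorem IsCone.add_mem {K : Set V} (hK : IsCone K) {x y : V} (hx : x ∈ K) (hy : y ∈ K) :
    x + y ∈ K := by
  have h := hK.smul_mem 2 two_pos _
    (hK.convex hx hy (by norm_num : (0 : ℝ) ≤ 1 / 2) (by norm_num : (0 : ℝ) ≤ 1 / 2) (by norm_num))
  rwa [← smul_add, smul_smul, show (2 : ℝ) * (1 / 2) = 1 by norm_num, one_smul] at h

theorem isCone_univ : IsCone (Set.univ : Set V) := ⟨convex_univ, trivial, fun _ _ _ _ => trivial⟩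

theorem isCone_le (f : V →ₗ[ℝ] ℝ) : IsCone {x | f x ≤ 0} :=
  ⟨convex_halfSpace_le f.isLinear 0, by simp, fun t ht x hx => by
    simpa using mul_nonpos_of_nonneg_of_nonpos ht.le hx⟩

theorem isCone_ge (f : V →ₗ[ℝ] ℝ) : IsCone {x | 0 ≤ f x} :=
  ⟨convex_halfSpace_ge f.isLinear 0, by simp, fun t ht x hx => by
    simpa using mul_nonneg ht.le hx⟩

theorem isCone_eq (f : V →ₗ[ℝ] ℝ) : IsCone {x | f x = 0} :=
  ⟨convex_hyperplane f.isLinear 0, by simp, fun t ht x hx => by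
    have : f x = 0 := hx
    simp [this]⟩

theorem mem_convexHull_zero_union {G : Set V} (hG : Convex ℝ G) {x : V} :
    x ∈ convexHull ℝ ({0} ∪ G) ↔ x = 0 ∨ ∃ t : ℝ, 0 < t ∧ t ≤ 1 ∧ ∃ g ∈ G, x = t • g := by
  constructor
  · intro hx
    rcases Set.eq_empty_or_nonempty G with rfl | hne
    · left
      simpa using hx
    rw [convexHull_union (Set.singleton_nonempty 0) hne, convexHull_singleton,
      hG.convexHull_eq, mem_convexJoin] at hx
    obtain ⟨a, rfl, g, hg, s, t, hs, ht, hst, rfl⟩ := hx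
    rcases ht.eq_or_lt with rfl | ht
    · left; simp
    · right; exact ⟨t, ht, by linarith, g, hg, by simp⟩
  · rintro (rfl | ⟨t, ht, ht1, g, hg, rfl⟩)
    · exact subset_convexHull ℝ _ (Or.inl rfl)
    · have := convex_convexHull ℝ ({0} ∪ G) (subset_convexHull ℝ _ (Or.inl rfl))
        (subset_convexHull ℝ _ (Or.inr hg)) (sub_nonneg.2 ht1) ht.le (by ring)
      simpa using this

/-- Forming the pyramid over `G` with apex the origin (or just taking `G`, if `o = ∅`) commutes
with intersecting with a cone. -/
theorem convexHull_union_inter_cone {o G K : Set V} (ho : o ⊆ {0}) (hG : Convex ℝ G)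
    (hK : IsCone K) : convexHull ℝ (o ∪ G) ∩ K = convexHull ℝ (o ∪ (G ∩ K)) := by
  rcases Set.subset_singleton_iff_eq.1 ho with rfl | rfl
  · rw [Set.empty_union, Set.empty_union, hG.convexHull_eq, (hG.inter hK.convex).convexHull_eq]
  · ext x
    rw [Set.mem_inter_iff, mem_convexHull_zero_union hG,
      mem_convexHull_zero_union (hG.inter hK.convex)]
    constructor
    · rintro ⟨rfl | ⟨t, ht, ht1, g, hg, rfl⟩, hxK⟩
      · exact Or.inl rfl
      · refine Or.inr ⟨t, ht, ht1, g, ⟨hg, ?_⟩, rfl⟩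
        have := hK.smul_mem t⁻¹ (inv_pos.2 ht) _ hxK
        rwa [smul_smul, inv_mul_cancel₀ ht.ne', one_smul] at this
    · rintro (rfl | ⟨t, ht, ht1, g, ⟨hg, hgK⟩, rfl⟩)
      · exact ⟨Or.inl rfl, hK.zero_mem⟩
      · exact ⟨Or.inr ⟨t, ht, ht1, g, hg, rfl⟩, hK.smul_mem t ht _ hgK⟩

/-- Truncating a pointed cone gives a pyramid with apex the origin. -/
theorem IsCone.inter_le_one {K : Set V} (hK : IsCone K) (δ : V →ₗ[ℝ] ℝ)
    (hδ : ∀ x ∈ K, x ≠ 0 → 0 < δ x) :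
    K ∩ {x | δ x ≤ 1} = convexHull ℝ ({0} ∪ (K ∩ {x | δ x = 1})) := by
  ext x
  rw [mem_convexHull_zero_union (hK.convex.inter (convex_hyperplane δ.isLinear 1))]
  constructor
  · rintro ⟨hx, hx1⟩
    by_cases h0 : x = 0
    · exact Or.inl h0
    · have hpos := hδ x hx h0
      refine Or.inr ⟨δ x, hpos, hx1, (δ x)⁻¹ • x,
        ⟨hK.smul_mem _ (inv_pos.2 hpos) x hx, ?_⟩, ?_⟩
      · simp [inv_mul_cancel₀ hpos.ne']
      · rw [smul_smul, mul_inv_cancel₀ hpos.ne', one_smul]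
  · rintro (rfl | ⟨t, ht, ht1, g, ⟨hg, hg1⟩, rfl⟩)
    · exact ⟨hK.zero_mem, by simp⟩
    · have hg1 : δ g = 1 := hg1
      exact ⟨hK.smul_mem t ht g hg, by simpa [hg1] using ht1⟩

/-- A function which is additive for cuts by linear hyperplanes vanishes on `P ∩ K` as soon as it
vanishes on all its parts on which each functional of a given finite family has a sign. -/
theorem CutVal.eq_zero_of_signs {D : Set V → ℝ} (hD : CutVal D)
    (hker : ∀ P, IsPoly P → ∀ f : V →ₗ[ℝ] ℝ, f ≠ 0 → P ⊆ {x | f x = 0} → D P = 0)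
    (W : Finset (V →ₗ[ℝ] ℝ)) (P : Set V) :
    ∀ K : Set V, IsCone K → IsPoly (P ∩ K) →
      (∀ L : Set V, IsCone L → IsPoly (P ∩ L) →
        (∀ w ∈ W, (∀ x ∈ L, 0 ≤ w x) ∨ (∀ x ∈ L, w x ≤ 0)) → L ⊆ K → D (P ∩ L) = 0) →
      D (P ∩ K) = 0 := by
  classical
  induction W using Finset.induction_on with
  | empty => exact fun K hK hP h => h K hK hP (by simp) Set.Subset.rfl
  | insert w W _ ih =>
    intro K hK hP h
    by_cases hw : w = 0
    · refine ih K hK hP fun L hL hPL hs hLK => h L hL hPL ?_ hLK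
      intro f hf
      rcases Finset.mem_insert.1 hf with rfl | hf
      · left; simp [hw]
      · exact hs f hf
    have key : ∀ H : Set V, IsCone H → IsPoly (P ∩ K ∩ H) →
        ((∀ x ∈ H, 0 ≤ w x) ∨ (∀ x ∈ H, w x ≤ 0)) → D (P ∩ K ∩ H) = 0 := by
      intro H hH hPH hsign
      rw [Set.inter_assoc] at hPH ⊢
      refine ih (K ∩ H) (hK.inter hH) hPH fun L hL hPL hs hLK =>
        h L hL hPL ?_ (hLK.trans Set.inter_subset_left)
      intro f hf
      rcases Finset.mem_insert.1 hf with rfl | hf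
      · exact hsign.imp (fun h x hx => h x (hLK hx).2) (fun h x hx => h x (hLK hx).2)
      · exact hs f hf
    have h1 := hD.cut _ hP w 0
    rw [key _ (isCone_le w) (hP.inter_le w 0) (Or.inr fun x hx => hx),
      key _ (isCone_ge w) (hP.inter_ge w 0) (Or.inl fun x hx => hx),
      hker _ (hP.inter_eq w 0) w hw (fun x hx => hx.2)] at h1
    linarith

theorem exists_forall_rel {ι : Type*} (r : ι → ι → Prop) (htrans : ∀ a b c, r a b → r b c → r a c)
    (B : Finset ι) (hB : B.Nonempty) (htot : ∀ a ∈ B, ∀ b ∈ B, r a b ∨ r b a) :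
    ∃ m ∈ B, ∀ a ∈ B, r a m := by
  classical
  induction hB using Finset.Nonempty.cons_induction with
  | singleton a => exact ⟨a, by simp, by simpa using htot a (by simp) a (by simp)⟩
  | cons a s ha hs ih =>
    obtain ⟨m, hm, h⟩ := ih fun x hx y hy => htot x (by simp [hx]) y (by simp [hy])
    rcases htot a (by simp) m (by simp [hm]) with h1 | h1
    · refine ⟨m, by simp [hm], fun x hx => ?_⟩
      rcases Finset.mem_cons.1 hx with rfl | hx
      · exact h1
      · exact h x hx
    · refine ⟨a, by simp, fun x hx => ?_⟩
      rcases Finset.mem_cons.1 hx with rfl | hx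
      · simpa using htot x (by simp) x (by simp)
      · exact htrans _ _ _ (h x hx) h1

variable [FiniteDimensional ℝ V]

/-- A polytope can be described by inequalities with right-hand sides `1`, `0` and `-1`. -/
theorem IsPoly.exists_normalized {P : Set V} (h : IsPoly P) :
    ∃ B C A : Finset (V →ₗ[ℝ] ℝ), 0 ∈ B ∧
      P = {x | (∀ f ∈ B, f x ≤ 1) ∧ (∀ f ∈ C, f x ≤ 0) ∧ (∀ f ∈ A, 1 ≤ f x)} := by
  classical
  obtain ⟨S, rfl⟩ := h.exists_halfSpaces
  refine ⟨insert 0 ((S.filter fun q => 0 < q.2).image fun q => q.2⁻¹ • q.1),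
    (S.filter fun q => q.2 = 0).image fun q => q.1,
    (S.filter fun q => q.2 < 0).image fun q => q.2⁻¹ • q.1, by simp, ?_⟩
  ext x
  simp only [Set.mem_ofPred_eq, Finset.forall_mem_insert, Finset.forall_mem_image,
    Finset.mem_filter, LinearMap.zero_apply, zero_le_one, true_and, LinearMap.smul_apply,
    smul_eq_mul]
  constructor
  · intro h
    refine ⟨fun q hq => ?_, fun q hq => ?_, fun q hq => ?_⟩
    · rw [inv_mul_le_iff₀ hq.2, mul_one]
      exact h q hq.1
    · exact (h q hq.1).trans hq.2.le
    · rw [← div_eq_inv_mul, one_le_div_of_neg hq.2]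
      exact h q hq.1
  · rintro ⟨h1, h2, h3⟩ q hq
    rcases lt_trichotomy q.2 0 with hq2 | hq2 | hq2
    · have := h3 ⟨hq, hq2⟩
      rwa [← div_eq_inv_mul, one_le_div_of_neg hq2] at this
    · exact (h2 ⟨hq, hq2⟩).trans hq2.ge
    · have := h1 ⟨hq, hq2⟩
      rwa [inv_mul_le_iff₀ hq2, mul_one] at this

/-- Let `D` be a valuation which vanishes on polytopes in linear hyperplanes. If `D` vanishes on
polytopes `G` in affine hyperplanes not through the origin and on the pyramids with base `G` and
apex the origin, then it vanishes on all polytopes. Indeed, the linear hyperplanes defined by the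
facet functionals and their differences dissect a polytope into truncated cones
`K ∩ {β ≤ 1} ∩ {1 ≤ α}`, which are differences of pyramids. -/
theorem CutVal.eq_zero_of_pyramids {D : Set V → ℝ} (hD : CutVal D)
    (hker : ∀ P, IsPoly P → ∀ f : V →ₗ[ℝ] ℝ, f ≠ 0 → P ⊆ {x | f x = 0} → D P = 0)
    (h0 : D {0} = 0)
    (hG : ∀ β : V →ₗ[ℝ] ℝ, β ≠ 0 → ∀ G, IsPoly G → G ⊆ {x | β x = 1} → ∀ o : Set V, o ⊆ {0} →
      D (convexHull ℝ (o ∪ G)) = 0)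
    (P : Set V) (hP : IsPoly P) : D P = 0 := by
  classical
  obtain ⟨B, C, A, hB0, hPeq⟩ := hP.exists_normalized
  have hG0 : ∀ β : V →ₗ[ℝ] ℝ, β ≠ 0 → ∀ G, IsPoly G → G ⊆ {x | β x = 1} → D G = 0 := by
    intro β hβ G hGp hGβ
    have := hG β hβ G hGp hGβ ∅ (Set.empty_subset _)
    rwa [Set.empty_union, hGp.convex.convexHull_eq] at this
  have hsmall : ∀ Q, Q ⊆ {(0 : V)} → D Q = 0 := by
    intro Q hQ
    rcases Set.subset_singleton_iff_eq.1 hQ with rfl | rfl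
    · exact hD.empty
    · exact h0
  have := hD.eq_zero_of_signs hker
    (B ∪ C ∪ A ∪ ((B ∪ A) ×ˢ (B ∪ A)).image fun q => q.1 - q.2) P Set.univ isCone_univ
    (by rwa [Set.inter_univ])
  rw [Set.inter_univ] at this
  refine this fun K hK hQ hsgn _ => ?_
  set Q := P ∩ K with hQdef
  have hsign : ∀ f ∈ B ∪ C ∪ A, (∀ x ∈ K, 0 ≤ f x) ∨ (∀ x ∈ K, f x ≤ 0) := fun f hf =>
    hsgn f (Finset.mem_union_left _ hf)
  have hcomp : ∀ f ∈ B ∪ A, ∀ g ∈ B ∪ A, (∀ x ∈ K, f x ≤ g x) ∨ (∀ x ∈ K, g x ≤ f x) := by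
    intro f hf g hg
    have := hsgn (f - g) (Finset.mem_union_right _ (Finset.mem_image.2
      ⟨(f, g), Finset.mem_product.2 ⟨hf, hg⟩, rfl⟩))
    rcases this with h | h
    · exact Or.inr fun x hx => by simpa using h x hx
    · exact Or.inl fun x hx => by simpa using h x hx
  rcases Set.eq_empty_or_nonempty Q with hQe | ⟨q, hqP, hqK⟩
  · rw [hQe, hD.empty]
  have hqP' := hqP
  rw [hPeq] at hqP'
  obtain ⟨hqB, hqC, hqA⟩ := hqP'
  -- constraints with right-hand side `0` are vacuous on `K` or force `Q` into a linear hyperplane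
  by_cases hC : ∀ f ∈ C, ∀ x ∈ K, f x ≤ 0
  swap
  · push Not at hC
    obtain ⟨f, hf, x, hx, hfx⟩ := hC
    refine hker Q hQ f (by rintro rfl; simp at hfx) fun y hy => ?_
    rcases hsign f (by simp [hf]) with h | h
    · have h1 := h y hy.2
      have h2 := hy.1
      rw [hPeq] at h2
      exact le_antisymm (h2.2.1 f hf) h1
    · exact absurd (h x hx) (not_le.2 hfx)
  obtain ⟨β, hβB, hβ⟩ := exists_forall_rel (fun f g : V →ₗ[ℝ] ℝ => ∀ x ∈ K, f x ≤ g x)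
    (fun a b c hab hbc x hx => (hab x hx).trans (hbc x hx)) B ⟨0, hB0⟩
    (fun a ha b hb => hcomp a (by simp [ha]) b (by simp [hb]))
  have hβ0 : ∀ x ∈ K, 0 ≤ β x := fun x hx => by simpa using hβ 0 hB0 x hx
  -- `K` contains no ray on which `β` vanishes, since such a ray could be added to `q ∈ Q`
  have hpos : (∀ f ∈ A, ∀ x ∈ K, 0 ≤ f x) → ∀ x ∈ K, x ≠ 0 → 0 < β x := by
    intro hA x hx hx0
    refine (hβ0 x hx).lt_of_ne fun hβx => ?_
    obtain ⟨g, hg⟩ : ∃ g : V →ₗ[ℝ] ℝ, 0 < g x := by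
      obtain ⟨g, hg⟩ := Module.Projective.exists_dual_ne_zero ℝ hx0
      rcases lt_or_gt_of_ne hg with h | h
      · exact ⟨-g, by simpa using h⟩
      · exact ⟨g, h⟩
    obtain ⟨M, hM⟩ := hQ.bddAbove g
    have hmem : ∀ t : ℝ, 0 < t → q + t • x ∈ Q := by
      intro t ht
      have hK' : q + t • x ∈ K := hK.add_mem hqK (hK.smul_mem t ht x hx)
      refine ⟨?_, hK'⟩
      rw [hPeq]
      refine ⟨fun f hf => (hβ f hf _ hK').trans ?_, fun f hf => hC f hf _ hK', fun f hf => ?_⟩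
      · simpa [← hβx] using hqB β hβB
      · have := hqA f hf
        have := mul_nonneg ht.le (hA f hf x hx)
        simp only [map_add, map_smul, smul_eq_mul]
        linarith
    have h1 := hM _ (hmem ((|M - g q| + 1) / g x) (by positivity))
    simp only [map_add, map_smul, smul_eq_mul, div_mul_cancel₀ _ hg.ne'] at h1
    linarith [le_abs_self (M - g q)]
  have hlin : ∀ x ∈ K, (∀ y ∈ K, y ≠ 0 → 0 < β y) → x ≠ 0 → β ≠ 0 := by
    rintro x hx h hx0 rfl
    simpa using h x hx hx0
  by_cases hKne : ∀ x ∈ K, x = 0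
  · exact hsmall Q fun x hx => hKne x hx.2
  push Not at hKne
  obtain ⟨z, hzK, hz0⟩ := hKne
  rcases A.eq_empty_or_nonempty with hAe | hAne
  · have hβpos := hpos (by simp [hAe])
    have hQeq : ∀ x ∈ K, (x ∈ Q ↔ β x ≤ 1) := by
      intro x hx
      rw [hQdef, hPeq]
      simp only [hAe, Set.mem_inter_iff, Set.mem_ofPred_eq, hx, and_true]
      exact ⟨fun h => h.1 β hβB, fun h => ⟨fun f hf => (hβ f hf x hx).trans h,
        fun f hf => hC f hf x hx, by simp⟩⟩
    have hQ1 : Q = K ∩ {x | β x ≤ 1} := by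
      ext x
      exact ⟨fun hx => ⟨hx.2, (hQeq x hx.2).1 hx⟩, fun hx => (hQeq x hx.1).2 hx.2⟩
    have hG1 : Q ∩ {x | β x = 1} = K ∩ {x | β x = 1} := by
      ext x
      exact ⟨fun hx => ⟨hx.1.2, hx.2⟩, fun hx => ⟨(hQeq x hx.1).2 (le_of_eq hx.2), hx.2⟩⟩
    rw [hQ1, hK.inter_le_one β hβpos, ← hG1]
    exact hG β (hlin z hzK hβpos hz0) _ (hQ.inter_eq β 1) Set.inter_subset_right {0} Set.Subset.rfl
  · obtain ⟨α, hαA, hα⟩ := exists_forall_rel (fun f g : V →ₗ[ℝ] ℝ => ∀ x ∈ K, g x ≤ f x)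
      (fun a b c hab hbc x hx => (hbc x hx).trans (hab x hx)) A hAne
      (fun a ha b hb => hcomp b (by simp [hb]) a (by simp [ha]))
    have hα0 : ∀ x ∈ K, 0 ≤ α x := by
      rcases hsign α (by simp [hαA]) with h | h
      · exact h
      · have := hqA α hαA
        linarith [h q hqK]
    have hβpos := hpos fun f hf x hx => (hα0 x hx).trans (hα f hf x hx)
    have hβne := hlin z hzK hβpos hz0
    have hQeq : ∀ x ∈ K, (x ∈ Q ↔ β x ≤ 1 ∧ 1 ≤ α x) := by
      intro x hx
      rw [hQdef, hPeq]
      simp only [Set.mem_inter_iff, Set.mem_ofPred_eq, hx, and_true]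
      exact ⟨fun h => ⟨h.1 β hβB, h.2.2 α hαA⟩, fun h => ⟨fun f hf => (hβ f hf x hx).trans h.1,
        fun f hf => hC f hf x hx, fun f hf => h.2.trans (hα f hf x hx)⟩⟩
    rcases hcomp α (by simp [hαA]) β (by simp [hβB]) with hαβ | hβα
    · refine hG0 β hβne Q hQ fun x hx => ?_
      have h1 := (hQeq x hx.2).1 hx
      exact le_antisymm h1.1 (h1.2.trans (hαβ x hx.2))
    · have hαpos : ∀ x ∈ K, x ≠ 0 → 0 < α x := fun x hx h => (hβpos x hx h).trans_le (hβα x hx)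
      have hαne : α ≠ 0 := by
        rintro rfl
        simpa using hαpos z hzK hz0
      have hGβ : Q ∩ {x | β x = 1} = K ∩ {x | β x = 1} := by
        ext x
        refine ⟨fun hx => ⟨hx.1.2, hx.2⟩, fun hx => ⟨(hQeq x hx.1).2 ⟨le_of_eq hx.2, ?_⟩, hx.2⟩⟩
        have h2 : β x = 1 := hx.2
        rw [← h2]
        exact hβα x hx.1
      have hGα : Q ∩ {x | α x = 1} = K ∩ {x | α x = 1} := by
        ext x
        refine ⟨fun hx => ⟨hx.1.2, hx.2⟩, fun hx => ⟨(hQeq x hx.1).2 ⟨?_, ge_of_eq hx.2⟩, hx.2⟩⟩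
        have h2 : α x = 1 := hx.2
        rw [← h2]
        exact hβα x hx.1
      have hpβ := hQ.inter_eq β 1
      have hpα := hQ.inter_eq α 1
      rw [hGβ] at hpβ
      rw [hGα] at hpα
      have hR := hK.inter_le_one β hβpos
      have hRp : IsPoly (K ∩ {x | β x ≤ 1}) := by
        rw [hR]
        obtain ⟨s, hs, hs'⟩ := hpβ.hull_insert 0
        exact ⟨s, hs, hs'⟩
      have hcut := hD.cut _ hRp α 1
      have e1 : K ∩ {x | β x ≤ 1} ∩ {x | α x = 1} = K ∩ {x | α x = 1} := by
        ext x
        refine ⟨fun hx => ⟨hx.1.1, hx.2⟩, fun hx => ⟨⟨hx.1, ?_⟩, hx.2⟩⟩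
        have h2 : α x = 1 := hx.2
        exact (hβα x hx.1).trans h2.le
      have e2 : K ∩ {x | β x ≤ 1} ∩ {x | α x ≤ 1} = K ∩ {x | α x ≤ 1} := by
        ext x
        exact ⟨fun hx => ⟨hx.1.1, hx.2⟩,
          fun hx => ⟨⟨hx.1, (hβα x hx.1).trans hx.2⟩, hx.2⟩⟩
      have e3 : K ∩ {x | β x ≤ 1} ∩ {x | 1 ≤ α x} = Q := by
        ext x
        exact ⟨fun hx => (hQeq x hx.1.1).2 ⟨hx.1.2, hx.2⟩,
          fun hx => ⟨⟨hx.2, ((hQeq x hx.2).1 hx).1⟩, ((hQeq x hx.2).1 hx).2⟩⟩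
      rw [e1, e2, e3, hR, hK.inter_le_one α hαpos,
        hG β hβne _ hpβ Set.inter_subset_right {0} Set.Subset.rfl,
        hG α hαne _ hpα Set.inter_subset_right {0} Set.Subset.rfl,
        hG0 α hαne _ hpα Set.inter_subset_right] at hcut
      linarith

end Cut

/-! ### Valuations are determined by their values on simplices -/

section Determination

universe u

variable {V : Type u} [AddCommGroup V] [Module ℝ V]

theorem IsPoly.hull_union {P : Set V} (h : IsPoly P) {o : Set V} (ho : o ⊆ {0}) :
    IsPoly (convexHull ℝ (o ∪ P)) := by
  rcases Set.subset_singleton_iff_eq.1 ho with rfl | rfl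
  · rw [Set.empty_union, h.convex.convexHull_eq]
    exact h
  · exact h.hull_insert 0

theorem convexHull_union_convexHull {o s : Set V} :
    convexHull ℝ (o ∪ convexHull ℝ s) = convexHull ℝ (o ∪ s) :=
  (convexHull ℝ).closure_sup_closure_right o s

/-- The copy in the affine hyperplane `β = 1` of a subset of the linear hyperplane `β = 0`. -/
def lift {β : V →ₗ[ℝ] ℝ} (x₀ : V) (G : Set (LinearMap.ker β)) : Set V :=
  (fun y : LinearMap.ker β => x₀ + (y : V)) '' G

theorem isPoly_lift {β : V →ₗ[ℝ] ℝ} (x₀ : V) {G : Set (LinearMap.ker β)} (h : IsPoly G) :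
    IsPoly (lift x₀ G) := by
  have := (h.image (LinearMap.ker β).subtype).add_left x₀
  rwa [Set.image_image] at this

theorem convexHull_lift {β : V →ₗ[ℝ] ℝ} (x₀ : V) (s : Set (LinearMap.ker β)) :
    convexHull ℝ (lift x₀ s) = lift x₀ (convexHull ℝ s) := by
  have h1 := (AffineEquiv.constVAdd ℝ V x₀).toAffineMap.image_convexHull
    ((LinearMap.ker β).subtype '' s)
  have h2 := (LinearMap.ker β).subtype.image_convexHull s
  rw [← h2, Set.image_image, Set.image_image] at h1
  exact h1.symm

theorem exists_lift {β : V →ₗ[ℝ] ℝ} {x₀ : V} (hx₀ : β x₀ = 1) {G : Set V} (hG : IsPoly G)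
    (hGβ : G ⊆ {x | β x = 1}) : ∃ G' : Set (LinearMap.ker β), IsPoly G' ∧ lift x₀ G' = G := by
  obtain ⟨s, hs, rfl⟩ := hG
  have hsβ := (subset_convexHull ℝ s).trans hGβ
  have hlift : lift x₀ ((fun y : LinearMap.ker β => x₀ + (y : V)) ⁻¹' s) = s := by
    refine Set.image_preimage_eq_of_subset fun x hx => ?_
    have : β x = 1 := hsβ hx
    exact ⟨⟨x - x₀, by simp [this, hx₀]⟩, by simp⟩
  refine ⟨convexHull ℝ ((fun y : LinearMap.ker β => x₀ + (y : V)) ⁻¹' s),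
    isPoly_convexHull (hs.preimage fun a _ b _ h => Subtype.ext (add_left_cancel h)), ?_⟩
  rw [← convexHull_lift, hlift]

/-- A functional inequality in the affine hyperplane `β = 1` is a linear one in the ambient
space. -/
theorem exists_functional {β : V →ₗ[ℝ] ℝ} {x₀ : V} (hx₀ : β x₀ = 1)
    (f : LinearMap.ker β →ₗ[ℝ] ℝ) (c : ℝ) :
    ∃ F : V →ₗ[ℝ] ℝ, ∀ y : LinearMap.ker β, F (x₀ + (y : V)) = f y - c := by
  obtain ⟨g, hg⟩ := LinearMap.exists_extend f
  refine ⟨g - (c + g x₀) • β, fun y => ?_⟩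
  have h1 : g y = f y := by rw [← hg]; rfl
  have h2 : β y = 0 := y.2
  simp only [LinearMap.sub_apply, map_add, LinearMap.smul_apply, h1, h2, hx₀, smul_eq_mul]
  ring

/-- Forming the polytope in the hyperplane `β = 1`, or the pyramid over it, turns valuations on the
ambient space into valuations on `ker β`, which allows induction on the dimension. -/
theorem CutVal.comp_lift {D : Set V → ℝ} (hD : CutVal D) (h0 : D {0} = 0) {β : V →ₗ[ℝ] ℝ} {x₀ : V}
    (hx₀ : β x₀ = 1) {o : Set V} (ho : o ⊆ {0}) :
    CutVal fun G : Set (LinearMap.ker β) => D (convexHull ℝ (o ∪ lift x₀ G)) where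
  empty := by
    rcases Set.subset_singleton_iff_eq.1 ho with rfl | rfl
    · simpa [lift] using hD.empty
    · simpa [lift] using h0
  cut G hG f c := by
    obtain ⟨F, hF⟩ := exists_functional hx₀ f c
    have key : ∀ (K : Set V) (L : Set (LinearMap.ker β)), IsCone K →
        (∀ y : LinearMap.ker β, x₀ + (y : V) ∈ K ↔ y ∈ L) →
        convexHull ℝ (o ∪ lift x₀ (G ∩ L)) = convexHull ℝ (o ∪ lift x₀ G) ∩ K := by
      intro K L hK hKL
      rw [convexHull_union_inter_cone ho (isPoly_lift x₀ hG).convex hK]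
      congr 2
      ext x
      constructor
      · rintro ⟨y, ⟨hy, hyL⟩, rfl⟩
        exact ⟨⟨y, hy, rfl⟩, (hKL y).2 hyL⟩
      · rintro ⟨⟨y, hy, rfl⟩, hyK⟩
        exact ⟨y, ⟨hy, (hKL y).1 hyK⟩, rfl⟩
    rw [key _ _ (isCone_eq F) fun y => by simp [hF, sub_eq_zero],
      key _ _ (isCone_le F) fun y => by simp [hF],
      key _ _ (isCone_ge F) fun y => by simp [hF]]
    exact hD.cut _ ((isPoly_lift x₀ hG).hull_union ho) F 0

/-- Polytopes in a hyperplane of the affine hyperplane `β = 1` lie, together with the pyramids over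
them, in a linear hyperplane. -/
theorem exists_hyperplane_of_lift {β : V →ₗ[ℝ] ℝ} {x₀ : V} (hx₀ : β x₀ = 1) {o : Set V}
    (ho : o ⊆ {0}) {f : LinearMap.ker β →ₗ[ℝ] ℝ} (hf : f ≠ 0) {c : ℝ}
    {G : Set (LinearMap.ker β)} (hG : G ⊆ {x | f x = c}) :
    ∃ F : V →ₗ[ℝ] ℝ, F ≠ 0 ∧ convexHull ℝ (o ∪ lift x₀ G) ⊆ {x | F x = 0} := by
  obtain ⟨F, hF⟩ := exists_functional hx₀ f c
  refine ⟨F, ?_, convexHull_min ?_ (isCone_eq F).convex⟩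
  · rintro rfl
    refine hf (LinearMap.ext fun y => ?_)
    have h1 := hF y
    have h2 := hF 0
    simp at h1 h2
    simp only [LinearMap.zero_apply]
    linarith
  · rintro x (hx | ⟨y, hy, rfl⟩)
    · rw [ho hx]; simp
    · have : f y = c := hG hy
      simp [hF, this]

theorem linearIndependent_lift {β : V →ₗ[ℝ] ℝ} {x₀ : V} (hx₀ : β x₀ = 1) {ι : Type*} [Fintype ι]
    {v : ι → LinearMap.ker β} (hv : AffineIndependent ℝ v) :
    LinearIndependent ℝ fun i => x₀ + (v i : V) := by
  rw [Fintype.linearIndependent_iff]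
  intro g hg
  have h1 : ∑ i, g i = 0 := by
    have := congrArg β hg
    simpa [hx₀] using this
  have h2 : ∑ i, g i • v i = 0 := by
    apply Subtype.ext
    simp only [smul_add, Finset.sum_add_distrib, ← Finset.sum_smul, h1, zero_smul, zero_add] at hg
    simpa using hg
  have h3 := affineIndependent_iff.1 hv Finset.univ g h1 h2
  exact fun i => h3 i (Finset.mem_univ i)

theorem exists_apply_eq_one {β : V →ₗ[ℝ] ℝ} (hβ : β ≠ 0) : ∃ x, β x = 1 :=
  LinearMap.surjective hβ 1

variable [FiniteDimensional ℝ V]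

theorem finrank_ker_functional {m : ℕ} (hm : Module.finrank ℝ V = m + 1) {β : V →ₗ[ℝ] ℝ}
    (hβ : β ≠ 0) : Module.finrank ℝ (LinearMap.ker β) = m := by
  have h1 := LinearMap.finrank_range_add_finrank_ker β
  have h2 : LinearMap.range β = ⊤ := LinearMap.range_eq_top.2 (LinearMap.surjective hβ)
  rw [h2, finrank_top, Module.finrank_self] at h1
  omega

/-- A valuation which vanishes on lower-dimensional polytopes and on simplices is zero. The ambient
space varies in the induction on the dimension. -/
theorem CutVal.eq_zero_of_simplices (m : ℕ) : ∀ {V : Type u} [AddCommGroup V] [Module ℝ V]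
    [FiniteDimensional ℝ V], Module.finrank ℝ V = m → ∀ {D : Set V → ℝ}, CutVal D →
    (∀ P, IsPoly P → ∀ (f : V →ₗ[ℝ] ℝ) (c : ℝ), f ≠ 0 → P ⊆ {x | f x = c} → D P = 0) →
    (∀ v : Fin (m + 1) → V, AffineIndependent ℝ v → D (convexHull ℝ (Set.range v)) = 0) →
    ∀ P, IsPoly P → D P = 0 := by
  induction m with
  | zero =>
    intro V _ _ _ hV D hD _ hsimp P hP
    have : Subsingleton V := Module.finrank_zero_iff.1 hV
    rcases Set.eq_empty_or_nonempty P with rfl | hne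
    · exact hD.empty
    · have h := hsimp (fun _ => 0) (by
        rw [affineIndependent_iff_of_fintype]
        intro w hw _ i
        rw [Fin.sum_univ_one] at hw
        rwa [Subsingleton.elim (α := Fin 1) i 0])
      have hu : ∀ s : Set V, s.Nonempty → s = Set.univ := fun s hs => hs.eq_univ
      rw [hu P hne]
      rwa [hu _ ((Set.range_nonempty _).mono (subset_convexHull ℝ _))] at h
  | succ m ih =>
    intro V _ _ _ hV D hD hlow hsimp P hP
    have h0 : D {0} = 0 := by
      have : Nontrivial V := Module.nontrivial_of_finrank_pos (R := ℝ) (by omega)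
      obtain ⟨x, hx⟩ := exists_ne (0 : V)
      obtain ⟨f, hf⟩ := Module.Projective.exists_dual_ne_zero ℝ hx
      refine hlow {0} ⟨{0}, Set.finite_singleton 0, by simp⟩ f 0 ?_ (by simp)
      rintro rfl
      simp at hf
    refine hD.eq_zero_of_pyramids (fun P hP f hf h => hlow P hP f 0 hf h) h0 ?_ P hP
    intro β hβ G hG hGβ o ho
    obtain ⟨x₀, hx₀⟩ := exists_apply_eq_one hβ
    rcases Set.subset_singleton_iff_eq.1 ho with rfl | rfl
    · rw [Set.empty_union, hG.convex.convexHull_eq]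
      exact hlow G hG β 1 hβ hGβ
    obtain ⟨G', hG', rfl⟩ := exists_lift hx₀ hG hGβ
    refine ih (finrank_ker_functional hV hβ) (hD.comp_lift h0 hx₀ ho) ?_ ?_ G' hG'
    · intro Q hQ f c hf hQf
      obtain ⟨F, hF, hsub⟩ := exists_hyperplane_of_lift hx₀ ho hf hQf
      exact hlow _ ((isPoly_lift x₀ hQ).hull_union ho) F 0 hF hsub
    · intro v hv
      have hind : AffineIndependent ℝ (Fin.cons 0 fun i => x₀ + (v i : V) : Fin (m + 2) → V) := by
        have h1 := Fintype.linearIndependent_iff.1 (linearIndependent_lift hx₀ hv)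
        rw [affineIndependent_iff_of_fintype]
        intro w hw hw0
        rw [Finset.univ.weightedVSub_eq_linear_combination hw, Fin.sum_univ_succ] at hw0
        simp only [Fin.cons_zero, Fin.cons_succ, smul_zero, zero_add] at hw0
        have h2 := h1 _ hw0
        rw [Fin.sum_univ_succ, Finset.sum_eq_zero fun i _ => h2 i, add_zero] at hw
        exact Fin.cases hw h2
      have := hsimp _ hind
      rw [Fin.range_cons, Set.insert_eq] at this
      rw [← convexHull_lift]
      have e1 : lift x₀ (Set.range v) = Set.range fun i => x₀ + (v i : V) := by
        rw [lift, ← Set.range_comp]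
        rfl
      rw [e1, convexHull_union_convexHull]
      exact this

/-- A valuation which vanishes on polytopes in linear hyperplanes is determined by its values on
the simplices `conv {v₁, …, vₙ}` and `conv {0, v₁, …, vₙ}` for linearly independent `vᵢ`. -/
theorem CutVal.eq_zero_of_bases {m : ℕ} (hV : Module.finrank ℝ V = m + 1) {D : Set V → ℝ}
    (hD : CutVal D)
    (hker : ∀ P, IsPoly P → ∀ f : V →ₗ[ℝ] ℝ, f ≠ 0 → P ⊆ {x | f x = 0} → D P = 0)
    (hbasis : ∀ o : Set V, o ⊆ {0} → ∀ v : Fin (m + 1) → V, LinearIndependent ℝ v →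
      D (convexHull ℝ (o ∪ Set.range v)) = 0)
    (P : Set V) (hP : IsPoly P) : D P = 0 := by
  have h0 : D {0} = 0 := by
    have : Nontrivial V := Module.nontrivial_of_finrank_pos (R := ℝ) (by omega)
    obtain ⟨x, hx⟩ := exists_ne (0 : V)
    obtain ⟨f, hf⟩ := Module.Projective.exists_dual_ne_zero ℝ hx
    refine hker {0} ⟨{0}, Set.finite_singleton 0, by simp⟩ f ?_ (by simp)
    rintro rfl
    simp at hf
  refine hD.eq_zero_of_pyramids hker h0 ?_ P hP
  intro β hβ G hG hGβ o ho
  obtain ⟨x₀, hx₀⟩ := exists_apply_eq_one hβ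
  obtain ⟨G', hG', rfl⟩ := exists_lift hx₀ hG hGβ
  refine CutVal.eq_zero_of_simplices m (finrank_ker_functional hV hβ) (hD.comp_lift h0 hx₀ ho)
    ?_ ?_ G' hG'
  · intro Q hQ f c hf hQf
    obtain ⟨F, hF, hsub⟩ := exists_hyperplane_of_lift hx₀ ho hf hQf
    exact hker _ ((isPoly_lift x₀ hQ).hull_union ho) F hF hsub
  · intro v hv
    have e1 : lift x₀ (Set.range v) = Set.range fun i => x₀ + (v i : V) := by
      rw [lift, ← Set.range_comp]
      rfl
    rw [← convexHull_lift, e1, convexHull_union_convexHull]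
    exact hbasis o ho _ (linearIndependent_lift hx₀ hv)

end Determination

/-! ### The functional equation on simplices -/

section FunctionalEquation

/-- Cauchy's functional equation for nonnegative functions on the positive half-line. -/
theorem eq_mul_of_add {h : ℝ → ℝ} (h0 : ∀ d, 0 < d → 0 ≤ h d)
    (hadd : ∀ a b, 0 < a → 0 < b → h (a + b) = h a + h b) {d : ℝ} (hd : 0 < d) :
    h d = d * h 1 := by
  have hnat : ∀ (m : ℕ) (d : ℝ), 0 < d → h ((m + 1 : ℕ) * d) = (m + 1 : ℕ) * h d := by
    intro m d hd
    induction m with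
    | zero => simp
    | succ m ih =>
      have : ((m + 1 + 1 : ℕ) : ℝ) * d = (m + 1 : ℕ) * d + d := by push_cast; ring
      rw [this, hadd _ _ (by positivity) hd, ih]
      push_cast
      ring
  have hmono : ∀ a b, 0 < a → a ≤ b → h a ≤ h b := by
    intro a b ha hab
    rcases hab.eq_or_lt with rfl | hab
    · rfl
    · have := hadd a (b - a) ha (by linarith)
      rw [add_sub_cancel] at this
      linarith [h0 (b - a) (by linarith)]
  have hint : ∀ m : ℕ, 0 < m → h m = m * h 1 := by
    intro m hm
    obtain ⟨k, rfl⟩ := Nat.exists_eq_add_of_le' hm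
    simpa using hnat k 1 one_pos
  have hbound : ∀ N : ℕ, (N + 1 : ℕ) * |h d - d * h 1| ≤ h 1 := by
    intro N
    have e := hnat N d hd
    have hpos : 0 < ((N + 1 : ℕ) : ℝ) * d := by positivity
    set y := ((N + 1 : ℕ) : ℝ) * d with hy
    have h1 : h y ≤ (⌊y⌋₊ + 1 : ℕ) * h 1 := by
      rw [← hint _ (Nat.succ_pos _)]
      exact hmono _ _ hpos (by push_cast; exact (Nat.lt_floor_add_one y).le)
    have h2 : (⌊y⌋₊ : ℝ) * h 1 ≤ h y := by
      rcases Nat.eq_zero_or_pos ⌊y⌋₊ with hz | hz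
      · rw [hz, Nat.cast_zero, zero_mul]
        exact h0 y hpos
      · rw [← hint _ hz]
        exact hmono _ _ (by exact_mod_cast hz) (Nat.floor_le hpos.le)
    have h3 : (⌊y⌋₊ : ℝ) * h 1 ≤ y * h 1 :=
      mul_le_mul_of_nonneg_right (Nat.floor_le hpos.le) (h0 1 one_pos)
    have h4 : y * h 1 ≤ (⌊y⌋₊ + 1 : ℕ) * h 1 :=
      mul_le_mul_of_nonneg_right (by push_cast; exact (Nat.lt_floor_add_one y).le) (h0 1 one_pos)
    have h5 : ((N + 1 : ℕ) : ℝ) * |h d - d * h 1| = |h y - y * h 1| := by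
      rw [e, hy, mul_assoc, ← mul_sub, abs_mul, Nat.abs_cast]
    rw [h5, abs_le]
    push_cast at h1 h4
    constructor <;> linarith
  by_contra hne
  have hpos : 0 < |h d - d * h 1| := abs_pos.2 (sub_ne_zero.2 hne)
  obtain ⟨N, hN⟩ := exists_nat_gt (h 1 / |h d - d * h 1|)
  rw [div_lt_iff₀ hpos] at hN
  have := hbound N
  push_cast at this
  linarith

variable {n : ℕ}

/-- Replace the coordinates `i` and `j` of `x` by `a` and `b`. -/
def upd₂ (x : Fin n → ℝ) (i j : Fin n) (a b : ℝ) : Fin n → ℝ :=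
  Function.update (Function.update x i a) j b

theorem upd₂_left (x : Fin n → ℝ) {i j : Fin n} (hij : i ≠ j) (a b : ℝ) : upd₂ x i j a b i = a := by
  simp [upd₂, hij]

theorem upd₂_right (x : Fin n → ℝ) (i j : Fin n) (a b : ℝ) : upd₂ x i j a b j = b := by
  simp [upd₂]

theorem upd₂_other (x : Fin n → ℝ) {i j k : Fin n} (hi : k ≠ i) (hj : k ≠ j) (a b : ℝ) :
    upd₂ x i j a b k = x k := by
  simp [upd₂, hi, hj]

theorem upd₂_comm (x : Fin n → ℝ) {i j : Fin n} (hij : i ≠ j) (a b : ℝ) :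
    upd₂ x i j a b = upd₂ x j i b a :=
  Function.update_comm hij _ _ _

theorem upd₂_eq_self (x : Fin n → ℝ) (i j : Fin n) {a b : ℝ} (ha : a = x i) (hb : b = x j) :
    upd₂ x i j a b = x := by
  subst ha hb
  simp [upd₂]

theorem upd₂_upd₂ (x : Fin n → ℝ) {i j : Fin n} (hij : i ≠ j) (a b c d : ℝ) :
    upd₂ (upd₂ x i j a b) i j c d = upd₂ x i j c d := by
  funext k
  by_cases hj : k = j
  · subst hj; simp [upd₂]
  · by_cases hi : k = i
    · subst hi; simp [upd₂, hij]
    · simp [upd₂, hi, hj]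

theorem sum_upd₂ (x : Fin n → ℝ) {i j : Fin n} (hij : i ≠ j) (a b : ℝ) :
    ∑ k, upd₂ x i j a b k = ∑ k, x k - x i - x j + a + b := by
  have : upd₂ x i j a b = x + Pi.single i (a - x i) + Pi.single j (b - x j) := by
    funext k
    by_cases hj : k = j
    · subst hj; simp [upd₂, hij]
    · by_cases hi : k = i
      · subst hi; simp [upd₂, hij]
      · simp [upd₂, hi, hj]
  rw [this]
  simp only [Pi.add_apply, Finset.sum_add_distrib, Finset.sum_pi_single', Finset.mem_univ, if_true]
  ring

/-- The functional equation satisfied by the values of a valuation on the simplices spanned by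
bases: `f d x` stands for the value at `∑ xᵢ vᵢ` for a basis `v` with determinant `d`, and the
identity `split` comes from dissecting the simplex through a point of the edge `[vᵢ, vⱼ]`. -/
structure SplitEq (p : ℝ) (f : ℝ → (Fin n → ℝ) → ℝ) : Prop where
  nonneg : ∀ d, 0 < d → ∀ x, 0 ≤ f d x
  homog : ∀ d, 0 < d → ∀ c, 0 < c → ∀ x, f d (c • x) = c ^ p * f d x
  cont : ∀ d, 0 < d → Continuous (f d)
  perm : ∀ d, 0 < d → ∀ σ : Equiv.Perm (Fin n), Equiv.Perm.sign σ = 1 → ∀ x, f d (x ∘ σ) = f d x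
  split : ∀ d, 0 < d → ∀ i j, i ≠ j → ∀ l, 0 < l → l < 1 → ∀ x,
    f d x = f (l * d) (upd₂ x i j (x i / l) (x j - x i * (1 - l) / l)) +
      f ((1 - l) * d) (upd₂ x i j (x i - x j * l / (1 - l)) (x j / (1 - l)))

theorem exists_two_ne (hn : 3 ≤ n) (k : Fin n) : ∃ i j : Fin n, i ≠ j ∧ i ≠ k ∧ j ≠ k := by
  have : 1 < (Finset.univ.erase k).card := by
    rw [Finset.card_erase_of_mem (Finset.mem_univ k), Finset.card_fin]
    omega
  obtain ⟨i, hi, j, hj, hij⟩ := Finset.one_lt_card.1 this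
  exact ⟨i, j, hij, Finset.ne_of_mem_erase hi, Finset.ne_of_mem_erase hj⟩

/-- Only a dissection along an edge `[vᵢ, vⱼ]` with `i, j ≠ k` is needed here; it leaves the
multiples of the `k`-th unit vector unchanged and gives Cauchy's functional equation in `d`. -/
theorem SplitEq.single_eq {p : ℝ} {f : ℝ → (Fin n → ℝ) → ℝ} (hf : SplitEq p f) (hn : 3 ≤ n) {d : ℝ}
    (hd : 0 < d) (k : Fin n) (s : ℝ) : f d (Pi.single k s) = d * f 1 (Pi.single k s) := by
  obtain ⟨i, j, hij, hik, hjk⟩ := exists_two_ne hn k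
  refine eq_mul_of_add (h := fun d => f d (Pi.single k s)) (fun d hd => hf.nonneg d hd _) ?_ hd
  intro a b ha hb
  have hab : 0 < a + b := by linarith
  have := hf.split (a + b) hab i j hij (a / (a + b)) (by positivity)
    (by rw [div_lt_one hab]; linarith) (Pi.single k s)
  rw [upd₂_eq_self _ _ _ (by simp [hik]) (by simp [hik, hjk]),
    upd₂_eq_self _ _ _ (by simp [hik, hjk]) (by simp [hjk])] at this
  have e1 : a / (a + b) * (a + b) = a := by field_simp
  have e2 : (1 - a / (a + b)) * (a + b) = b := by field_simp; ring
  rwa [e1, e2] at this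

theorem SplitEq.single_swap {p : ℝ} {f : ℝ → (Fin n → ℝ) → ℝ} (hf : SplitEq p f) (hn : 3 ≤ n)
    (k l : Fin n) (s : ℝ) : f 1 (Pi.single k s) = f 1 (Pi.single l s) := by
  by_cases hkl : k = l
  · rw [hkl]
  have : ∃ j, j ≠ k ∧ j ≠ l := by
    obtain ⟨i, j, hij, hik, hjk⟩ := exists_two_ne hn k
    by_cases hi : i = l
    · exact ⟨j, hjk, fun h => hij (hi.trans h.symm)⟩
    · exact ⟨i, hik, hi⟩
  obtain ⟨j, hjk, hjl⟩ := this
  -- a `3`-cycle is an even permutation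
  have h := hf.perm 1 one_pos (Equiv.swap k j * Equiv.swap j l)
    (by rw [Equiv.Perm.sign_mul, Equiv.Perm.sign_swap hjk.symm, Equiv.Perm.sign_swap hjl]; rfl)
    (Pi.single k s)
  rw [← h]
  congr 1
  funext m
  have hiff : (Equiv.swap k j * Equiv.swap j l) m = k ↔ m = l :=
    (Equiv.swap k j * Equiv.swap j l).injective.eq_iff' (by simp)
  simp only [Function.comp_apply, Pi.single_apply, hiff]

/-- The number of nonzero coordinates. -/
def nnz (x : Fin n → ℝ) : ℕ := (Finset.univ.filter fun k => x k ≠ 0).card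

theorem nnz_upd₂_lt {x : Fin n → ℝ} {i j : Fin n} (hij : i ≠ j) (hi : x i ≠ 0) (hj : x j ≠ 0)
    (a : ℝ) : nnz (upd₂ x i j a 0) < nnz x := by
  refine Finset.card_lt_card (Finset.ssubset_iff_of_subset ?_ |>.2 ⟨j, by simp [hj], ?_⟩)
  · intro k hk
    simp only [Finset.mem_filter, Finset.mem_univ, true_and] at hk ⊢
    by_cases hkj : k = j
    · subst hkj; exact hj
    · by_cases hki : k = i
      · subst hki; exact hi
      · rwa [upd₂_other _ hki hkj] at hk
  · simp [upd₂_right]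

/-- The induction step for coordinates `xᵢ`, `xⱼ` of opposite signs. -/
theorem SplitEq.step_opposite {p : ℝ} {f : ℝ → (Fin n → ℝ) → ℝ} (hf : SplitEq p f) {g : ℝ → ℝ}
    {x : Fin n → ℝ} {i j : Fin n} (hij : i ≠ j)
    (hl : 0 < (x i + x j) / x i) (hl1 : (x i + x j) / x i < 1)
    (ih : ∀ d, 0 < d → f d (upd₂ x i j (x i + x j) 0) = d * g (∑ k, x k)) {d : ℝ} (hd : 0 < d) :
    f d x = d * g (∑ k, x k) := by
  set l := (x i + x j) / x i with hldef
  have hxi : x i ≠ 0 := by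
    intro h
    rw [hldef, h, div_zero] at hl
    exact lt_irrefl _ hl
  have hli : (x i + x j) / l = x i := by
    rw [div_eq_iff hl.ne', hldef]
    field_simp
  have h := hf.split (d / l) (by positivity) i j hij l hl hl1 (upd₂ x i j (x i + x j) 0)
  rw [upd₂_left _ hij, upd₂_right, upd₂_upd₂ _ hij, upd₂_upd₂ _ hij, ih _ (by positivity),
    zero_mul, zero_div, sub_zero,
    ih _ (mul_pos (by linarith) (by positivity)), hli, mul_div_cancel₀ _ hl.ne',
    upd₂_eq_self x i j rfl] at h
  · have e : d / l = d + (1 - l) * (d / l) := by field_simp; ring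
    linear_combination (-1 : ℝ) * h + g (∑ k, x k) * e
  · have e : (x i + x j) * (1 - l) / l = (x i + x j) / l - (x i + x j) := by
      field_simp
    rw [e, hli]
    ring

/-- The induction step on the number of nonzero coordinates. If `xᵢ` and `xⱼ` have the same sign,
then dissecting the edge at the ratio `xᵢ / (xᵢ + xⱼ)` annihilates a coordinate in both parts;
otherwise `x` appears in the dissection of a vector with fewer nonzero coordinates. -/
theorem SplitEq.step {p : ℝ} {f : ℝ → (Fin n → ℝ) → ℝ} (hf : SplitEq p f) {g : ℝ → ℝ}
    {x : Fin n → ℝ} {i j : Fin n} (hij : i ≠ j) (hi : x i ≠ 0) (hj : x j ≠ 0) (hs : x i + x j ≠ 0)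
    (ih : ∀ y, nnz y < nnz x → ∀ d, 0 < d → f d y = d * g (∑ k, y k)) {d : ℝ} (hd : 0 < d) :
    f d x = d * g (∑ k, x k) := by
  have ihi : ∀ d, 0 < d → f d (upd₂ x i j (x i + x j) 0) = d * g (∑ k, x k) := by
    intro d hd
    rw [ih _ (nnz_upd₂_lt hij hi hj _) d hd, sum_upd₂ _ hij]
    congr 2
    ring
  have ihj : ∀ d, 0 < d → f d (upd₂ x j i (x j + x i) 0) = d * g (∑ k, x k) := by
    intro d hd
    rw [ih _ (nnz_upd₂_lt hij.symm hj hi _) d hd, sum_upd₂ _ hij.symm]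
    congr 2
    ring
  by_cases h1 : 0 < (x i + x j) / x i
  · by_cases h2 : 0 < (x i + x j) / x j
    · -- the coordinates have the same sign
      have hl : 0 < x i / (x i + x j) := by rw [← inv_div]; exact inv_pos.2 h1
      have hl' : 1 - x i / (x i + x j) = x j / (x i + x j) := by field_simp; ring
      have hl1 : 0 < x j / (x i + x j) := by rw [← inv_div]; exact inv_pos.2 h2
      have h := hf.split d hd i j hij (x i / (x i + x j)) hl (by linarith) x
      rw [hl'] at h
      have e1 : x i / (x i / (x i + x j)) = x i + x j := by field_simp
      have e2 : x j - x i * (x j / (x i + x j)) / (x i / (x i + x j)) = 0 := by field_simp; ring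
      have e3 : x i - x j * (x i / (x i + x j)) / (x j / (x i + x j)) = 0 := by field_simp; ring
      have e4 : x j / (x j / (x i + x j)) = x j + x i := by field_simp; ring
      rw [e1, e2, e3, e4, upd₂_comm x hij 0, ihi _ (mul_pos hl hd), ihj _ (mul_pos hl1 hd)] at h
      rw [h, ← hl']
      ring
    · refine hf.step_opposite hij h1 ?_ ihi hd
      have h3 : (x i + x j) / x i - 1 = x j / x i := by field_simp; ring
      have h4 : (x i + x j) / x j < 0 := lt_of_le_of_ne (not_lt.1 h2) (div_ne_zero hs hj)
      have : x j / x i < 0 := by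
        have e : x j / x i = ((x i + x j) / x i) / ((x i + x j) / x j) := by field_simp
        rw [e]
        exact div_neg_of_pos_of_neg h1 h4
      linarith
  · have h4 : (x i + x j) / x i < 0 := lt_of_le_of_ne (not_lt.1 h1) (div_ne_zero hs hi)
    have h5 : x j / x i < -1 := by
      have h3 : (x i + x j) / x i - 1 = x j / x i := by field_simp; ring
      linarith
    have h6 : (x j + x i) / x j = 1 + (x j / x i)⁻¹ := by field_simp
    have h7 : (x j / x i)⁻¹ < 0 := inv_lt_zero.2 (by linarith)
    have h8 : -1 < (x j / x i)⁻¹ := by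
      rw [← neg_lt_neg_iff, neg_neg, ← inv_neg]
      exact inv_lt_one_of_one_lt₀ (by linarith)
    exact hf.step_opposite hij.symm (by rw [h6]; linarith) (by rw [h6]; linarith) ihj hd

/-- The solutions of the functional equation only depend on `d` and the sum of the coordinates. -/
theorem SplitEq.eq_mul_sum {p : ℝ} {f : ℝ → (Fin n → ℝ) → ℝ} (hf : SplitEq p f) (hn : 3 ≤ n)
    (k₀ : Fin n) (x : Fin n → ℝ) :
    ∀ d, 0 < d → f d x = d * f 1 (Pi.single k₀ (∑ k, x k)) := by
  induction hN : nnz x using Nat.strong_induction_on generalizing x with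
  | _ N ih =>
  have ih' : ∀ y, nnz y < N → ∀ d, 0 < d → f d y = d * f 1 (Pi.single k₀ (∑ k, y k)) :=
    fun y hy => ih _ hy y rfl
  intro d hd
  by_cases hN1 : N ≤ 1
  · obtain ⟨k, hk⟩ : ∃ k, ∀ m, m ≠ k → x m = 0 := by
      have : Nonempty (Fin n) := ⟨k₀⟩
      rw [← hN, nnz, Finset.card_le_one_iff_subset_singleton] at hN1
      · obtain ⟨k, hk⟩ := hN1
        refine ⟨k, fun m hm => ?_⟩
        by_contra hne
        exact hm (Finset.mem_singleton.1 (hk (by simp [hne])))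
    have hx : x = Pi.single k (x k) := by
      funext m
      by_cases hm : m = k
      · subst hm; simp
      · rw [hk m hm, Pi.single_eq_of_ne hm]
    have hsum : ∑ m, x m = x k := Finset.sum_eq_single k (fun m _ hm => hk m hm) (by simp)
    rw [hsum, hf.single_swap hn k₀ k, ← hf.single_eq hn hd, ← hx]
  · obtain ⟨i, hi, j, hj, hij⟩ := Finset.one_lt_card.1 (by rw [nnz] at hN; omega :
      1 < (Finset.univ.filter fun k => x k ≠ 0).card)
    simp only [Finset.mem_filter, Finset.mem_univ, true_and] at hi hj
    by_cases hs : x i + x j ≠ 0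
    · exact hf.step (g := fun s => f 1 (Pi.single k₀ s)) hij hi hj hs (hN ▸ ih') hd
    -- if `xᵢ + xⱼ = 0`, perturb `xᵢ` and use continuity
    push Not at hs
    let y : ℝ → Fin n → ℝ := fun t => Function.update x i (x i + t)
    have hyc : Continuous y := by
      refine continuous_pi fun k => ?_
      by_cases hk : k = i
      · subst hk; simp only [y, Function.update_self]; fun_prop
      · simp only [y, Function.update_of_ne hk]; fun_prop
    have hy0 : y 0 = x := by simp [y]
    have hg : Continuous fun t => d * f 1 (Pi.single k₀ (∑ k, y t k)) := by
      refine continuous_const.mul ((hf.cont 1 one_pos).comp ?_)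
      refine (continuous_single k₀).comp ?_
      fun_prop
    have hfc : Continuous fun t => f d (y t) := (hf.cont d hd).comp hyc
    have hev : ∀ᶠ t in nhdsWithin (0 : ℝ) {0}ᶜ,
        f d (y t) = d * f 1 (Pi.single k₀ (∑ k, y t k)) := by
      have h1 : ∀ᶠ t in nhdsWithin (0 : ℝ) {0}ᶜ, x i + t ≠ 0 :=
        nhdsWithin_le_nhds ((continuous_const.add continuous_id).continuousAt.eventually_ne
          (by simpa using hi))
      filter_upwards [h1, self_mem_nhdsWithin] with t ht ht0
      have hyi : y t i = x i + t := by simp [y]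
      have hyj : y t j = x j := by simp [y, hij.symm]
      have hnz : nnz (y t) = nnz x := by
        unfold nnz
        congr 1
        ext k
        by_cases hk : k = i
        · subst hk; simp [hyi, ht, hi]
        · simp [y, hk]
      refine hf.step (g := fun s => f 1 (Pi.single k₀ s)) hij (by rwa [hyi]) (by rwa [hyj]) ?_ ?_ hd
      · rw [hyi, hyj, add_right_comm, hs, zero_add]
        exact ht0
      · rw [hnz, hN]
        exact ih'
    have h1 := (hfc.tendsto 0).mono_left (nhdsWithin_le_nhds (s := {0}ᶜ))
    have h2 := (hg.tendsto 0).mono_left (nhdsWithin_le_nhds (s := {0}ᶜ))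
    have := tendsto_nhds_unique (h1.congr' hev) h2
    simpa [hy0] using this

/-- The general solution of the functional equation. -/
theorem SplitEq.eq {p : ℝ} (hp : 0 < p) {f : ℝ → (Fin n → ℝ) → ℝ} (hf : SplitEq p f) (hn : 3 ≤ n)
    (k₀ : Fin n) {d : ℝ} (hd : 0 < d) (x : Fin n → ℝ) :
    f d x = d * (f 1 (Pi.single k₀ 1) * max (∑ k, x k) 0 ^ p +
      f 1 (Pi.single k₀ (-1)) * max (-∑ k, x k) 0 ^ p) := by
  rw [hf.eq_mul_sum hn k₀ x d hd]
  congr 1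
  generalize ∑ k, x k = S
  have hsm : ∀ (c s : ℝ), (Pi.single k₀ (c * s) : Fin n → ℝ) = c • Pi.single k₀ s := by
    intro c s
    rw [← Pi.single_smul, smul_eq_mul]
  rcases lt_trichotomy S 0 with h | rfl | h
  · have := hf.homog 1 one_pos (-S) (by linarith) (Pi.single k₀ (-1))
    rw [← hsm, neg_mul_neg, mul_one] at this
    rw [this, max_eq_right h.le, max_eq_left (by linarith), Real.zero_rpow hp.ne']
    ring
  · have := hf.homog 1 one_pos 2 two_pos (Pi.single k₀ 0)
    rw [← hsm, mul_zero] at this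
    have h2 : (1 : ℝ) < 2 ^ p := Real.one_lt_rpow one_lt_two hp
    have h3 : (2 ^ p - 1) * f 1 (Pi.single k₀ 0) = 0 := by linarith
    rcases mul_eq_zero.1 h3 with h4 | h4
    · linarith
    · rw [h4, neg_zero, max_self, Real.zero_rpow hp.ne']
      ring
  · have := hf.homog 1 one_pos S h (Pi.single k₀ 1)
    rw [← hsm, mul_one] at this
    rw [this, max_eq_left h.le, max_eq_right (by linarith), Real.zero_rpow hp.ne']
    ring

end FunctionalEquation

/-! ### Contravariant valuations on simplices and in hyperplanes -/

section Split

universe u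

variable {V : Type u} [AddCommGroup V] [Module ℝ V] {ι : Type*} [DecidableEq ι]

theorem split_le {o : Set V} (ho : o ⊆ {0}) (v : ι → V) {i j : ι} (hij : i ≠ j) {l : ℝ} (hl : 0 < l)
    (hl1 : l < 1) (g : V →ₗ[ℝ] ℝ) (hgi : g (v i) = 1 - l) (hgj : g (v j) = -l)
    (hg : ∀ k, k ≠ i → k ≠ j → g (v k) = 0) :
    convexHull ℝ (o ∪ Set.range v) ∩ {x | g x ≤ 0} =
      convexHull ℝ (o ∪ Set.range (Function.update v i (l • v i + (1 - l) • v j))) := by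
  have hcr : crossPt g 0 (v j) (v i) = l • v i + (1 - l) • v j := by
    rw [crossPt, hgi, hgj]
    simp only [sub_neg_eq_add, sub_add_cancel, inv_one, one_smul, sub_zero, zero_add]
    abel
  have ho0 : ∀ x ∈ o, g x = 0 := fun x hx => by rw [ho hx, map_zero]
  have hle : ∀ k, k ≠ i → g (v k) ≤ 0 := fun k hk => by
    by_cases hkj : k = j
    · rw [hkj, hgj]; linarith
    · rw [hg k hk hkj]
  rw [convexHull_inter_halfSpace]
  congr 1
  ext x
  constructor
  · rintro (⟨hx | ⟨k, rfl⟩, hx0⟩ | ⟨a, ⟨ha, ha0⟩, b, ⟨hb, hb0⟩, rfl⟩)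
    · exact Or.inl hx
    · refine Or.inr ⟨k, Function.update_of_ne ?_ _ _⟩
      rintro rfl
      linarith
    · have hbi : b = v i := by
        rcases hb with hb | ⟨k, rfl⟩
        · linarith [ho0 b hb]
        · by_contra hne
          have := hle k (fun h => hne (by rw [h]))
          linarith
      have haj : a = v j := by
        rcases ha with ha | ⟨k, rfl⟩
        · linarith [ho0 a ha]
        · by_contra hne
          by_cases hki : k = i
          · subst hki; linarith
          · have := hg k hki (fun h => hne (by rw [h]))
            linarith
      rw [hbi, haj, hcr]
      exact Or.inr ⟨i, Function.update_self _ _ _⟩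
  · rintro (hx | ⟨k, rfl⟩)
    · exact Or.inl ⟨Or.inl hx, (ho0 x hx).le⟩
    · by_cases hk : k = i
      · subst hk
        rw [Function.update_self, ← hcr]
        exact Or.inr ⟨v j, ⟨Or.inr ⟨j, rfl⟩, by rw [hgj]; linarith⟩, v k,
          ⟨Or.inr ⟨k, rfl⟩, by rw [hgi]; linarith⟩, rfl⟩
      · rw [Function.update_of_ne hk]
        exact Or.inl ⟨Or.inr ⟨k, rfl⟩, hle k hk⟩

/-- Dissection of a simplex through a point of the edge `[vᵢ, vⱼ]`. -/
theorem CutVal.split {D : Set V → ℝ} (hD : CutVal D)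
    (hker : ∀ P, IsPoly P → ∀ f : V →ₗ[ℝ] ℝ, f ≠ 0 → P ⊆ {x | f x = 0} → D P = 0) [Finite ι]
    {o : Set V} (ho : o ⊆ {0}) {v : ι → V} {i j : ι} (hij : i ≠ j) {l : ℝ} (hl : 0 < l)
    (hl1 : l < 1) (g : V →ₗ[ℝ] ℝ) (hgi : g (v i) = 1 - l) (hgj : g (v j) = -l)
    (hg : ∀ k, k ≠ i → k ≠ j → g (v k) = 0) :
    D (convexHull ℝ (o ∪ Set.range v)) =
      D (convexHull ℝ (o ∪ Set.range (Function.update v i (l • v i + (1 - l) • v j)))) +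
      D (convexHull ℝ (o ∪ Set.range (Function.update v j (l • v i + (1 - l) • v j)))) := by
  have hfin : IsPoly (convexHull ℝ (o ∪ Set.range v)) :=
    isPoly_convexHull (((Set.finite_singleton 0).subset ho).union (Set.finite_range v))
  have h := hD.cut _ hfin g 0
  have hg0 : g ≠ 0 := by
    rintro rfl
    simp at hgj
    linarith
  have h2 := split_le ho v hij.symm (l := 1 - l) (by linarith) (by linarith) (-g)
    (by simp [hgj]) (by simp [hgi]) (fun k hkj hki => by simp [hg k hki hkj])
  have e : {x | (-g) x ≤ 0} = {x | 0 ≤ g x} := by ext; simp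
  rw [e, sub_sub_cancel, add_comm ((1 - l) • v j)] at h2
  rw [split_le ho v hij hl hl1 g hgi hgj hg, h2,
    hker _ (hfin.inter_eq g 0) g hg0 Set.inter_subset_right, add_zero] at h
  exact h

end Split

/-- The properties of `P ↦ h_{Φ P} ^ p`, extended by `0` to the empty set, for an
`SL(n)`-contravariant `L_p`-Minkowski valuation `Φ`. -/
structure ContraVal {n : ℕ} (p : ℝ) (Z : Set (E n) → E n → ℝ) : Prop where
  cut : ∀ u, CutVal fun P => Z P u
  contra : ∀ φ : E n →ₗ[ℝ] E n, LinearMap.det φ = 1 → ∀ P, IsPoly P → ∀ u, Z (φ '' P) (φ u) = Z P u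
  nonneg : ∀ P u, 0 ≤ Z P u
  homog : ∀ P c, 0 < c → ∀ u, Z P (c • u) = c ^ p * Z P u
  cont : ∀ P, Continuous (Z P)

namespace ContraVal

variable {n : ℕ} {p : ℝ} {Z : Set (E n) → E n → ℝ}

theorem apply_zero (hZ : ContraVal p Z) (hp : 0 < p) (P : Set (E n)) : Z P 0 = 0 := by
  have h := hZ.homog P 2 two_pos 0
  rw [smul_zero] at h
  have h2 : (1 : ℝ) < 2 ^ p := Real.one_lt_rpow one_lt_two hp
  have h3 : (2 ^ p - 1) * Z P 0 = 0 := by linarith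
  rcases mul_eq_zero.1 h3 with h4 | h4
  · linarith
  · exact h4

/-- Shears fixing a hyperplane pointwise: for `P` in the hyperplane `ℓ = 0`, the value at `u` only
depends on `ℓ u`. -/
theorem eq_of_functional_eq (hZ : ContraVal p Z) {P : Set (E n)} (hP : IsPoly P)
    {f : E n →ₗ[ℝ] ℝ} (hPf : P ⊆ {x | f x = 0}) {u u' : E n} (hu : f u ≠ 0) (huu' : f u' = f u) :
    Z P u' = Z P u := by
  have hdet : LinearMap.det (LinearMap.transvection f ((f u)⁻¹ • (u' - u))) = 1 := by
    rw [LinearMap.transvection.det]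
    simp [huu']
  have h := hZ.contra _ hdet P hP u
  have himg : LinearMap.transvection f ((f u)⁻¹ • (u' - u)) '' P = P := by
    have : ∀ x ∈ P, LinearMap.transvection f ((f u)⁻¹ • (u' - u)) x = x := fun x hx => by
      have : f x = 0 := hPf hx
      simp [LinearMap.transvection.apply, this]
    rw [Set.image_congr this, Set.image_id']
  have hu' : LinearMap.transvection f ((f u)⁻¹ • (u' - u)) u = u' := by
    simp [LinearMap.transvection.apply, smul_smul, mul_inv_cancel₀ hu]
  rw [himg, hu'] at h
  exact h

/-- For `P` in the hyperplane `f = 0`, the values at `u + t • w` and `t • w` agree for `t ≠ 0` if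
`f u = 0` and `f w = 1`; now let `t → 0`. -/
theorem eq_zero_of_functional_eq_zero (hZ : ContraVal p Z) (hp : 0 < p) {P : Set (E n)}
    (hP : IsPoly P) {f : E n →ₗ[ℝ] ℝ} (hf : f ≠ 0) (hPf : P ⊆ {x | f x = 0}) {u : E n}
    (hu : f u = 0) : Z P u = 0 := by
  obtain ⟨w, hw⟩ := exists_apply_eq_one hf
  have h1 : Continuous fun t : ℝ => Z P (u + t • w) := (hZ.cont P).comp (by fun_prop)
  have h2 : Continuous fun t : ℝ => Z P (t • w) := (hZ.cont P).comp (by fun_prop)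
  have hev : ∀ᶠ t in nhdsWithin (0 : ℝ) {0}ᶜ, Z P (u + t • w) = Z P (t • w) := by
    filter_upwards [self_mem_nhdsWithin] with t ht
    refine hZ.eq_of_functional_eq hP hPf ?_ ?_
    · simpa [hw] using ht
    · simp [hu]
  have h3 := (h1.tendsto 0).mono_left (nhdsWithin_le_nhds (s := {0}ᶜ))
  have h4 := (h2.tendsto 0).mono_left (nhdsWithin_le_nhds (s := {0}ᶜ))
  have := tendsto_nhds_unique (h3.congr' hev) h4
  simpa [hZ.apply_zero hp] using this

/-- For a polytope in two different hyperplanes `f = 0` and `g = 0`, the argument can first be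
moved, along `f = f u`, into the hyperplane `g = 0`. -/
theorem eq_zero_of_codim_two (hZ : ContraVal p Z) (hp : 0 < p) {P : Set (E n)}
    (hP : IsPoly P) {f g : E n →ₗ[ℝ] ℝ} (hf : f ≠ 0) (hPf : P ⊆ {x | f x = 0})
    (hPg : P ⊆ {x | g x = 0}) {w : E n} (hw : f w = 0) (hgw : g w ≠ 0) (u : E n) : Z P u = 0 := by
  have hg : g ≠ 0 := by
    rintro rfl
    simp at hgw
  by_cases hfu : f u = 0
  · exact hZ.eq_zero_of_functional_eq_zero hp hP hf hPf hfu
  · rw [← hZ.eq_of_functional_eq hP hPf hfu (u' := u - (g u / g w) • w) (by simp [hw])]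
    refine hZ.eq_zero_of_functional_eq_zero hp hP hg hPg ?_
    simp [div_mul_cancel₀ _ hgw]

/-- The linear map which moves the vertex `vᵢ` of a simplex spanned by a basis of a hyperplane to
the midpoint of `vᵢ` and `vⱼ`, fixes the other `vₖ` and doubles a transversal vector `u` has
determinant `1`. -/
theorem two_rpow_mul_midpoint (hZ : ContraVal p Z) {f : E n →ₗ[ℝ] ℝ} {m : ℕ}
    (b : Module.Basis (Fin (m + 1)) ℝ (LinearMap.ker f)) {i j : Fin (m + 1)} (hij : i ≠ j)
    {o : Set (LinearMap.ker f)} (ho : o ⊆ {0}) {u : E n} (hu : f u ≠ 0) :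
    2 ^ p * Z ((LinearMap.ker f).subtype '' convexHull ℝ (o ∪ Set.range
      (Function.update b i ((1 / 2 : ℝ) • b i + (1 / 2 : ℝ) • b j)))) u =
    Z ((LinearMap.ker f).subtype '' convexHull ℝ (o ∪ Set.range b)) u := by
  obtain ⟨c₀, hc₀⟩ := LinearMap.exists_extend (b.coord i)
  have hc₀' : ∀ y : LinearMap.ker f, c₀ y = b.coord i y := fun y => by rw [← hc₀]; rfl
  have hf0 : ∀ y : LinearMap.ker f, f y = 0 := fun y => y.2
  set c : E n →ₗ[ℝ] ℝ := c₀ - (c₀ u / f u) • f with hc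
  have hcu : c u = 0 := by simp [hc, div_mul_cancel₀ _ hu]
  have hcy : ∀ y : LinearMap.ker f, c y = b.coord i y := fun y => by simp [hc, hf0, hc₀']
  set y : LinearMap.ker f := (1 / 2 : ℝ) • b j - (1 / 2 : ℝ) • b i with hy
  set φ : E n →ₗ[ℝ] E n :=
    LinearMap.transvection c (y : E n) ∘ₗ LinearMap.transvection ((f u)⁻¹ • f) u with hφ
  have hdet : LinearMap.det φ = 1 := by
    rw [hφ, LinearMap.det_comp, LinearMap.transvection.det, LinearMap.transvection.det, hcy, hy]
    simp [hij, inv_mul_cancel₀ hu]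
    norm_num
  have hφu : φ u = (2 : ℝ) • u := by
    simp only [hφ, LinearMap.comp_apply, LinearMap.transvection.apply, LinearMap.smul_apply,
      smul_eq_mul, inv_mul_cancel₀ hu, one_smul, map_add, hcu, add_zero, zero_smul]
    rw [two_smul]
  have hφz : ∀ z : LinearMap.ker f, φ z = ((z + b.coord i z • y : LinearMap.ker f) : E n) := by
    intro z
    simp only [hφ, LinearMap.comp_apply, LinearMap.transvection.apply, LinearMap.smul_apply,
      smul_eq_mul, hf0, mul_zero, zero_smul, add_zero, hcy]
    simp
  have himg : φ '' ((LinearMap.ker f).subtype '' convexHull ℝ (o ∪ Set.range b)) =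
      (LinearMap.ker f).subtype '' convexHull ℝ (o ∪ Set.range
      (Function.update b i ((1 / 2 : ℝ) • b i + (1 / 2 : ℝ) • b j))) := by
    have hcomp : ∀ s : Set (LinearMap.ker f), φ '' ((LinearMap.ker f).subtype '' s) =
        (LinearMap.ker f).subtype '' (LinearMap.transvection (b.coord i) y '' s) := by
      intro s
      rw [Set.image_image, Set.image_image]
      exact Set.image_congr fun z _ => by rw [Submodule.subtype_apply, hφz]; rfl
    rw [hcomp, LinearMap.image_convexHull, Set.image_union, ← Set.range_comp]
    have h1 : LinearMap.transvection (b.coord i) y '' o = o := by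
      rcases Set.subset_singleton_iff_eq.1 ho with rfl | rfl <;> simp
    have h2 : LinearMap.transvection (b.coord i) y ∘ b =
        Function.update b i ((1 / 2 : ℝ) • b i + (1 / 2 : ℝ) • b j) := by
      funext k
      by_cases hk : k = i
      · subst hk
        simp only [Function.comp_apply, LinearMap.transvection.apply, Module.Basis.coord_apply,
          Module.Basis.repr_self, Finsupp.single_eq_same, one_smul, Function.update_self, hy]
        module
      · simp [LinearMap.transvection.apply, hk]
    rw [h1, h2]
  have hfin : IsPoly ((LinearMap.ker f).subtype '' convexHull ℝ (o ∪ Set.range b)) :=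
    (isPoly_convexHull (((Set.finite_singleton 0).subset ho).union (Set.finite_range b))).image _
  have h := hZ.contra φ hdet _ hfin u
  rw [himg, hφu, hZ.homog _ 2 two_pos] at h
  exact h

theorem cutVal_ker (hZ : ContraVal p Z) (f : E n →ₗ[ℝ] ℝ) (u : E n) :
    CutVal fun P : Set (LinearMap.ker f) => Z ((LinearMap.ker f).subtype '' P) u where
  empty := by
    rw [Set.image_empty]
    exact (hZ.cut u).empty
  cut P hP g c := by
    obtain ⟨F, hF⟩ := LinearMap.exists_extend g
    have hF' : ∀ y : LinearMap.ker f, F y = g y := fun y => by rw [← hF]; rfl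
    have key : ∀ r : ℝ → Prop, (LinearMap.ker f).subtype '' (P ∩ {x | r (g x)}) =
        (LinearMap.ker f).subtype '' P ∩ {x | r (F x)} := by
      intro r
      ext x
      constructor
      · rintro ⟨y, ⟨hy, hyr⟩, rfl⟩
        exact ⟨⟨y, hy, rfl⟩, by simpa [hF'] using hyr⟩
      · rintro ⟨⟨y, hy, rfl⟩, hyr⟩
        exact ⟨y, ⟨hy, by simpa [hF'] using hyr⟩, rfl⟩
    rw [key (fun t => t = c), key (fun t => t ≤ c), key (fun t => c ≤ t)]
    exact (hZ.cut u).cut _ (hP.image _) F c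

/-- A contravariant valuation vanishes on polytopes in linear hyperplanes. It suffices to consider
simplices spanned by a basis of the hyperplane. Dissecting such a simplex at the midpoint of an edge
gives two parts with value `2⁻ᵖ z` each, where `z` is the value of the simplex, and `2 ≠ 2ᵖ`. -/
theorem eq_zero_of_hyperplane (hZ : ContraVal p Z) (hn : 3 ≤ n) (hp : 1 < p) {P : Set (E n)}
    (hP : IsPoly P) {f : E n →ₗ[ℝ] ℝ} (hf : f ≠ 0) (hPf : P ⊆ {x | f x = 0}) (u : E n) :
    Z P u = 0 := by
  have hp0 : 0 < p := by linarith
  by_cases hu : f u = 0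
  · exact hZ.eq_zero_of_functional_eq_zero hp0 hP hf hPf hu
  obtain ⟨m, rfl⟩ : ∃ m, n = m + 3 := ⟨n - 3, by omega⟩
  have hfr : Module.finrank ℝ (LinearMap.ker f) = (m + 1) + 1 :=
    finrank_ker_functional finrank_euclideanSpace_fin hf
  have hD := hZ.cutVal_ker f u
  have hker : ∀ P : Set (LinearMap.ker f), IsPoly P → ∀ g : LinearMap.ker f →ₗ[ℝ] ℝ, g ≠ 0 →
      P ⊆ {x | g x = 0} → Z ((LinearMap.ker f).subtype '' P) u = 0 := by
    intro P hP g hg hPg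
    obtain ⟨w, hw⟩ := exists_apply_eq_one hg
    obtain ⟨F, hF⟩ := LinearMap.exists_extend g
    have hF' : ∀ y : LinearMap.ker f, F y = g y := fun y => by rw [← hF]; rfl
    refine hZ.eq_zero_of_codim_two hp0 (hP.image _) hf ?_ (g := F) ?_ (w := w) w.2 ?_ u
    · rintro _ ⟨y, -, rfl⟩
      exact y.2
    · rintro _ ⟨y, hy, rfl⟩
      have : g y = 0 := hPg hy
      simpa [hF'] using this
    · rw [hF', hw]
      exact one_ne_zero
  have key := hD.eq_zero_of_bases hfr hker ?_ (((LinearMap.ker f).subtype) ⁻¹' P) ?_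
  · rwa [Set.image_preimage_eq_of_subset] at key
    intro x hx
    exact ⟨⟨x, hPf hx⟩, rfl⟩
  · intro o ho v hv
    let b := basisOfLinearIndependentOfCardEqFinrank hv (by rw [hfr, Fintype.card_fin])
    have hb : (b : Fin (m + 2) → LinearMap.ker f) = v :=
      coe_basisOfLinearIndependentOfCardEqFinrank _ _
    have h01 : (0 : Fin (m + 2)) ≠ 1 := by simp
    have hs := hD.split hker ho (v := b) h01 (l := 1 / 2) (by norm_num) (by norm_num)
      ((1 / 2 : ℝ) • (b.coord 0 - b.coord 1)) (by simp [h01.symm]; norm_num)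
      (by simp [h01]) (fun k h0 h1 => by simp [h0, h1])
    rw [show (1 - 1 / 2 : ℝ) = 1 / 2 by norm_num] at hs
    have h1 := hZ.two_rpow_mul_midpoint b h01 ho hu
    have h2 := hZ.two_rpow_mul_midpoint b h01.symm ho hu
    rw [add_comm ((1 / 2 : ℝ) • b 1)] at h2
    have h3 : (2 : ℝ) < 2 ^ p := by
      simpa using Real.rpow_lt_rpow_of_exponent_lt one_lt_two hp
    rw [← hb]
    set z := Z ((LinearMap.ker f).subtype '' convexHull ℝ (o ∪ Set.range b)) u
    have h4 : (2 ^ p - 2) * z = 0 := by linear_combination (2 : ℝ) ^ p * hs + h1 + h2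
    rcases mul_eq_zero.1 h4 with h5 | h5
    · linarith
    · exact h5
  · obtain ⟨s, hs, rfl⟩ := hP
    refine ⟨(LinearMap.ker f).subtype ⁻¹' s, hs.preimage Subtype.val_injective.injOn, ?_⟩
    have hsub : (LinearMap.ker f).subtype '' ((LinearMap.ker f).subtype ⁻¹' s) = s :=
      Set.image_preimage_eq_of_subset fun x hx =>
        ⟨⟨x, hPf (subset_convexHull ℝ s hx)⟩, rfl⟩
    apply Set.image_injective.2 (LinearMap.ker f).injective_subtype
    rw [LinearMap.image_convexHull, hsub, Set.image_preimage_eq_of_subset]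
    intro x hx
    exact ⟨⟨x, hPf hx⟩, rfl⟩

end ContraVal

/-! ### Values on the simplices spanned by bases -/

/-- The standard basis of `ℝⁿ`. -/
abbrev stdB (n : ℕ) : Module.Basis (Fin n) ℝ (E n) := (EuclideanSpace.basisFun (Fin n) ℝ).toBasis

/-- The simplex `conv (o ∪ {vᵢ})`, where `o` is empty or consists of the origin. -/
abbrev simplex {n : ℕ} (o : Set (E n)) (v : Fin n → E n) : Set (E n) :=
  convexHull ℝ (o ∪ Set.range v)

section

variable {n : ℕ} {o : Set (E n)}

theorem isPoly_simplex (ho : o ⊆ {0}) (v : Fin n → E n) : IsPoly (simplex o v) :=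
  isPoly_convexHull (((Set.finite_singleton 0).subset ho).union (Set.finite_range v))

theorem image_simplex (ho : o ⊆ {0}) (v : Fin n → E n) (φ : E n →ₗ[ℝ] E n) :
    φ '' simplex o v = simplex o (φ ∘ v) := by
  have h1 : φ '' o = o := by
    rcases Set.subset_singleton_iff_eq.1 ho with rfl | rfl <;> simp
  rw [simplex, LinearMap.image_convexHull, Set.image_union, ← Set.range_comp, h1]

theorem simplex_perm (o : Set (E n)) (v : Fin n → E n) (σ : Equiv.Perm (Fin n)) :
    simplex o (v ∘ σ) = simplex o v := by
  rw [simplex, EquivLike.range_comp]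

theorem det_update_left (v : Fin n → E n) {i j : Fin n} (hij : i ≠ j) (a b : ℝ) :
    (stdB n).det (Function.update v i (a • v i + b • v j)) = a * (stdB n).det v := by
  rw [AlternatingMap.map_update_add, AlternatingMap.map_update_smul,
    AlternatingMap.map_update_smul, Function.update_eq_self,
    AlternatingMap.map_update_self _ _ hij]
  simp

/-- Two bases with the same determinant differ by an element of `SL(n)`. -/
theorem exists_sl_of_det_eq {v w : Fin n → E n} (hv : (stdB n).det v ≠ 0)
    (hvw : (stdB n).det w = (stdB n).det v) :
    ∃ φ : E n →ₗ[ℝ] E n, LinearMap.det φ = 1 ∧ φ ∘ v = w := by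
  obtain ⟨hli, hsp⟩ := (Module.Basis.is_basis_iff_det (stdB n)).2 (isUnit_iff_ne_zero.2 hv)
  let b := Module.Basis.mk hli hsp.ge
  have hb : (b : Fin n → E n) = v := Module.Basis.coe_mk _ _
  have hφ : b.constr ℝ w ∘ v = w := by
    funext i
    rw [← hb, Function.comp_apply, Module.Basis.constr_basis]
  refine ⟨b.constr ℝ w, ?_, hφ⟩
  have h := Module.Basis.det_comp (stdB n) (b.constr ℝ w) v
  rw [hφ, hvw] at h
  exact mul_right_cancel₀ hv (by rw [← h, one_mul])

end

namespace ContraVal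

variable {n : ℕ} {p : ℝ} {Z : Set (E n) → E n → ℝ} {o : Set (E n)}

theorem simplex_eq_of_det_eq (hZ : ContraVal p Z) (ho : o ⊆ {0}) {v w : Fin n → E n}
    (hv : (stdB n).det v ≠ 0) (hvw : (stdB n).det w = (stdB n).det v) (x : Fin n → ℝ) :
    Z (simplex o w) (∑ i, x i • w i) = Z (simplex o v) (∑ i, x i • v i) := by
  obtain ⟨φ, hφ, rfl⟩ := exists_sl_of_det_eq hv hvw
  rw [← image_simplex ho, ← hZ.contra φ hφ _ (isPoly_simplex ho v)]
  simp

/-- The values of `Z` on simplices spanned by bases of determinant `d`, in coordinates. -/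
def simplexFun (Z : Set (E n) → E n → ℝ) (o : Set (E n)) (d : ℝ) (x : Fin n → ℝ) : ℝ :=
  Z (simplex o (d ^ (1 / n : ℝ) • ⇑(stdB n))) (∑ i, x i • (d ^ (1 / n : ℝ) • ⇑(stdB n)) i)

theorem det_scaled (hn : n ≠ 0) {d : ℝ} (hd : 0 < d) :
    (stdB n).det (d ^ (1 / n : ℝ) • ⇑(stdB n)) = d := by
  have h := MultilinearMap.map_smul_univ (stdB n).det.toMultilinearMap
    (fun _ => d ^ (1 / n : ℝ)) (stdB n)
  have h2 : (stdB n).det (d ^ (1 / n : ℝ) • ⇑(stdB n)) =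
      (∏ _i : Fin n, d ^ (1 / n : ℝ)) • (stdB n).det (stdB n) := h
  rw [h2, Module.Basis.det_self, Finset.prod_const, Finset.card_fin, smul_eq_mul, mul_one,
    one_div, Real.rpow_inv_natCast_pow hd.le hn]

theorem simplex_eq_simplexFun (hZ : ContraVal p Z) (hn : n ≠ 0) (ho : o ⊆ {0}) {v : Fin n → E n}
    (hv : 0 < (stdB n).det v) (x : Fin n → ℝ) :
    Z (simplex o v) (∑ i, x i • v i) = simplexFun Z o ((stdB n).det v) x := by
  have h := det_scaled hn hv
  exact hZ.simplex_eq_of_det_eq ho (by rw [h]; exact hv.ne') h.symm x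

theorem sum_upd₂_smul {M : Type*} [AddCommGroup M] [Module ℝ M] (v : Fin n → M) {i j : Fin n}
    (hij : i ≠ j) {l : ℝ} (hl : l ≠ 0) (x : Fin n → ℝ) :
    ∑ k, upd₂ x i j (x i / l) (x j - x i * (1 - l) / l) k •
      Function.update v i (l • v i + (1 - l) • v j) k = ∑ k, x k • v k := by
  rw [← sub_eq_zero, ← Finset.sum_sub_distrib, Finset.sum_eq_add i j hij]
  · rw [upd₂_left _ hij, upd₂_right, Function.update_self, Function.update_of_ne hij.symm]
    match_scalars <;> field_simp <;> ring
  · intro k _ hk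
    rw [upd₂_other _ hk.1 hk.2, Function.update_of_ne hk.1, sub_self]
  · simp
  · simp

theorem splitEq (hZ : ContraVal p Z) (hn : 3 ≤ n) (hp : 1 < p) (ho : o ⊆ {0}) :
    SplitEq p (simplexFun Z o) where
  nonneg d _ x := hZ.nonneg _ _
  homog d _ c hc x := by
    rw [simplexFun, simplexFun, ← hZ.homog _ c hc, Finset.smul_sum]
    simp only [Pi.smul_apply, smul_eq_mul, mul_smul]
  cont d _ := (hZ.cont _).comp (by fun_prop)
  perm d hd σ hσ x := by
    set v := d ^ (1 / n : ℝ) • ⇑(stdB n) with hv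
    have hdet : (stdB n).det v = d := det_scaled (by omega) hd
    have h := hZ.simplex_eq_of_det_eq ho (v := v) (w := v ∘ σ) (by rw [hdet]; exact hd.ne')
      (by rw [AlternatingMap.map_perm, hσ, one_smul]) (x ∘ σ)
    rw [simplex_perm] at h
    have e : ∑ i, (x ∘ σ) i • (v ∘ σ) i = ∑ i, x i • v i := Equiv.sum_comp σ fun i => x i • v i
    rw [e] at h
    exact h.symm
  split d hd i j hij l hl hl1 x := by
    have hn0 : n ≠ 0 := by omega
    set v := d ^ (1 / n : ℝ) • ⇑(stdB n) with hv
    have hdet : (stdB n).det v = d := det_scaled hn0 hd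
    have hdet1 := det_update_left v hij l (1 - l)
    have hdet2 := det_update_left v hij.symm (1 - l) l
    rw [add_comm] at hdet2
    rw [hdet] at hdet1 hdet2
    have hc : d ^ (1 / n : ℝ) ≠ 0 := (Real.rpow_pos_of_pos hd _).ne'
    have hcoord : ∀ k m, (stdB n).coord k (v m) = d ^ (1 / n : ℝ) * if m = k then 1 else 0 := by
      intro k m
      simp only [hv, Pi.smul_apply, map_smul, Module.Basis.coord_apply, Module.Basis.repr_self,
        Finsupp.single_apply, smul_eq_mul]
    have hs := (hZ.cut (∑ k, x k • v k)).split
      (fun P hP f hf hPf => hZ.eq_zero_of_hyperplane hn hp hP hf hPf _) ho (v := v) hij hl hl1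
      ((d ^ (1 / n : ℝ))⁻¹ • ((1 - l) • (stdB n).coord i - l • (stdB n).coord j))
      (by
        simp only [LinearMap.smul_apply, LinearMap.sub_apply, hcoord, smul_eq_mul, if_true,
          if_neg hij]
        field_simp
        ring)
      (by
        simp only [LinearMap.smul_apply, LinearMap.sub_apply, hcoord, smul_eq_mul, if_true,
          if_neg hij.symm]
        field_simp
        ring)
      (fun k hki hkj => by
        simp only [LinearMap.smul_apply, LinearMap.sub_apply, hcoord, smul_eq_mul, if_neg hki,
          if_neg hkj]
        ring)
    have e1 := sum_upd₂_smul v hij hl.ne' x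
    have e2 := sum_upd₂_smul v hij.symm (l := 1 - l) (by linarith) x
    rw [sub_sub_cancel, add_comm ((1 - l) • v j), upd₂_comm x hij.symm] at e2
    have h1 := hZ.simplex_eq_simplexFun hn0 ho (by rw [hdet1]; positivity)
      (upd₂ x i j (x i / l) (x j - x i * (1 - l) / l))
    have h2 := hZ.simplex_eq_simplexFun hn0 ho (by rw [hdet2]; exact mul_pos (by linarith) hd)
      (upd₂ x i j (x i - x j * l / (1 - l)) (x j / (1 - l)))
    rw [hdet1, e1] at h1
    rw [hdet2, e2] at h2
    rw [← h1, ← h2]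
    exact hs

/-- The values of a contravariant valuation on the simplices spanned by a basis. The constants are
the values on the standard simplex at `± e_k`. -/
theorem simplex_eq (hZ : ContraVal p Z) (hn : 3 ≤ n) (hp : 1 < p) (ho : o ⊆ {0}) (k : Fin n)
    {v : Fin n → E n} (hv : (stdB n).det v ≠ 0) (x : Fin n → ℝ) :
    Z (simplex o v) (∑ i, x i • v i) = |(stdB n).det v| *
      (Z (simplex o (stdB n)) (stdB n k) * max (∑ i, x i) 0 ^ p +
        Z (simplex o (stdB n)) (-stdB n k) * max (-∑ i, x i) 0 ^ p) := by
  have hn0 : n ≠ 0 := by omega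
  have hpos : ∀ {v : Fin n → E n}, 0 < (stdB n).det v → ∀ x : Fin n → ℝ,
      Z (simplex o v) (∑ i, x i • v i) = (stdB n).det v *
      (Z (simplex o (stdB n)) (stdB n k) * max (∑ i, x i) 0 ^ p +
        Z (simplex o (stdB n)) (-stdB n k) * max (-∑ i, x i) 0 ^ p) := by
    intro v hv x
    have h1 : ∀ s : ℝ,
        simplexFun Z o 1 (Pi.single k s) = Z (simplex o (stdB n)) (s • stdB n k) := by
      intro s
      rw [simplexFun, Real.one_rpow, one_smul, Finset.sum_eq_single k]
      · simp
      · intro i _ hi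
        simp [hi]
      · simp
    rw [hZ.simplex_eq_simplexFun hn0 ho hv,
      (hZ.splitEq hn hp ho).eq (by linarith) hn k hv, h1, h1, one_smul, neg_one_smul]
  rcases lt_or_gt_of_ne hv with h | h
  · have h01 : (⟨0, by omega⟩ : Fin n) ≠ ⟨1, by omega⟩ := by simp
    let σ : Equiv.Perm (Fin n) := Equiv.swap ⟨0, by omega⟩ ⟨1, by omega⟩
    have hσ : (stdB n).det (v ∘ σ) = -(stdB n).det v := by
      rw [AlternatingMap.map_perm, Equiv.Perm.sign_swap h01]
      simp
    have := hpos (v := v ∘ σ) (by rw [hσ]; linarith) (x ∘ σ)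
    have e : ∑ i, (x ∘ σ) i • (v ∘ σ) i = ∑ i, x i • v i := Equiv.sum_comp σ fun i => x i • v i
    have e' : ∑ i, (x ∘ σ) i = ∑ i, x i := Equiv.sum_comp σ x
    rw [hσ, simplex_perm, e, e'] at this
    rw [this, abs_of_neg h]
  · rw [hpos h, abs_of_pos h]

end ContraVal

/-! ### From maps on polytopes to families of real valuations -/

section

variable {n : ℕ}

theorem Polytope.toSet_injective : Function.Injective (Polytope.toSet (n := n)) := by
  rintro ⟨P, hP⟩ ⟨Q, hQ⟩ h
  have : P = Q := ConvexBody.ext h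
  subst this
  rfl

theorem ConvexBodyO.ext_supp {K L : ConvexBodyO n} (h : ∀ u, supp K.1 u = supp L.1 u) : K = L := by
  rcases K with ⟨K, hK⟩
  rcases L with ⟨L, hL⟩
  have : K = L := SLContra.ext_supp h
  subst this
  rfl

theorem Polytope.isPoly (P : Polytope n) : IsPoly P.toSet := by
  obtain ⟨s, hs⟩ := P.2
  exact ⟨s, s.finite_toSet, hs⟩

theorem Polytope.nonempty (P : Polytope n) : P.toSet.Nonempty := P.1.nonempty

theorem IsPoly.exists_polytope {S : Set (E n)} (hS : IsPoly S) (hne : S.Nonempty) :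
    ∃ P : Polytope n, P.toSet = S := by
  obtain ⟨s, hs, rfl⟩ := hS
  exact ⟨⟨⟨convexHull ℝ s, convex_convexHull ℝ s, hs.isCompact_convexHull ℝ, hne⟩,
    hs.toFinset, by rw [hs.coe_toFinset]; rfl⟩, rfl⟩

theorem continuous_supp (K : ConvexBody (E n)) : Continuous (supp K) := by
  obtain ⟨R, hR⟩ := isBounded_iff_forall_norm_le.1 K.isBounded
  have key : ∀ u v, supp K u ≤ supp K v + R * dist u v := by
    intro u v
    have h1 := supp_add_le K v (u - v)
    rw [add_sub_cancel] at h1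
    obtain ⟨x, hx, hxu⟩ := (supp_isGreatest K (u - v)).1
    have h2 : ⟪x, u - v⟫ ≤ R * dist u v := by
      rw [dist_eq_norm]
      exact (real_inner_le_norm _ _).trans
        (mul_le_mul_of_nonneg_right (hR x hx) (norm_nonneg _))
    simp only at hxu
    linarith
  have hR0 : 0 ≤ R := by
    obtain ⟨x, hx⟩ := K.nonempty
    exact (norm_nonneg x).trans (hR x hx)
  refine (LipschitzWith.of_le_add_mul (Real.toNNReal R) fun u v => ?_).continuous
  rw [Real.coe_toNNReal R hR0]
  exact key u v

theorem inner_inv_transpose (φ : Matrix.SpecialLinearGroup (Fin n) ℝ) (x u : E n) :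
    ⟪Matrix.toEuclideanLin ((φ : Matrix (Fin n) (Fin n) ℝ)⁻¹.transpose) x,
      Matrix.toEuclideanLin (φ : Matrix (Fin n) (Fin n) ℝ) u⟫ = ⟪x, u⟫ := by
  have hdet : IsUnit (φ : Matrix (Fin n) (Fin n) ℝ).det := by simp
  simp only [EuclideanSpace.inner_eq_star_dotProduct, Matrix.ofLp_toLpLin, Matrix.toLin'_apply,
    star_trivial]
  rw [Matrix.mulVec_transpose, dotProduct_comm, ← Matrix.dotProduct_mulVec, Matrix.mulVec_mulVec,
    Matrix.nonsing_inv_mul _ hdet, Matrix.one_mulVec, dotProduct_comm]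

theorem toEuclideanLin_inv_apply (φ : Matrix.SpecialLinearGroup (Fin n) ℝ) (u : E n) :
    Matrix.toEuclideanLin (φ : Matrix (Fin n) (Fin n) ℝ)
      (Matrix.toEuclideanLin ((φ : Matrix (Fin n) (Fin n) ℝ)⁻¹) u) = u := by
  have hdet : IsUnit (φ : Matrix (Fin n) (Fin n) ℝ).det := by simp
  apply (WithLp.ofLp_injective 2)
  simp only [Matrix.ofLp_toLpLin, Matrix.toLin'_apply, Matrix.mulVec_mulVec,
    Matrix.mul_nonsing_inv _ hdet, Matrix.one_mulVec]

/-- Contravariance in terms of support functions. -/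
theorem isSLContravariant_iff {Φ : Polytope n → ConvexBodyO n} :
    IsSLContravariant Φ ↔ ∀ (φ : Matrix.SpecialLinearGroup (Fin n) ℝ) (P : Polytope n) (u : E n),
      supp (Φ (P.image φ)).1 (Matrix.toEuclideanLin (φ : Matrix (Fin n) (Fin n) ℝ) u) =
        supp (Φ P).1 u := by
  have key : ∀ (φ : Matrix.SpecialLinearGroup (Fin n) ℝ) (K L : ConvexBody (E n)),
      (L : Set (E n)) =
        Matrix.toEuclideanLin ((φ : Matrix (Fin n) (Fin n) ℝ)⁻¹.transpose) '' (K : Set (E n)) →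
      ∀ u, supp L (Matrix.toEuclideanLin (φ : Matrix (Fin n) (Fin n) ℝ) u) = supp K u := by
    intro φ K L h u
    rw [supp, supp, h, Set.image_image]
    congr 1
    exact Set.image_congr fun x _ => inner_inv_transpose φ x u
  constructor
  · intro h φ P u
    exact key φ _ _ (h φ P) u
  · intro h φ P
    let L : ConvexBody (E n) :=
      ⟨Matrix.toEuclideanLin ((φ : Matrix (Fin n) (Fin n) ℝ)⁻¹.transpose) '' (Φ P).toSet,
        (Φ P).1.convex.linear_image _,
        (Φ P).1.isCompact.image (LinearMap.continuous_of_finiteDimensional _),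
        (Φ P).1.nonempty.image _⟩
    have hL : (Φ (P.image φ)).1 = L := by
      refine ext_supp fun u => ?_
      rw [← toEuclideanLin_inv_apply φ u, h, key φ _ L rfl]
    exact congrArg (fun K : ConvexBody (E n) => (K : Set (E n))) hL

/-- The valuation property in terms of support functions. -/
theorem isLpMinkowskiValuation_iff {p : ℝ} (hp : 1 < p) {Φ : Polytope n → ConvexBodyO n} :
    IsLpMinkowskiValuation p Φ ↔ ∀ P Q U I : Polytope n, U.toSet = P.toSet ∪ Q.toSet →
      I.toSet = P.toSet ∩ Q.toSet → ∀ u, supp (Φ U).1 u ^ p + supp (Φ I).1 u ^ p =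
        supp (Φ P).1 u ^ p + supp (Φ Q).1 u ^ p := by
  refine forall₄_congr fun P Q U I => forall₂_congr fun _ _ => ?_
  constructor
  · intro h u
    rw [← supp_lpAdd hp.le, h, supp_lpAdd hp.le]
  · intro h
    refine ConvexBodyO.ext_supp fun u => ?_
    refine (Real.rpow_left_inj (supp_nonneg _ u) (supp_nonneg _ u) (by linarith : p ≠ 0)).1 ?_
    rw [supp_lpAdd hp.le, supp_lpAdd hp.le, h]

open Classical in
/-- The function `h_{Φ P}(u) ^ p` as a function of the set underlying `P`; it is `0` for sets which
are not polytopes, in particular for the empty set. -/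
def suppPow (p : ℝ) (Φ : Polytope n → ConvexBodyO n) (S : Set (E n)) (u : E n) : ℝ :=
  if h : ∃ P : Polytope n, P.toSet = S then supp (Φ h.choose).1 u ^ p else 0

theorem suppPow_toSet (p : ℝ) (Φ : Polytope n → ConvexBodyO n) (P : Polytope n) (u : E n) :
    suppPow p Φ P.toSet u = supp (Φ P).1 u ^ p := by
  have h : ∃ Q : Polytope n, Q.toSet = P.toSet := ⟨P, rfl⟩
  rw [suppPow, dif_pos h, Polytope.toSet_injective h.choose_spec]

theorem suppPow_of_not {p : ℝ} {Φ : Polytope n → ConvexBodyO n} {S : Set (E n)}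
    (h : ¬ ∃ P : Polytope n, P.toSet = S) (u : E n) : suppPow p Φ S u = 0 := by
  rw [suppPow, dif_neg h]

theorem suppPow_empty (p : ℝ) (Φ : Polytope n → ConvexBodyO n) (u : E n) :
    suppPow p Φ ∅ u = 0 :=
  suppPow_of_not (fun ⟨P, hP⟩ => P.nonempty.ne_empty hP) u

theorem exists_specialLinear {φ : E n →ₗ[ℝ] E n} (hφ : LinearMap.det φ = 1) :
    ∃ A : Matrix.SpecialLinearGroup (Fin n) ℝ,
      Matrix.toEuclideanLin (A : Matrix (Fin n) (Fin n) ℝ) = φ := by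
  refine ⟨⟨Matrix.toEuclideanLin.symm φ, ?_⟩, by simp⟩
  have h : LinearMap.det (Matrix.toEuclideanLin (Matrix.toEuclideanLin.symm φ)) =
      (Matrix.toEuclideanLin.symm φ).det := by
    rw [Matrix.toEuclideanLin_eq_toLin_orthonormal, LinearMap.det_toLin]
  rw [← h, LinearEquiv.apply_symm_apply, hφ]

theorem contraVal_suppPow {p : ℝ} (hp : 1 < p) {Φ : Polytope n → ConvexBodyO n}
    (hc : IsSLContravariant Φ) (hv : IsLpMinkowskiValuation p Φ) : ContraVal p (suppPow p Φ) where
  cut u :=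
    { empty := suppPow_empty p Φ u
      cut := by
        intro P hP f c
        have hunion : P = (P ∩ {x | f x ≤ c}) ∪ (P ∩ {x | c ≤ f x}) := by
          ext x
          simp only [Set.mem_union, Set.mem_inter_iff, Set.mem_ofPred_eq]
          have := le_total (f x) c
          tauto
        have hinter : P ∩ {x | f x = c} = (P ∩ {x | f x ≤ c}) ∩ (P ∩ {x | c ≤ f x}) := by
          ext x
          simp only [Set.mem_inter_iff, Set.mem_ofPred_eq, le_antisymm_iff]
          tauto
        rcases Set.eq_empty_or_nonempty (P ∩ {x | f x = c}) with he | hne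
        · -- a connected set which misses the hyperplane lies on one side of it
          have h : (P ∩ {x | f x ≤ c}) = ∅ ∨ (P ∩ {x | c ≤ f x}) = ∅ := by
            by_contra hcon
            push Not at hcon
            obtain ⟨⟨x, hx, hxc⟩, ⟨y, hy, hyc⟩⟩ := hcon
            have hx' : f x < c := lt_of_le_of_ne hxc fun h => he.subset ⟨hx, h⟩
            have hy' : c < f y := lt_of_le_of_ne hyc fun h => he.subset ⟨hy, h.symm⟩
            exact he.subset ⟨hP.convex.segment_subset hx hy (crossPt_mem_segment hx'.le hy'),
              apply_crossPt (hx'.trans hy')⟩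
          rw [he]
          rcases h with h | h
          · rw [h, Set.empty_union] at hunion
            rw [h, ← hunion, add_comm]
          · rw [h, Set.union_empty] at hunion
            rw [h, ← hunion]
        · obtain ⟨I, hI⟩ := (hP.inter_eq f c).exists_polytope hne
          obtain ⟨x, hx, hxc⟩ := hne
          have hxc : f x = c := hxc
          obtain ⟨U, rfl⟩ := hP.exists_polytope ⟨x, hx⟩
          obtain ⟨A, hA⟩ := (hP.inter_le f c).exists_polytope ⟨x, hx, hxc.le⟩
          obtain ⟨B, hB⟩ := (hP.inter_ge f c).exists_polytope ⟨x, hx, hxc.ge⟩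
          rw [← hA, ← hB] at hunion
          rw [← hI, ← hA, ← hB] at hinter
          rw [← hI, ← hA, ← hB]
          simp only [suppPow_toSet]
          exact (isLpMinkowskiValuation_iff hp).1 hv A B U I hunion hinter u }
  contra := by
    intro φ hφ P hP u
    rcases Set.eq_empty_or_nonempty P with rfl | hne
    · rw [Set.image_empty, suppPow_empty, suppPow_empty]
    obtain ⟨A, rfl⟩ := exists_specialLinear hφ
    obtain ⟨P, rfl⟩ := hP.exists_polytope hne
    have : Matrix.toEuclideanLin (A : Matrix (Fin n) (Fin n) ℝ) '' P.toSet =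
      (P.image A).toSet := rfl
    rw [this, suppPow_toSet, suppPow_toSet, isSLContravariant_iff.1 hc]
  nonneg S u := by
    by_cases h : ∃ P : Polytope n, P.toSet = S
    · obtain ⟨P, rfl⟩ := h
      rw [suppPow_toSet]
      exact Real.rpow_nonneg (supp_nonneg _ _) _
    · rw [suppPow_of_not h]
  homog S c hc u := by
    by_cases h : ∃ P : Polytope n, P.toSet = S
    · obtain ⟨P, rfl⟩ := h
      rw [suppPow_toSet, suppPow_toSet, supp_smul _ _ _ hc, Real.mul_rpow hc.le (supp_nonneg _ _)]
    · rw [suppPow_of_not h, suppPow_of_not h, mul_zero]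
  cont S := by
    by_cases h : ∃ P : Polytope n, P.toSet = S
    · obtain ⟨P, rfl⟩ := h
      rw [show suppPow p Φ P.toSet = fun u => supp (Φ P).1 u ^ p from
        funext fun u => suppPow_toSet p Φ P u]
      exact (continuous_supp _).rpow_const fun u => Or.inr (by linarith)
    · rw [show suppPow p Φ S = fun _ => 0 from funext fun u => suppPow_of_not h u]
      exact continuous_const

end

/-! ### Volumes of facets via prisms -/

section Prism

variable {n : ℕ}

/-- The prism over `F` spanned by the vector `a`. -/
def prism (F : Set (E n)) (a : E n) : Set (E n) :=
  (fun q : E n × ℝ => q.1 + q.2 • a) '' (F ×ˢ Set.Icc 0 1)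

theorem isCompact_prism {F : Set (E n)} (hF : IsCompact F) (a : E n) : IsCompact (prism F a) :=
  (hF.prod isCompact_Icc).image (by fun_prop)

theorem image_prism (φ : E n →ₗ[ℝ] E n) (F : Set (E n)) (a : E n) :
    φ '' prism F a = prism (φ '' F) (φ a) := by
  ext x
  constructor
  · rintro ⟨_, ⟨⟨y, t⟩, ⟨hy, ht⟩, rfl⟩, rfl⟩
    exact ⟨(φ y, t), ⟨⟨y, hy, rfl⟩, ht⟩, by simp⟩
  · rintro ⟨⟨_, t⟩, ⟨⟨y, hy, rfl⟩, ht⟩, rfl⟩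
    exact ⟨y + t • a, ⟨(y, t), ⟨hy, ht⟩, rfl⟩, by simp⟩

/-- The volume of a prism is the volume of its base times its height. -/
theorem volume_prism {F : Set (E n)} (hF : IsCompact F) {v a : E n} {h : ℝ} (hv : ‖v‖ = 1)
    (hFv : ∀ x ∈ F, ⟪x, v⟫ = h) (ha : 0 < ⟪a, v⟫) :
    MeasureTheory.volume (prism F a) = ENNReal.ofReal ⟪a, v⟫ * μHE[n - 1] F := by
  have hv0 : v ≠ 0 := by
    rintro rfl
    simp at hv
  have h1 := EuclideanGeometry.euclideanHausdorffMeasure_eq_lintegral (0 : E n) hv0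
    (isCompact_prism hF a).isClosed.measurableSet
  rw [InnerProductSpace.euclideanHausdorffMeasure_eq_volume, finrank_euclideanSpace_fin] at h1
  have hnorm : ‖v‖ₑ = 1 := by rw [← ofReal_norm, hv, ENNReal.ofReal_one]
  have hmem : ∀ (x : ℝ) (y : E n),
      y ∈ AffineSubspace.mk' (x • v +ᵥ (0 : E n)) (ℝ ∙ v)ᗮ ↔ ⟪y, v⟫ = x := by
    intro x y
    rw [AffineSubspace.mem_mk', Submodule.mem_orthogonal_singleton_iff_inner_left]
    simp only [vadd_eq_add, add_zero, vsub_eq_sub, inner_sub_left, real_inner_smul_left,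
      real_inner_self_eq_norm_sq, hv]
    rw [one_pow, mul_one, sub_eq_zero]
  have hsec : ∀ x : ℝ, μHE[n - 1]
      (prism F a ∩ AffineSubspace.mk' (x • v +ᵥ (0 : E n)) (ℝ ∙ v)ᗮ) =
      (Set.Icc h (h + ⟪a, v⟫)).indicator (fun _ => μHE[n - 1] F) x := by
    intro x
    by_cases hx : x ∈ Set.Icc h (h + ⟪a, v⟫)
    · rw [Set.indicator_of_mem hx]
      have : prism F a ∩ AffineSubspace.mk' (x • v +ᵥ (0 : E n)) (ℝ ∙ v)ᗮ =
          (fun y => ((x - h) / ⟪a, v⟫) • a + y) '' F := by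
        ext y
        constructor
        · rintro ⟨⟨⟨z, t⟩, ⟨hz, ht⟩, rfl⟩, hy⟩
          rw [SetLike.mem_coe, hmem, inner_add_left, real_inner_smul_left, hFv z hz] at hy
          refine ⟨z, hz, ?_⟩
          have ht' : (x - h) / ⟪a, v⟫ = t := by
            rw [div_eq_iff ha.ne']
            linarith
          simp only [ht']
          exact add_comm _ _
        · rintro ⟨z, hz, rfl⟩
          refine ⟨⟨(z, (x - h) / ⟪a, v⟫), ⟨hz, ?_, ?_⟩, add_comm _ _⟩, ?_⟩
          · exact div_nonneg (by linarith [hx.1]) ha.le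
          · exact (div_le_one ha).2 (by linarith [hx.2])
          · rw [SetLike.mem_coe, hmem, inner_add_left, real_inner_smul_left, hFv z hz,
              div_mul_cancel₀ _ ha.ne']
            ring
      rw [this]
      exact (isometry_add_left _).euclideanHausdorffMeasure_image F
    · rw [Set.indicator_of_notMem hx]
      have : prism F a ∩ AffineSubspace.mk' (x • v +ᵥ (0 : E n)) (ℝ ∙ v)ᗮ = ∅ := by
        rw [Set.eq_empty_iff_forall_notMem]
        rintro y ⟨⟨⟨z, t⟩, ⟨hz, ht⟩, rfl⟩, hy⟩
        rw [SetLike.mem_coe, hmem, inner_add_left, real_inner_smul_left, hFv z hz] at hy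
        refine hx ⟨?_, ?_⟩
        · have := mul_nonneg ht.1 ha.le
          linarith
        · have := mul_le_mul_of_nonneg_right ht.2 ha.le
          linarith
      rw [this, MeasureTheory.measure_empty]
  rw [h1, hnorm, one_mul, MeasureTheory.lintegral_congr hsec,
    MeasureTheory.lintegral_indicator_const measurableSet_Icc, Real.volume_Icc,
    add_sub_cancel_left, mul_comm]

theorem volume_prism_self {F : Set (E n)} (hF : IsCompact F) {v : E n} {h : ℝ} (hv : ‖v‖ = 1)
    (hFv : ∀ x ∈ F, ⟪x, v⟫ = h) : MeasureTheory.volume (prism F v) = μHE[n - 1] F := by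
  have e : ⟪v, v⟫ = (1 : ℝ) := by rw [real_inner_self_eq_norm_sq, hv, one_pow]
  rw [volume_prism hF hv hFv (by rw [e]; exact one_pos), e, ENNReal.ofReal_one, one_mul]

theorem vectorSpan_le_orthogonal {F : Set (E n)} {v : E n} {h : ℝ} (hFv : ∀ x ∈ F, ⟪x, v⟫ = h) :
    vectorSpan ℝ F ≤ (ℝ ∙ v)ᗮ := by
  rw [vectorSpan_def, Submodule.span_le]
  rintro _ ⟨x, hx, y, hy, rfl⟩
  rw [SetLike.mem_coe, Submodule.mem_orthogonal_singleton_iff_inner_left]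
  change ⟪x - y, v⟫ = 0
  rw [inner_sub_left, hFv x hx, hFv y hy, sub_self]

theorem finrank_orthogonal_span {v : E n} (hv : v ≠ 0) :
    Module.finrank ℝ (ℝ ∙ v)ᗮ + 1 = n := by
  have h1 := (ℝ ∙ v).finrank_add_finrank_orthogonal
  rw [finrank_span_singleton hv, finrank_euclideanSpace_fin] at h1
  omega

theorem vectorSpan_prism {F : Set (E n)} (hne : F.Nonempty) (v : E n) :
    vectorSpan ℝ (prism F v) = vectorSpan ℝ F ⊔ ℝ ∙ v := by
  obtain ⟨x₀, hx₀⟩ := hne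
  apply le_antisymm
  · rw [vectorSpan_def, Submodule.span_le]
    rintro _ ⟨_, ⟨⟨x, s⟩, ⟨hx, -⟩, rfl⟩, _, ⟨⟨y, t⟩, ⟨hy, -⟩, rfl⟩, rfl⟩
    have e : (x + s • v) -ᵥ (y + t • v) = (x -ᵥ y) + (s - t) • v := by
      simp only [vsub_eq_sub, sub_smul]
      abel
    simp only [e]
    exact Submodule.add_mem_sup (vsub_mem_vectorSpan ℝ hx hy)
      (Submodule.smul_mem _ _ (Submodule.mem_span_singleton_self v))
  · refine sup_le (vectorSpan_mono ℝ fun x hx => ⟨(x, 0), ⟨hx, by simp⟩, by simp⟩) ?_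
    rw [Submodule.span_singleton_le_iff_mem]
    have h1 : x₀ + v ∈ prism F v := ⟨(x₀, 1), ⟨hx₀, by simp⟩, by simp⟩
    have h0 : x₀ ∈ prism F v := ⟨(x₀, 0), ⟨hx₀, by simp⟩, by simp⟩
    simpa using vsub_mem_vectorSpan ℝ h1 h0

theorem convex_prism {F : Set (E n)} (hF : Convex ℝ F) (a : E n) : Convex ℝ (prism F a) := by
  have := (hF.prod (convex_Icc (0 : ℝ) 1)).linear_image
    (LinearMap.fst ℝ (E n) ℝ + (LinearMap.snd ℝ (E n) ℝ).smulRight a)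
  exact this

/-- A compact convex set in a hyperplane has positive `(n-1)`-dimensional volume if and only if it
has dimension `n - 1`. -/
theorem hausdorff_eq_zero_iff {F : Set (E n)} (hF : IsCompact F) (hFc : Convex ℝ F)
    (hne : F.Nonempty) {v : E n} {h : ℝ} (hv : ‖v‖ = 1) (hFv : ∀ x ∈ F, ⟪x, v⟫ = h) :
    μHE[n - 1] F = 0 ↔ Module.finrank ℝ (vectorSpan ℝ F) + 1 ≠ n := by
  have hv0 : v ≠ 0 := by
    rintro rfl
    simp at hv
  have hne' : (prism F v).Nonempty := by
    obtain ⟨x, hx⟩ := hne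
    exact ⟨_, ⟨(x, 0), ⟨hx, by simp⟩, rfl⟩⟩
  have hle := vectorSpan_le_orthogonal hFv
  have hdim := finrank_orthogonal_span hv0
  rw [← volume_prism_self hF hv hFv]
  constructor
  · intro h0 hfin
    have hV : vectorSpan ℝ F = (ℝ ∙ v)ᗮ :=
      Submodule.eq_of_le_of_finrank_eq hle (by omega)
    have htop : vectorSpan ℝ (prism F v) = ⊤ := by
      rw [vectorSpan_prism hne, hV, sup_comm, Submodule.sup_orthogonal_of_hasOrthogonalProjection]
    have hint : (interior (prism F v)).Nonempty := by
      rw [(convex_prism hFc v).interior_nonempty_iff_affineSpan_eq_top,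
        AffineSubspace.affineSpan_eq_top_iff_vectorSpan_eq_top_of_nonempty ℝ (E n) (E n) hne', htop]
    exact (MeasureTheory.Measure.measure_pos_of_nonempty_interior _ hint).ne' h0
  · intro hfin
    refine MeasureTheory.measure_mono_null (subset_affineSpan ℝ _)
      (MeasureTheory.Measure.addHaar_affineSubspace _ _ fun htop => hfin ?_)
    rw [AffineSubspace.affineSpan_eq_top_iff_vectorSpan_eq_top_of_nonempty ℝ (E n) (E n) hne',
      vectorSpan_prism hne] at htop
    have h1 := Submodule.finrank_add_le_finrank_add_finrank (vectorSpan ℝ F) (ℝ ∙ v)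
    rw [htop, finrank_top, finrank_euclideanSpace_fin, finrank_span_singleton hv0] at h1
    have h2 := Submodule.finrank_mono hle
    omega

theorem hausdorff_lt_top {F : Set (E n)} (hF : IsCompact F) {v : E n} {h : ℝ} (hv : ‖v‖ = 1)
    (hFv : ∀ x ∈ F, ⟪x, v⟫ = h) : μHE[n - 1] F < ⊤ := by
  rw [← volume_prism_self hF hv hFv]
  exact (isCompact_prism hF v).measure_lt_top

/-- A volume-preserving linear map `φ` changes the area of a set with unit normal `v` by the factor
`s`, where `s • v'` is the image of `v` under the inverse transpose of `φ`. -/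
theorem hausdorff_image {F : Set (E n)} (hF : IsCompact F) {v v' : E n} {h h' s : ℝ}
    (hv : ‖v‖ = 1) (hFv : ∀ x ∈ F, ⟪x, v⟫ = h) {φ : E n →ₗ[ℝ] E n} (hφ : LinearMap.det φ = 1)
    (hv' : ‖v'‖ = 1) (hFv' : ∀ x ∈ F, ⟪φ x, v'⟫ = h') (hs : 0 < s) (hφv : ⟪φ v, v'⟫ = s⁻¹) :
    μHE[n - 1] (φ '' F) = ENNReal.ofReal s * μHE[n - 1] F := by
  have hφF : IsCompact (φ '' F) := hF.image (LinearMap.continuous_of_finiteDimensional _)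
  have h1 := volume_prism (a := φ v) hφF hv' (by rintro _ ⟨x, hx, rfl⟩; exact hFv' x hx)
    (by rw [hφv]; positivity)
  rw [← image_prism, MeasureTheory.Measure.addHaar_image_linearMap, hφ, abs_one,
    ENNReal.ofReal_one, one_mul, volume_prism_self hF hv hFv, hφv] at h1
  rw [h1, ← mul_assoc, ← ENNReal.ofReal_mul hs.le, mul_inv_cancel₀ hs.ne', ENNReal.ofReal_one,
    one_mul]

end Prism

/-! ### Sums over facets are contravariant valuations -/

section Facets

variable {n : ℕ}

theorem face_eq (P : Polytope n) (v : E n) :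
    face P v = P.toSet ∩ {x | ⟪x, v⟫ = supp P.1 v} := rfl

theorem isCompact_face (P : Polytope n) (v : E n) : IsCompact (face P v) := by
  rw [face_eq]
  exact P.1.isCompact.inter_right (isClosed_eq (by fun_prop) continuous_const)

theorem face_nonempty (P : Polytope n) (v : E n) : (face P v).Nonempty := by
  obtain ⟨x, hx, hxv⟩ := (supp_isGreatest P.1 v).1
  exact ⟨x, hx, hxv⟩

theorem convex_face (P : Polytope n) (v : E n) : Convex ℝ (face P v) := by
  obtain ⟨s, hs⟩ := P.2
  rw [face_eq_convexHull P s hs]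
  exact convex_convexHull ℝ _

theorem le_supp (P : Polytope n) (v : E n) {x : E n} (hx : x ∈ P.toSet) : ⟪x, v⟫ ≤ supp P.1 v :=
  (supp_isGreatest P.1 v).2 ⟨x, hx, rfl⟩

theorem supp_eq_of_isGreatest {K : ConvexBody (E n)} {v : E n} {t : ℝ}
    (h : IsGreatest ((fun x : E n => ⟪x, v⟫) '' (K : Set (E n))) t) : supp K v = t :=
  (supp_isGreatest K v).unique h

theorem faceVol_eq_zero_iff (P : Polytope n) {v : E n} (hv : ‖v‖ = 1) :
    faceVol P v = 0 ↔ v ∉ facetNormals P := by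
  have hF : ∀ x ∈ face P v, ⟪x, v⟫ = supp P.1 v := fun x hx => hx.2
  have h := hausdorff_eq_zero_iff (isCompact_face P v) (convex_face P v) (face_nonempty P v) hv hF
  rw [faceVol, ENNReal.toReal_eq_zero_iff,
    or_iff_left (hausdorff_lt_top (isCompact_face P v) hv hF).ne, h]
  simp [facetNormals, hv]

theorem faceVol_nonneg (P : Polytope n) (v : E n) : 0 ≤ faceVol P v := ENNReal.toReal_nonneg

/-- The sum over the facets may be taken over all unit vectors, since faces which are not facets
have zero volume. -/
theorem facetSum_eq (p : ℝ) (C : ℝ → Prop) (g : ℝ → ℝ) (P : Polytope n) (u : E n) :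
    facetSum p C g P u = ∑ᶠ v ∈ {v | ‖v‖ = 1 ∧ C (supp P.1 v)},
      faceVol P v * |supp P.1 v| ^ (1 - p) * g ⟪v, u⟫ ^ p := by
  rw [facetSum]
  refine (finsum_mem_inter_support_eq _ _ _ ?_)
  ext v
  simp only [Set.mem_inter_iff, Set.mem_ofPred_eq, Function.mem_support]
  constructor
  · rintro ⟨⟨hv, hC⟩, h⟩
    exact ⟨⟨hv.1, hC⟩, h⟩
  · rintro ⟨⟨hv, hC⟩, h⟩
    refine ⟨⟨?_, hC⟩, h⟩
    by_contra hn
    rw [(faceVol_eq_zero_iff P hv).2 hn, zero_mul, zero_mul] at h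
    exact h rfl

/-- The contribution of the vector `v` to the sum over the facets; it is zero unless `v` is a unit
vector and `C` holds for the support number of `P` at `v`. -/
def facetTerm (p : ℝ) (C : ℝ → Prop) (g : ℝ → ℝ) (P : Polytope n) (u v : E n) : ℝ :=
  {v : E n | ‖v‖ = 1}.indicator (fun v => faceVol P v *
    ({t : ℝ | C t}.indicator (fun t => |t| ^ (1 - p)) (supp P.1 v) * g ⟪v, u⟫ ^ p)) v

theorem facetSum_eq_finsum (p : ℝ) (C : ℝ → Prop) (g : ℝ → ℝ) (P : Polytope n) (u : E n) :
    facetSum p C g P u = ∑ᶠ v, facetTerm p C g P u v := by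
  rw [facetSum_eq, finsum_mem_def]
  refine finsum_congr fun v => ?_
  classical
  rw [facetTerm, Set.indicator_apply, Set.indicator_apply, Set.indicator_apply]
  by_cases h1 : ‖v‖ = 1 <;> by_cases h2 : C (supp P.1 v) <;> simp [h1, h2, mul_assoc]

theorem support_facetTerm_finite (p : ℝ) (C : ℝ → Prop) (g : ℝ → ℝ) (P : Polytope n) (u : E n) :
    (Function.support (facetTerm p C g P u)).Finite := by
  refine (facetNormals_finite P).subset fun v hv => ?_
  by_contra hn
  refine hv ?_
  by_cases h : ‖v‖ = 1
  · rw [facetTerm, Set.indicator_of_mem (by exact h), (faceVol_eq_zero_iff P h).2 hn, zero_mul]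
  · rw [facetTerm, Set.indicator_of_notMem (by exact h)]

/-- If `h_Q(v) < h_P(v)` and `P ∪ Q` is convex, then the face of `Q` lies in `P`. -/
theorem face_subset_of_lt {P Q U : Polytope n} (hU : U.toSet = P.toSet ∪ Q.toSet) {v : E n}
    (h : supp Q.1 v < supp P.1 v) : face Q v ⊆ P.toSet := by
  rintro x ⟨hxQ, hxv⟩
  obtain ⟨y, hyP, hyv⟩ := face_nonempty P v
  have hclosed : IsClosed P.toSet := P.1.isClosed
  have hcont : Filter.Tendsto (fun t : ℝ => x + t • (y - x)) (nhdsWithin 0 (Set.Ioi 0))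
      (nhds x) := by
    have : Continuous fun t : ℝ => x + t • (y - x) := by fun_prop
    simpa using (this.tendsto 0).mono_left (nhdsWithin_le_nhds (s := Set.Ioi 0))
  refine hclosed.mem_of_tendsto hcont ?_
  filter_upwards [Ioo_mem_nhdsGT (zero_lt_one' ℝ)] with t ht
  have hmem : x + t • (y - x) ∈ U.toSet := by
    have hx' : x ∈ U.toSet := by rw [hU]; exact Or.inr hxQ
    have hy' : y ∈ U.toSet := by rw [hU]; exact Or.inl hyP
    have hUc : Convex ℝ U.toSet := U.1.convex
    exact hUc.add_smul_sub_mem hx' hy' ⟨ht.1.le, ht.2.le⟩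
  rw [hU] at hmem
  rcases hmem with hmem | hmem
  · exact hmem
  · exfalso
    have h1 := le_supp Q v hmem
    rw [inner_add_left, real_inner_smul_left, inner_sub_left, hxv, hyv] at h1
    have := mul_pos ht.1 (sub_pos.2 h)
    linarith

/-- The faces of `P ∪ Q` and `P ∩ Q` in a direction in which the support function of `P` is
larger. -/
theorem faces_of_lt {P Q U I : Polytope n} (hU : U.toSet = P.toSet ∪ Q.toSet)
    (hI : I.toSet = P.toSet ∩ Q.toSet) {v : E n} (h : supp Q.1 v < supp P.1 v) :
    supp U.1 v = supp P.1 v ∧ face U v = face P v ∧ supp I.1 v = supp Q.1 v ∧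
      face I v = face Q v := by
  have hsU : supp U.1 v = supp P.1 v := by
    refine supp_eq_of_isGreatest ⟨?_, ?_⟩
    · obtain ⟨y, hyP, hyv⟩ := face_nonempty P v
      exact ⟨y, hU.symm.subset (Or.inl hyP), hyv⟩
    · rintro _ ⟨x, hx, rfl⟩
      rcases hU.subset hx with hx | hx
      · exact le_supp P v hx
      · exact (le_supp Q v hx).trans h.le
  have hsub := face_subset_of_lt hU h
  have hsI : supp I.1 v = supp Q.1 v := by
    refine supp_eq_of_isGreatest ⟨?_, ?_⟩
    · obtain ⟨y, hyQ, hyv⟩ := face_nonempty Q v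
      exact ⟨y, hI.symm.subset ⟨hsub ⟨hyQ, hyv⟩, hyQ⟩, hyv⟩
    · rintro _ ⟨x, hx, rfl⟩
      exact le_supp Q v (hI.subset hx).2
  refine ⟨hsU, ?_, hsI, ?_⟩
  · rw [face_eq, face_eq, hsU, hU]
    ext x
    constructor
    · rintro ⟨hx | hx, hxv⟩
      · exact ⟨hx, hxv⟩
      · have h1 := le_supp Q v hx
        have h2 : ⟪x, v⟫ = supp P.1 v := hxv
        linarith
    · rintro ⟨hx, hxv⟩
      exact ⟨Or.inl hx, hxv⟩
  · rw [face_eq, hsI, hI]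
    ext x
    constructor
    · rintro ⟨⟨-, hx⟩, hxv⟩
      exact ⟨hx, hxv⟩
    · intro hx
      exact ⟨⟨hsub hx, hx.1⟩, hx.2⟩

theorem faces_of_eq {P Q U I : Polytope n} (hU : U.toSet = P.toSet ∪ Q.toSet)
    (hI : I.toSet = P.toSet ∩ Q.toSet) {v : E n} (h : supp Q.1 v = supp P.1 v) :
    supp U.1 v = supp P.1 v ∧ supp I.1 v = supp P.1 v ∧ face U v = face P v ∪ face Q v ∧
      face I v = face P v ∩ face Q v := by
  have hsU : supp U.1 v = supp P.1 v := by
    refine supp_eq_of_isGreatest ⟨?_, ?_⟩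
    · obtain ⟨y, hyP, hyv⟩ := face_nonempty P v
      exact ⟨y, hU.symm.subset (Or.inl hyP), hyv⟩
    · rintro _ ⟨x, hx, rfl⟩
      rcases hU.subset hx with hx | hx
      · exact le_supp P v hx
      · exact (le_supp Q v hx).trans h.le
  have hfU : face U v = face P v ∪ face Q v := by
    rw [face_eq, face_eq, face_eq, hsU, hU, h, Set.union_inter_distrib_right]
  -- the face of the union is connected, so the faces of `P` and `Q` intersect
  have hne : (face P v ∩ face Q v).Nonempty := by
    have hconn := (convex_face U v).isPreconnected
    rw [isPreconnected_closed_iff] at hconn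
    have := hconn (face P v) (face Q v) (isCompact_face P v).isClosed (isCompact_face Q v).isClosed
      hfU.subset ?_ ?_
    · exact this.mono Set.inter_subset_right
    · rw [hfU]
      exact (face_nonempty P v).mono fun x hx => ⟨Or.inl hx, hx⟩
    · rw [hfU]
      exact (face_nonempty Q v).mono fun x hx => ⟨Or.inr hx, hx⟩
  have hsI : supp I.1 v = supp P.1 v := by
    obtain ⟨y, hyP, hyQ⟩ := hne
    refine supp_eq_of_isGreatest ⟨⟨y, hI.symm.subset ⟨hyP.1, hyQ.1⟩, hyP.2⟩, ?_⟩
    rintro _ ⟨x, hx, rfl⟩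
    exact le_supp P v (hI.subset hx).1
  refine ⟨hsU, hsI, hfU, ?_⟩
  rw [face_eq, face_eq, face_eq, hsI, hI, h]
  ext x
  simp only [Set.mem_inter_iff]
  tauto

theorem facetTerm_valuation (p : ℝ) (C : ℝ → Prop) (g : ℝ → ℝ) {P Q U I : Polytope n}
    (hU : U.toSet = P.toSet ∪ Q.toSet) (hI : I.toSet = P.toSet ∩ Q.toSet) (u v : E n) :
    facetTerm p C g U u v + facetTerm p C g I u v =
      facetTerm p C g P u v + facetTerm p C g Q u v := by
  by_cases hv : ‖v‖ = 1
  swap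
  · simp only [facetTerm, Set.indicator_of_notMem (show v ∉ {v : E n | ‖v‖ = 1} from hv)]
  simp only [facetTerm, Set.indicator_of_mem (show v ∈ {v : E n | ‖v‖ = 1} from hv)]
  rcases lt_trichotomy (supp Q.1 v) (supp P.1 v) with h | h | h
  · obtain ⟨h1, h2, h3, h4⟩ := faces_of_lt hU hI h
    simp only [faceVol, h1, h2, h3, h4]
  · obtain ⟨h1, h2, h3, h4⟩ := faces_of_eq hU hI h
    have hvol : faceVol U v + faceVol I v = faceVol P v + faceVol Q v := by
      have hP := hausdorff_lt_top (isCompact_face P v) hv fun x hx => hx.2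
      have hQ := hausdorff_lt_top (isCompact_face Q v) hv fun x hx => hx.2
      have hU' := hausdorff_lt_top (isCompact_face U v) hv fun x hx => hx.2
      have hI' := hausdorff_lt_top (isCompact_face I v) hv fun x hx => hx.2
      rw [faceVol, faceVol, faceVol, faceVol, ← ENNReal.toReal_add hU'.ne hI'.ne,
        ← ENNReal.toReal_add hP.ne hQ.ne, h3, h4,
        MeasureTheory.measure_union_add_inter _ (isCompact_face Q v).isClosed.measurableSet]
    rw [h1, h2, h, ← add_mul, hvol, add_mul]
  · rw [Set.union_comm] at hU
    rw [Set.inter_comm] at hI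
    obtain ⟨h1, h2, h3, h4⟩ := faces_of_lt hU hI h
    simp only [faceVol, h1, h2, h3, h4]
    exact add_comm _ _

theorem facetSum_valuation (p : ℝ) (C : ℝ → Prop) (g : ℝ → ℝ) {P Q U I : Polytope n}
    (hU : U.toSet = P.toSet ∪ Q.toSet) (hI : I.toSet = P.toSet ∩ Q.toSet) (u : E n) :
    facetSum p C g U u + facetSum p C g I u = facetSum p C g P u + facetSum p C g Q u := by
  simp only [facetSum_eq_finsum]
  rw [← finsum_add_distrib (support_facetTerm_finite p C g U u)
    (support_facetTerm_finite p C g I u), ← finsum_add_distrib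
    (support_facetTerm_finite p C g P u) (support_facetTerm_finite p C g Q u)]
  exact finsum_congr fun v => facetTerm_valuation p C g hU hI u v

/-- The facet with unit normal `v` of `P` corresponds to the facet of `φ P` whose normal has the
direction of the image of `v` under the inverse transpose of `φ`. -/
theorem facetSum_image {p : ℝ} {C : ℝ → Prop} {g : ℝ → ℝ}
    (hC : ∀ c t, 0 < c → (C (c * t) ↔ C t)) (hg0 : ∀ t, 0 ≤ g t)
    (hg : ∀ c t, 0 < c → g (c * t) = c * g t)
    (A : Matrix.SpecialLinearGroup (Fin n) ℝ) (P : Polytope n) (u : E n) :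
    facetSum p C g (P.image A) (Matrix.toEuclideanLin (A : Matrix (Fin n) (Fin n) ℝ) u) =
      facetSum p C g P u := by
  set φ := Matrix.toEuclideanLin (A : Matrix (Fin n) (Fin n) ℝ) with hφ
  set ψ := Matrix.toEuclideanLin ((A : Matrix (Fin n) (Fin n) ℝ)⁻¹.transpose) with hψ
  have hψφ : ∀ x y, ⟪ψ x, φ y⟫ = ⟪x, y⟫ := inner_inv_transpose A
  have hφψ : ∀ x y, ⟪φ x, ψ y⟫ = ⟪x, y⟫ := fun x y => by
    rw [real_inner_comm, hψφ, real_inner_comm]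
  have hφs : ∀ x, ∃ y, φ y = x := fun x => ⟨_, toEuclideanLin_inv_apply A x⟩
  have hdet : LinearMap.det φ = 1 := by
    rw [hφ, Matrix.toEuclideanLin_eq_toLin_orthonormal, LinearMap.det_toLin]
    exact A.2
  have hinj : ∀ x y, ψ x = ψ y → x = y := fun x y h =>
    ext_inner_right ℝ fun z => by rw [← hψφ, h, hψφ]
  have hne : ∀ v : E n, ‖v‖ = 1 → 0 < ‖ψ v‖ := by
    intro v hv
    rw [norm_pos_iff]
    intro h0
    have := hinj v 0 (by rw [h0, map_zero])
    rw [this, norm_zero] at hv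
    exact zero_ne_one hv
  have hsupp : ∀ v, supp (P.image A).1 (ψ v) = supp P.1 v := by
    intro v
    refine supp_eq_of_isGreatest ?_
    have : (fun x : E n => ⟪x, ψ v⟫) '' ((P.image A).1 : Set (E n)) =
        (fun x : E n => ⟪x, v⟫) '' (P.1 : Set (E n)) := by
      change (fun x : E n => ⟪x, ψ v⟫) '' (φ '' P.toSet) = _
      rw [Set.image_image]
      exact Set.image_congr fun x _ => hφψ x v
    rw [this]
    exact supp_isGreatest P.1 v
  have hsupp' : ∀ (c : ℝ) (v : E n), 0 < c →
      supp (P.image A).1 (c • ψ v) = c * supp P.1 v := fun c v hc => by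
    rw [supp_smul _ _ _ hc, hsupp]
  have hface : ∀ (c : ℝ) (v : E n), 0 < c → face (P.image A) (c • ψ v) = φ '' face P v := by
    intro c v hc
    ext x
    constructor
    · rintro ⟨⟨y, hy, rfl⟩, hx⟩
      refine ⟨y, ⟨hy, ?_⟩, rfl⟩
      rw [hsupp' c v hc, real_inner_smul_right] at hx
      have hx : c * ⟪φ y, ψ v⟫ = c * supp P.1 v := hx
      rw [hφψ] at hx
      exact mul_left_cancel₀ hc.ne' hx
    · rintro ⟨y, ⟨hy, hyv⟩, rfl⟩
      refine ⟨⟨y, hy, rfl⟩, ?_⟩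
      rw [hsupp' c v hc, real_inner_smul_right, hφψ, hyv]
  rw [facetSum_eq, facetSum_eq]
  symm
  refine finsum_mem_eq_of_bijOn (fun v => ‖ψ v‖⁻¹ • ψ v) ⟨?_, ?_, ?_⟩ ?_
  · rintro v ⟨hv, hCv⟩
    have hpos := hne v hv
    refine ⟨?_, ?_⟩
    · rw [norm_smul, norm_inv, norm_norm, inv_mul_cancel₀ hpos.ne']
    · rw [hsupp' _ _ (inv_pos.2 hpos)]
      exact (hC _ _ (inv_pos.2 hpos)).2 hCv
  · rintro v ⟨hv, -⟩ w ⟨hw, -⟩ hvw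
    simp only [← map_smul] at hvw
    have h1 := hinj _ _ hvw
    have h2 := congrArg norm h1
    rw [norm_smul, norm_smul, hv, hw, mul_one, mul_one, norm_inv, norm_inv, norm_norm,
      norm_norm] at h2
    rw [h2] at h1
    exact smul_right_injective _ (inv_ne_zero (hne w hw).ne') h1
  · rintro v' ⟨hv', hCv'⟩
    -- the preimage is the direction of the transpose of `φ` applied to `v'`
    obtain ⟨w, hw⟩ : ∃ w, ψ w = v' := by
      refine ⟨LinearMap.adjoint φ v', ?_⟩
      refine ext_inner_right ℝ fun z => ?_
      obtain ⟨y, rfl⟩ := hφs z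
      rw [hψφ, LinearMap.adjoint_inner_left]
    have hw0 : 0 < ‖w‖ := by
      rw [norm_pos_iff]
      rintro rfl
      rw [map_zero] at hw
      rw [← hw, norm_zero] at hv'
      exact zero_ne_one hv'
    have hψw : ψ (‖w‖⁻¹ • w) = ‖w‖⁻¹ • v' := by rw [map_smul, hw]
    refine ⟨‖w‖⁻¹ • w, ⟨?_, ?_⟩, ?_⟩
    · rw [norm_smul, norm_inv, norm_norm, inv_mul_cancel₀ hw0.ne']
    · rw [supp_smul _ _ _ (inv_pos.2 hw0), hC _ _ (inv_pos.2 hw0), ← hsupp, hw]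
      exact hCv'
    · simp only
      rw [hψw, norm_smul, hv', mul_one, norm_inv, norm_norm, inv_inv, smul_smul,
        mul_inv_cancel₀ hw0.ne', one_smul]
  · rintro v ⟨hv, -⟩
    have hpos := hne v hv
    have hvol : faceVol (P.image A) (‖ψ v‖⁻¹ • ψ v) = ‖ψ v‖ * faceVol P v := by
      rw [faceVol, hface _ _ (inv_pos.2 hpos), hausdorff_image (isCompact_face P v)
        (v' := ‖ψ v‖⁻¹ • ψ v) (h := supp P.1 v) (h' := ‖ψ v‖⁻¹ * supp P.1 v) (s := ‖ψ v‖) hv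
        (fun x hx => hx.2) hdet ?_ ?_ hpos ?_, ENNReal.toReal_mul, ENNReal.toReal_ofReal hpos.le,
        faceVol]
      · rw [norm_smul, norm_inv, norm_norm, inv_mul_cancel₀ hpos.ne']
      · intro x hx
        rw [real_inner_smul_right, hφψ, hx.2]
      · rw [real_inner_smul_right, hφψ, real_inner_self_eq_norm_sq, hv, one_pow, mul_one]
    rw [hvol, hsupp' _ _ (inv_pos.2 hpos), real_inner_smul_left, hψφ, hg _ _ (inv_pos.2 hpos),
      abs_mul, abs_of_pos (inv_pos.2 hpos),
      Real.mul_rpow (inv_pos.2 hpos).le (abs_nonneg _),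
      Real.mul_rpow (inv_pos.2 hpos).le (hg0 _)]
    have e : ‖ψ v‖ * (‖ψ v‖⁻¹ ^ (1 - p) * ‖ψ v‖⁻¹ ^ p) = 1 := by
      rw [← Real.rpow_add (inv_pos.2 hpos), sub_add_cancel, Real.rpow_one,
        mul_inv_cancel₀ hpos.ne']
    linear_combination (-(faceVol P v * |supp P.1 v| ^ (1 - p) * g ⟪v, u⟫ ^ p)) * e

end Facets

/-! ### Comparison of the values on the two kinds of standard simplices -/

section Compare

variable {n : ℕ} {p : ℝ} {Z : Set (E n) → E n → ℝ}

theorem stdB_update_det (k : Fin n) (t : ℝ) :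
    (stdB n).det (Function.update (stdB n) k (t • stdB n k)) = t := by
  rw [AlternatingMap.map_update_smul, Function.update_eq_self, Module.Basis.det_self, smul_eq_mul,
    mul_one]

/-- The part of the standard simplex `conv {0, e₁, …, eₙ}` cut off by the hyperplane through
`e_k / 2` and the other `eᵢ`. -/
theorem simplex_inter_le {k : Fin n} {α : E n →ₗ[ℝ] ℝ} (hk : α (stdB n k) = 2)
    (hα : ∀ i, i ≠ k → α (stdB n i) = 1) :
    simplex {0} (stdB n) ∩ {x | α x ≤ 1} =
      simplex {0} (Function.update (stdB n) k ((1 / 2 : ℝ) • stdB n k)) := by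
  have hcr : crossPt α 1 0 (stdB n k) = (1 / 2 : ℝ) • stdB n k := by
    rw [crossPt, hk]
    simp
  rw [convexHull_inter_halfSpace]
  congr 1
  ext x
  constructor
  · rintro (⟨hx | ⟨i, rfl⟩, hx1⟩ | ⟨a, ⟨ha, ha1⟩, b, ⟨hb, hb1⟩, rfl⟩)
    · exact Or.inl hx
    · refine Or.inr ⟨i, Function.update_of_ne ?_ _ _⟩
      rintro rfl
      linarith
    · have hb' : b = stdB n k := by
        rcases hb with hb | ⟨i, rfl⟩
        · rw [hb, map_zero] at hb1
          linarith
        · by_contra hne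
          have := hα i (fun h => hne (by rw [h]))
          linarith
      have ha' : a = 0 := by
        rcases ha with ha | ⟨i, rfl⟩
        · exact ha
        · exfalso
          by_cases hik : i = k
          · subst hik; linarith
          · have := hα i hik
            linarith
      rw [ha', hb', hcr]
      exact Or.inr ⟨k, Function.update_self _ _ _⟩
  · rintro (hx | ⟨i, rfl⟩)
    · exact Or.inl ⟨Or.inl hx, by rw [hx, map_zero]; exact zero_le_one⟩
    · by_cases hik : i = k
      · subst hik
        rw [Function.update_self, ← hcr]
        exact Or.inr ⟨0, ⟨Or.inl rfl, by rw [map_zero]; exact one_pos⟩, _, ⟨Or.inr ⟨i, rfl⟩,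
          by rw [hk]; exact one_lt_two⟩, rfl⟩
      · rw [Function.update_of_ne hik]
        exact Or.inl ⟨Or.inr ⟨i, rfl⟩, (hα i hik).le⟩

theorem simplex_inter_eq {v : Fin n → E n} {α : E n →ₗ[ℝ] ℝ} (hα : ∀ i, α (v i) = 1) :
    simplex {0} v ∩ {x | α x = 1} = simplex ∅ v := by
  have hG : ∀ g ∈ convexHull ℝ (Set.range v), α g = 1 :=
    convexHull_min (by rintro _ ⟨i, rfl⟩; exact hα i) (convex_hyperplane α.isLinear 1)
  rw [simplex, simplex, Set.empty_union, ← convexHull_union_convexHull]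
  ext x
  rw [Set.mem_inter_iff, mem_convexHull_zero_union (convex_convexHull ℝ _)]
  constructor
  · rintro ⟨rfl | ⟨t, ht, ht1, g, hg, rfl⟩, hx⟩
    · simp at hx
    · have hx : α (t • g) = 1 := hx
      rw [map_smul, hG g hg, smul_eq_mul, mul_one] at hx
      rwa [hx, one_smul]
  · intro hx
    exact ⟨Or.inr ⟨1, one_pos, le_rfl, x, hx, (one_smul ℝ x).symm⟩, hG x hx⟩

/-- The value of a contravariant valuation at `± e_k` is larger for `conv {e₁, …, eₙ}` than for
`conv {0, e₁, …, eₙ}`. To see this, cut off a corner of the latter simplex and evaluate at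
`± (e_k - e_j)`. -/
theorem ContraVal.le_simplex (hZ : ContraVal p Z) (hn : 3 ≤ n) (hp : 1 < p) (k : Fin n) {s : ℝ}
    (hs : s = 1 ∨ s = -1) :
    Z (simplex {0} (stdB n)) (s • stdB n k) ≤ Z (simplex ∅ (stdB n)) (s • stdB n k) := by
  have hp0 : p ≠ 0 := by linarith
  obtain ⟨j, -, -, hjk, -⟩ := exists_two_ne hn k
  set v := Function.update (stdB n) k ((1 / 2 : ℝ) • stdB n k) with hv
  set α : E n →ₗ[ℝ] ℝ := ∑ i, (stdB n).coord i + (stdB n).coord k with hαdef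
  have hαe : ∀ i, α (stdB n i) = 1 + if i = k then 1 else 0 := by
    intro i
    simp only [hαdef, LinearMap.add_apply, LinearMap.sum_apply, Module.Basis.coord_apply,
      Module.Basis.repr_self, Finsupp.single_apply]
    simp
  have hk : α (stdB n k) = 2 := by rw [hαe, if_pos rfl]; norm_num
  have hi : ∀ i, i ≠ k → α (stdB n i) = 1 := fun i h => by rw [hαe, if_neg h, add_zero]
  have hαv : ∀ i, α (v i) = 1 := by
    intro i
    by_cases hik : i = k
    · subst hik
      rw [hv, Function.update_self, map_smul, hk]
      norm_num
    · rw [hv, Function.update_of_ne hik, hi i hik]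
  set u : E n := s • (stdB n k - stdB n j) with hu
  have hcut := (hZ.cut u).cut _ (isPoly_simplex Set.Subset.rfl (stdB n)) α 1
  have hle := simplex_inter_le hk hi
  have heq : simplex {0} (stdB n) ∩ {x | α x = 1} = simplex ∅ v := by
    rw [← simplex_inter_eq hαv, ← hle]
    ext x
    constructor
    · rintro ⟨hx, hx1⟩
      exact ⟨⟨hx, le_of_eq hx1⟩, hx1⟩
    · rintro ⟨⟨hx, -⟩, hx1⟩
      exact ⟨hx, hx1⟩
  rw [hle, heq] at hcut
  have hdet : (stdB n).det v = 1 / 2 := stdB_update_det k _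
  have hu1 : ∑ i, (Pi.single k s - Pi.single j s : Fin n → ℝ) i • stdB n i = u := by
    simp only [Pi.sub_apply, sub_smul, Finset.sum_sub_distrib, Pi.single_apply, ite_smul, zero_smul,
      Finset.sum_ite_eq', Finset.mem_univ, if_true, hu, smul_sub]
  have hu2 : ∑ i, (Pi.single k (2 * s) - Pi.single j s : Fin n → ℝ) i • v i = u := by
    simp only [Pi.sub_apply, sub_smul, Finset.sum_sub_distrib, Pi.single_apply, ite_smul, zero_smul,
      Finset.sum_ite_eq', Finset.mem_univ, if_true, hu, hv, Function.update_self,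
      Function.update_of_ne hjk, smul_sub, smul_smul]
    congr 2
    ring
  have hsum1 : ∑ i, (Pi.single k s - Pi.single j s : Fin n → ℝ) i = 0 := by
    simp [Finset.sum_sub_distrib]
  have hsum2 : ∑ i, (Pi.single k (2 * s) - Pi.single j s : Fin n → ℝ) i = s := by
    simp only [Pi.sub_apply, Finset.sum_sub_distrib, Finset.sum_pi_single', Finset.mem_univ,
      if_true]
    ring
  have h1 := hZ.simplex_eq hn hp Set.Subset.rfl k (v := stdB n)
    (by rw [Module.Basis.det_self]; exact one_ne_zero) (Pi.single k s - Pi.single j s)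
  have h2 := hZ.simplex_eq hn hp Set.Subset.rfl k (v := v) (by rw [hdet]; norm_num)
    (Pi.single k (2 * s) - Pi.single j s)
  have h3 := hZ.simplex_eq hn hp (Set.empty_subset {0}) k (v := v) (by rw [hdet]; norm_num)
    (Pi.single k (2 * s) - Pi.single j s)
  rw [hu1, hsum1, neg_zero, max_self, Real.zero_rpow hp0, mul_zero, mul_zero,
    add_zero, mul_zero] at h1
  rw [hu2, hsum2, hdet] at h2 h3
  have h4 := hZ.nonneg (simplex {0} (stdB n) ∩ {x | 1 ≤ α x}) u
  rw [abs_of_pos (by norm_num : (0 : ℝ) < 1 / 2)] at h2 h3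
  rcases hs with rfl | rfl
  · rw [max_eq_left zero_le_one, max_eq_right (by norm_num : (-1 : ℝ) ≤ 0), Real.one_rpow,
      Real.zero_rpow hp0] at h2 h3
    rw [one_smul]
    linarith
  · rw [neg_neg, max_eq_left zero_le_one, max_eq_right (by norm_num : (-1 : ℝ) ≤ 0), Real.one_rpow,
      Real.zero_rpow hp0] at h2 h3
    rw [neg_one_smul]
    linarith

/-- A contravariant valuation is determined by its values at `± e_k` on the two standard
simplices. -/
theorem ContraVal.eq_sum (hZ : ContraVal p Z) (hn : 3 ≤ n) (hp : 1 < p) (k : Fin n)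
    {ι : Type*} [Fintype ι] {Y : ι → Set (E n) → E n → ℝ} (hY : ∀ i, ContraVal p (Y i)) (w : ι → ℝ)
    (h : ∀ o : Set (E n), o ⊆ {0} → ∀ s : ℝ, s = 1 ∨ s = -1 →
      Z (simplex o (stdB n)) (s • stdB n k) = ∑ i, w i * Y i (simplex o (stdB n)) (s • stdB n k))
    {P : Set (E n)} (hP : IsPoly P) (u : E n) : Z P u = ∑ i, w i * Y i P u := by
  obtain ⟨m, rfl⟩ : ∃ m, n = m + 1 := ⟨n - 1, by omega⟩
  have hD : CutVal fun P => Z P u - ∑ i, w i * Y i P u :=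
    { empty := by
        simp only [(hZ.cut u).empty, ((hY _).cut u).empty, mul_zero, Finset.sum_const_zero,
          sub_zero]
      cut := by
        intro P hP f c
        have h1 := (hZ.cut u).cut P hP f c
        have h2 : ∑ i, w i * Y i P u + ∑ i, w i * Y i (P ∩ {x | f x = c}) u =
            ∑ i, w i * Y i (P ∩ {x | f x ≤ c}) u + ∑ i, w i * Y i (P ∩ {x | c ≤ f x}) u := by
          rw [← Finset.sum_add_distrib, ← Finset.sum_add_distrib]
          refine Finset.sum_congr rfl fun i _ => ?_
          rw [← mul_add, ← mul_add, ((hY i).cut u).cut P hP f c]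
        linarith }
  refine sub_eq_zero.1 (hD.eq_zero_of_bases finrank_euclideanSpace_fin ?_ ?_ P hP)
  · intro P hP f hf hPf
    simp only [hZ.eq_zero_of_hyperplane hn hp hP hf hPf,
      (hY _).eq_zero_of_hyperplane hn hp hP hf hPf,
      mul_zero, Finset.sum_const_zero, sub_zero]
  · intro o ho v hv
    let b := basisOfLinearIndependentOfCardEqFinrank hv (by simp)
    have hb : (b : Fin (m + 1) → E (m + 1)) = v := coe_basisOfLinearIndependentOfCardEqFinrank _ _
    have hdet : (stdB (m + 1)).det v ≠ 0 := by
      rw [← hb]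
      exact ((stdB (m + 1)).isUnit_det b).ne_zero
    have hu : ∑ i, b.repr u i • v i = u := by
      rw [← hb]
      exact b.sum_repr u
    have hp1 := h o ho 1 (Or.inl rfl)
    have hm1 := h o ho (-1) (Or.inr rfl)
    simp only [one_smul, neg_one_smul] at hp1 hm1
    have e1 := hZ.simplex_eq hn hp ho k hdet (b.repr u)
    have e2 := fun i => (hY i).simplex_eq hn hp ho k hdet (b.repr u)
    rw [hu, hp1, hm1] at e1
    simp only [hu] at e2
    change Z (simplex o v) u - ∑ i, w i * Y i (simplex o v) u = 0
    rw [e1]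
    simp only [e2]
    rw [sub_eq_zero, Finset.sum_mul, Finset.sum_mul, ← Finset.sum_add_distrib, Finset.mul_sum]
    exact Finset.sum_congr rfl fun i _ => by ring

end Compare

/-! ### The operators on standard simplices -/

section Operators

variable {n : ℕ} {p : ℝ} {C : ℝ → Prop} {g : ℝ → ℝ}

/-- Contravariance and the valuation property pass to bodies whose support functions, raised to the
power `p`, are linear combinations. -/
theorem contravariant_valuation_of_sum (hp : 1 < p) {ι : Type*} [Fintype ι]
    {Φ : Polytope n → ConvexBodyO n} {w : ι → ℝ} {G : ι → Polytope n → E n → ℝ}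
    (hΦ : ∀ P u, supp (Φ P).1 u ^ p = ∑ i, w i * G i P u)
    (hc : ∀ i (A : Matrix.SpecialLinearGroup (Fin n) ℝ) P u,
      G i (P.image A) (Matrix.toEuclideanLin (A : Matrix (Fin n) (Fin n) ℝ) u) = G i P u)
    (hv : ∀ i (P Q U I : Polytope n), U.toSet = P.toSet ∪ Q.toSet → I.toSet = P.toSet ∩ Q.toSet →
      ∀ u, G i U u + G i I u = G i P u + G i Q u) :
    IsSLContravariant Φ ∧ IsLpMinkowskiValuation p Φ := by
  refine ⟨isSLContravariant_iff.2 fun A P u => ?_,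
    (isLpMinkowskiValuation_iff hp).2 fun P Q U I hU hI u => ?_⟩
  · refine (Real.rpow_left_inj (supp_nonneg _ _) (supp_nonneg _ _) (by linarith : p ≠ 0)).1 ?_
    rw [hΦ, hΦ]
    exact Finset.sum_congr rfl fun i _ => by rw [hc]
  · simp only [hΦ]
    rw [← Finset.sum_add_distrib, ← Finset.sum_add_distrib]
    exact Finset.sum_congr rfl fun i _ => by rw [← mul_add, ← mul_add, hv i P Q U I hU hI]

/-- The vector `(1, …, 1) / √n`, which is a unit normal of `conv {e₁, …, eₙ}`. -/
def diag (n : ℕ) : E n := ‖∑ i, stdB n i‖⁻¹ • ∑ i, stdB n i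

theorem inner_stdB_sum (k : Fin n) : ⟪stdB n k, ∑ i, stdB n i⟫ = (1 : ℝ) := by
  rw [inner_sum]
  simp [EuclideanSpace.inner_single_left, Finset.sum_ite_eq]

theorem norm_sum_stdB_pos (hn : n ≠ 0) : 0 < ‖∑ i, stdB n i‖ := by
  rw [norm_pos_iff]
  intro h
  have := inner_stdB_sum (⟨0, Nat.pos_of_ne_zero hn⟩ : Fin n)
  rw [h, inner_zero_right] at this
  exact zero_ne_one this

theorem norm_diag (hn : n ≠ 0) : ‖diag n‖ = 1 := by
  rw [diag, norm_smul, norm_inv, norm_norm, inv_mul_cancel₀ (norm_sum_stdB_pos hn).ne']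

theorem inner_stdB_diag (k : Fin n) : ⟪stdB n k, diag n⟫ = ‖∑ i, stdB n i‖⁻¹ := by
  rw [diag, real_inner_smul_right, inner_stdB_sum, mul_one]

theorem inner_simplex_le {o : Set (E n)} {v : E n} {t : ℝ} (ho : ∀ x ∈ o, ⟪x, v⟫ ≤ t)
    (h : ∀ i, ⟪stdB n i, v⟫ ≤ t) : ∀ x ∈ simplex o (stdB n), ⟪x, v⟫ ≤ t := by
  have hc : Convex ℝ {x : E n | ⟪x, v⟫ ≤ t} := by
    intro x hx y hy a b ha hb hab
    have hx : ⟪x, v⟫ ≤ t := hx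
    have hy : ⟪y, v⟫ ≤ t := hy
    change ⟪a • x + b • y, v⟫ ≤ t
    rw [inner_add_left, real_inner_smul_left, real_inner_smul_left]
    have h1 := mul_le_mul_of_nonneg_left hx ha
    have h2 := mul_le_mul_of_nonneg_left hy hb
    have h3 : a * t + b * t = t := by rw [← add_mul, hab, one_mul]
    linarith
  refine convexHull_min ?_ hc
  rintro x (hx | ⟨i, rfl⟩)
  · exact ho x hx
  · exact h i

theorem supp_simplex_diag {o : Set (E n)} (hn : n ≠ 0) (ho : o ⊆ {0}) {P : Polytope n}
    (hP : P.toSet = simplex o (stdB n)) : supp P.1 (diag n) = ‖∑ i, stdB n i‖⁻¹ := by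
  refine supp_eq_of_isGreatest ⟨⟨stdB n ⟨0, Nat.pos_of_ne_zero hn⟩,
    hP.symm.subset (subset_convexHull ℝ _ (Or.inr ⟨_, rfl⟩)), inner_stdB_diag _⟩, ?_⟩
  rintro _ ⟨x, hx, rfl⟩
  refine inner_simplex_le (fun x hx => ?_) (fun i => (inner_stdB_diag i).le) x (hP.subset hx)
  rw [ho hx, inner_zero_left]
  exact inv_nonneg.2 (norm_nonneg _)

theorem supp_simplex_neg_diag (hn : n ≠ 0) {P : Polytope n}
    (hP : P.toSet = simplex ∅ (stdB n)) : supp P.1 (-diag n) = -‖∑ i, stdB n i‖⁻¹ := by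
  refine supp_eq_of_isGreatest ⟨⟨stdB n ⟨0, Nat.pos_of_ne_zero hn⟩,
    hP.symm.subset (subset_convexHull ℝ _ (Or.inr ⟨_, rfl⟩)), ?_⟩, ?_⟩
  · simp only [inner_neg_right, inner_stdB_diag]
  · rintro _ ⟨x, hx, rfl⟩
    exact inner_simplex_le (fun x hx => hx.elim)
      (fun i => by rw [inner_neg_right, inner_stdB_diag]) x (hP.subset hx)

theorem supp_simplex_zero_neg_diag {P : Polytope n}
    (hP : P.toSet = simplex {0} (stdB n)) : supp P.1 (-diag n) = 0 := by
  refine supp_eq_of_isGreatest ⟨⟨0, hP.symm.subset (subset_convexHull ℝ _ (Or.inl rfl)),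
    inner_zero_left _⟩, ?_⟩
  rintro _ ⟨x, hx, rfl⟩
  refine inner_simplex_le (fun x hx => ?_) (fun i => ?_) x (hP.subset hx)
  · rw [hx, inner_zero_left]
  · rw [inner_neg_right, inner_stdB_diag, neg_nonpos]
    exact inv_nonneg.2 (norm_nonneg _)

/-- A face of a standard simplex is spanned by the vertices it contains. -/
theorem face_simplex {o : Set (E n)} (ho : o ⊆ {0}) {P : Polytope n}
    (hP : P.toSet = simplex o (stdB n)) (v : E n) :
    face P v = convexHull ℝ ((o ∪ Set.range (stdB n)) ∩ {y | ⟪y, v⟫ = supp P.1 v}) := by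
  have hfin : (o ∪ Set.range (stdB n)).Finite :=
    ((Set.finite_singleton 0).subset ho).union (Set.finite_range _)
  rw [face_eq_convexHull P hfin.toFinset (by rw [hfin.coe_toFinset]; exact hP)]
  congr 1
  ext y
  simp only [Set.mem_ofPred_eq, Set.Finite.mem_toFinset, Set.mem_inter_iff]

theorem face_simplex_eq {o : Set (E n)} (ho : o ⊆ {0}) {P : Polytope n}
    (hP : P.toSet = simplex o (stdB n)) {v : E n} (h0 : supp P.1 v ≠ 0)
    (h : ∀ i, ⟪stdB n i, v⟫ = supp P.1 v) : face P v = simplex ∅ (stdB n) := by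
  rw [face_simplex ho hP, simplex]
  congr 1
  ext y
  constructor
  · rintro ⟨hy | hy, hyv⟩
    · have hyv : ⟪y, v⟫ = supp P.1 v := hyv
      rw [ho hy, inner_zero_left] at hyv
      exact absurd hyv.symm h0
    · exact Or.inr hy
  · rintro (hy | ⟨i, rfl⟩)
    · exact hy.elim
    · exact ⟨Or.inr ⟨i, rfl⟩, h i⟩

theorem finrank_vectorSpan_simplex (hn : n ≠ 0) :
    Module.finrank ℝ (vectorSpan ℝ (simplex ∅ (stdB n))) + 1 = n := by
  rw [← direction_affineSpan, affineSpan_convexHull, direction_affineSpan, Set.empty_union,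
    (stdB n).linearIndependent.affineIndependent.finrank_vectorSpan (n := n - 1)
      (by rw [Fintype.card_fin]; omega)]
  omega

/-- If a facet of a standard simplex does not lie on a hyperplane through the origin, then its unit
normal is `± (1, …, 1) / √n`: otherwise one of the vectors `eᵢ` is missing from the facet, which is
then spanned by too few vertices. -/
theorem eq_diag_of_facet {o : Set (E n)} (ho : o ⊆ {0}) {P : Polytope n}
    (hP : P.toSet = simplex o (stdB n)) {v : E n} (hv : v ∈ facetNormals P)
    (h0 : supp P.1 v ≠ 0) : v = diag n ∨ v = -diag n := by
  have hall : ∀ i, ⟪stdB n i, v⟫ = supp P.1 v := by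
    by_contra hcon
    push Not at hcon
    obtain ⟨i, hi⟩ := hcon
    have hsub : ((o ∪ Set.range (stdB n)) ∩ {y | ⟪y, v⟫ = supp P.1 v}) ⊆
        Set.range fun j : {j // j ≠ i} => stdB n j := by
      rintro y ⟨hy | ⟨j, rfl⟩, hyv⟩
      · have hyv : ⟪y, v⟫ = supp P.1 v := hyv
        rw [ho hy, inner_zero_left] at hyv
        exact absurd hyv.symm h0
      · refine ⟨⟨j, ?_⟩, rfl⟩
        rintro rfl
        exact hi hyv
    have hne : Nonempty {j // j ≠ i} := by
      have h1 := face_nonempty P v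
      rw [face_simplex ho hP, convexHull_nonempty_iff] at h1
      obtain ⟨y, hy⟩ := h1
      obtain ⟨j, -⟩ := hsub hy
      exact ⟨j⟩
    have hcard : Fintype.card {j // j ≠ i} = n - 1 := by
      rw [Fintype.card_subtype_compl, Fintype.card_subtype_eq, Fintype.card_fin]
    have hpos : 0 < Fintype.card {j // j ≠ i} := Fintype.card_pos
    have h2 := finrank_vectorSpan_range_le ℝ (fun j : {j // j ≠ i} => stdB n j) (n := n - 2)
      (by omega)
    have h3 := hv.2
    rw [face_simplex ho hP, ← direction_affineSpan, affineSpan_convexHull,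
      direction_affineSpan] at h3
    have h4 := Submodule.finrank_mono (vectorSpan_mono ℝ hsub)
    omega
  have hv' : v = supp P.1 v • ∑ i, stdB n i := by
    refine InnerProductSpace.ext_inner_left_basis (stdB n) fun i => ?_
    rw [real_inner_smul_right, inner_stdB_sum, mul_one]
    exact hall i
  have h1 : |supp P.1 v| * ‖∑ i, stdB n i‖ = 1 := by
    rw [← Real.norm_eq_abs, ← norm_smul, ← hv', hv.1]
  have h2 : |supp P.1 v| = ‖∑ i, stdB n i‖⁻¹ := eq_inv_of_mul_eq_one_left h1
  rw [hv', diag]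
  rcases abs_eq (inv_nonneg.2 (norm_nonneg _)) |>.1 h2 with h | h
  · left
    rw [h]
  · right
    rw [h, neg_smul]

theorem diag_ne_neg (hn : n ≠ 0) : diag n ≠ -diag n := by
  intro h
  have h1 := congrArg (fun x : E n => ⟪diag n, x⟫) h
  simp only [inner_neg_right, real_inner_self_eq_norm_sq, norm_diag hn] at h1
  norm_num at h1

/-- Only the facets with normals `± (1, …, 1) / √n` of a standard simplex contribute, provided that
support numbers equal to zero are excluded. -/
theorem facetSum_simplex {o : Set (E n)} (hn : n ≠ 0) (ho : o ⊆ {0}) (hC0 : ¬ C 0) {P : Polytope n}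
    (hP : P.toSet = simplex o (stdB n)) (u : E n) :
    facetSum p C g P u = facetTerm p C g P u (diag n) + facetTerm p C g P u (-diag n) := by
  classical
  rw [facetSum_eq_finsum, finsum_eq_sum_of_support_subset (s := {diag n, -diag n}),
    Finset.sum_pair (diag_ne_neg hn)]
  intro v hv
  have h1 : ‖v‖ = 1 := by
    by_contra h
    exact hv (Set.indicator_of_notMem (by exact h) _)
  have h2 : supp P.1 v ≠ 0 := by
    intro h
    refine hv ?_
    rw [facetTerm, Set.indicator_of_mem (by exact h1), h, Set.indicator_of_notMem (by exact hC0),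
      zero_mul, mul_zero]
  have h3 : v ∈ facetNormals P := by
    by_contra h
    refine hv ?_
    rw [facetTerm, Set.indicator_of_mem (by exact h1), (faceVol_eq_zero_iff P h1).2 h, zero_mul]
  rw [Finset.coe_pair]
  exact eq_diag_of_facet ho hP h3 h2

/-- The weight of the facet `conv {e₁, …, eₙ}`, multiplied by the `p`-th power of the inner product
of its unit normal with the basis vectors. -/
def simplexConst (n : ℕ) (p : ℝ) : ℝ :=
  (μHE[n - 1] (simplex ∅ (stdB n))).toReal *
    ((‖∑ i, stdB n i‖⁻¹) ^ (1 - p) * (‖∑ i, stdB n i‖⁻¹) ^ p)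

theorem simplexConst_pos (hn : n ≠ 0) : 0 < simplexConst n p := by
  have hc := inv_pos.2 (norm_sum_stdB_pos hn)
  obtain ⟨P, hP⟩ := (isPoly_simplex Set.Subset.rfl (stdB n)).exists_polytope
    (⟨0, subset_convexHull ℝ _ (Or.inl rfl)⟩ : (simplex {0} (stdB n)).Nonempty)
  have hs := supp_simplex_diag hn Set.Subset.rfl hP
  have hface : face P (diag n) = simplex ∅ (stdB n) :=
    face_simplex_eq Set.Subset.rfl hP (by rw [hs]; exact hc.ne') fun i => by
      rw [hs, inner_stdB_diag]
  refine mul_pos ?_ (mul_pos (Real.rpow_pos_of_pos hc _) (Real.rpow_pos_of_pos hc _))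
  rw [← hface]
  refine lt_of_le_of_ne (faceVol_nonneg P _) fun h => ?_
  refine (faceVol_eq_zero_iff P (norm_diag hn)).1 h.symm ⟨norm_diag hn, ?_⟩
  rw [hface]
  exact finrank_vectorSpan_simplex hn

theorem facetTerm_of_face {P : Polytope n} {v : E n} (hv : ‖v‖ = 1)
    (hs : |supp P.1 v| = ‖∑ i, stdB n i‖⁻¹) (hC : C (supp P.1 v))
    (hface : face P v = simplex ∅ (stdB n)) (hg0 : ∀ t, 0 ≤ g t)
    (hg : ∀ c t, 0 < c → g (c * t) = c * g t) {t : ℝ} {u : E n} (hn : n ≠ 0)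
    (hu : ⟪v, u⟫ = ‖∑ i, stdB n i‖⁻¹ * t) :
    facetTerm p C g P u v = simplexConst n p * g t ^ p := by
  have hc := inv_pos.2 (norm_sum_stdB_pos hn)
  rw [facetTerm, Set.indicator_of_mem (by exact hv), Set.indicator_of_mem (by exact hC), hs,
    faceVol, hface, hu, hg _ _ hc, Real.mul_rpow hc.le (hg0 t), simplexConst]
  ring

theorem facetSum_gt_simplex {o : Set (E n)} (hn : n ≠ 0) (ho : o ⊆ {0}) (hg0 : ∀ t, 0 ≤ g t)
    (hg : ∀ c t, 0 < c → g (c * t) = c * g t) {P : Polytope n}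
    (hP : P.toSet = simplex o (stdB n)) (s : ℝ) (k : Fin n) :
    facetSum p (fun t => 0 < t) g P (s • stdB n k) = simplexConst n p * g s ^ p := by
  have hc := inv_pos.2 (norm_sum_stdB_pos hn)
  have hs := supp_simplex_diag hn ho hP
  have hneg : ¬ 0 < supp P.1 (-diag n) := by
    rcases Set.subset_singleton_iff_eq.1 ho with rfl | rfl
    · rw [supp_simplex_neg_diag hn hP]
      linarith
    · rw [supp_simplex_zero_neg_diag hP]
      exact lt_irrefl 0
  have h2 : facetTerm p (fun t => 0 < t) g P (s • stdB n k) (-diag n) = 0 := by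
    rw [facetTerm, Set.indicator_of_mem (by simpa using norm_diag hn),
      Set.indicator_of_notMem (by exact hneg), zero_mul, mul_zero]
  rw [facetSum_simplex (C := fun t => 0 < t) hn ho (lt_irrefl 0) hP, h2, add_zero]
  refine facetTerm_of_face (norm_diag hn) (by rw [hs, abs_of_pos hc]) (by rw [hs]; exact hc)
    (face_simplex_eq ho hP (by rw [hs]; exact hc.ne') fun i => by rw [hs, inner_stdB_diag])
    hg0 hg hn ?_
  rw [real_inner_smul_right, real_inner_comm, inner_stdB_diag, mul_comm]

theorem facetSum_lt_simplex (hn : n ≠ 0) (hg0 : ∀ t, 0 ≤ g t)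
    (hg : ∀ c t, 0 < c → g (c * t) = c * g t) {P : Polytope n}
    (hP : P.toSet = simplex ∅ (stdB n)) (s : ℝ) (k : Fin n) :
    facetSum p (fun t => t < 0) g P (s • stdB n k) = simplexConst n p * g (-s) ^ p := by
  have hc := inv_pos.2 (norm_sum_stdB_pos hn)
  have ho : (∅ : Set (E n)) ⊆ {0} := Set.empty_subset _
  have hs := supp_simplex_neg_diag hn hP
  have h2 : facetTerm p (fun t => t < 0) g P (s • stdB n k) (diag n) = 0 := by
    rw [facetTerm, Set.indicator_of_mem (by exact norm_diag hn), supp_simplex_diag hn ho hP,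
      Set.indicator_of_notMem (by exact not_lt.2 hc.le), zero_mul, mul_zero]
  rw [facetSum_simplex (C := fun t => t < 0) hn ho (lt_irrefl 0) hP, h2, zero_add]
  refine facetTerm_of_face (by rw [norm_neg, norm_diag hn]) (by rw [hs, abs_neg, abs_of_pos hc])
    (by rw [hs]; exact neg_lt_zero.2 hc)
    (face_simplex_eq ho hP (by rw [hs]; exact (neg_lt_zero.2 hc).ne) fun i => by
      rw [hs, inner_neg_right, inner_stdB_diag]) hg0 hg hn ?_
  rw [real_inner_smul_right, inner_neg_left, real_inner_comm, inner_stdB_diag]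
  ring

theorem facetSum_lt_simplex_zero (hn : n ≠ 0) {P : Polytope n}
    (hP : P.toSet = simplex {0} (stdB n)) (u : E n) :
    facetSum p (fun t => t < 0) g P u = 0 := by
  have hc := inv_pos.2 (norm_sum_stdB_pos hn)
  rw [facetSum_simplex (C := fun t => t < 0) hn Set.Subset.rfl (lt_irrefl 0) hP,
    facetTerm, facetTerm,
    Set.indicator_of_mem (by exact norm_diag hn), supp_simplex_diag hn Set.Subset.rfl hP,
    Set.indicator_of_notMem (by exact not_lt.2 hc.le),
    Set.indicator_of_mem (by simpa using norm_diag hn), supp_simplex_zero_neg_diag hP,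
    Set.indicator_of_notMem (by exact lt_irrefl (0 : ℝ))]
  ring

end Operators

/-! ### The classification -/

section Classification

variable {n : ℕ} {p : ℝ}

theorem supp_smul_body {c : ℝ} (hc : 0 ≤ c) (K : ConvexBodyO n) (u : E n) :
    supp (c • K).1 u = c * supp K.1 u := by
  have h : ((c • K).1 : Set (E n)) = (fun x => c • x) '' (K.1 : Set (E n)) :=
    ConvexBody.coe_smul c K.1
  obtain ⟨⟨x, hx, hxu⟩, hmax⟩ := supp_isGreatest K.1 u
  refine supp_eq_of_isGreatest ?_
  rw [h]
  refine ⟨⟨c • x, ⟨x, hx, rfl⟩, ?_⟩, ?_⟩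
  · simp only [real_inner_smul_left] at hxu ⊢
    rw [hxu]
  · rintro _ ⟨_, ⟨y, hy, rfl⟩, rfl⟩
    simp only [real_inner_smul_left]
    exact mul_le_mul_of_nonneg_left (hmax ⟨y, hy, rfl⟩) hc

/-- The conditions on the support numbers in the four operators. -/
def facetCond : Fin 4 → ℝ → Prop :=
  ![fun t => 0 < t, fun t => 0 < t, fun t => t < 0, fun t => t < 0]

/-- The functions `t ↦ t₊` and `t ↦ t₋` in the four operators. -/
def facetFun : Fin 4 → ℝ → ℝ :=
  ![fun t => max t 0, fun t => max (-t) 0, fun t => max t 0, fun t => max (-t) 0]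

theorem facetCond_mul (i : Fin 4) (c t : ℝ) (hc : 0 < c) :
    facetCond i (c * t) ↔ facetCond i t := by
  have h1 : 0 < c * t ↔ 0 < t := mul_pos_iff_of_pos_left hc
  have h2 : c * t < 0 ↔ t < 0 := ⟨fun h => neg_of_mul_neg_right h hc.le, mul_neg_of_pos_of_neg hc⟩
  fin_cases i
  exacts [h1, h1, h2, h2]

theorem facetFun_nonneg (i : Fin 4) (t : ℝ) : 0 ≤ facetFun i t := by
  fin_cases i <;> exact le_max_right _ _

theorem facetFun_mul (i : Fin 4) (c t : ℝ) (hc : 0 < c) :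
    facetFun i (c * t) = c * facetFun i t := by
  have h1 : ∀ s, max (c * s) 0 = c * max s 0 := fun s => by
    rw [mul_max_of_nonneg _ _ hc.le, mul_zero]
  have h2 : max (-(c * t)) 0 = c * max (-t) 0 := by rw [← mul_neg, h1]
  fin_cases i
  exacts [h1 t, h2, h1 t, h2]

theorem facetFun_add (i : Fin 4) (a b : ℝ) :
    facetFun i (a + b) ≤ facetFun i a + facetFun i b := by
  have h1 : ∀ a b : ℝ, max (a + b) 0 ≤ max a 0 + max b 0 := fun a b =>
    max_le (add_le_add (le_max_left _ _) (le_max_left _ _))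
      (add_nonneg (le_max_right _ _) (le_max_right _ _))
  have h2 : max (-(a + b)) 0 ≤ max (-a) 0 + max (-b) 0 := by rw [neg_add]; exact h1 _ _
  fin_cases i
  exacts [h1 a b, h2, h1 a b, h2]

/-- The four operators. -/
def facetOp (p : ℝ) (i : Fin 4) (P : Polytope n) : ConvexBodyO n :=
  facetBody p (facetCond i) (facetFun i) (facetFun_nonneg i) P

theorem supp_facetOp (hp : 1 < p) (i : Fin 4) (P : Polytope n) (u : E n) :
    supp (facetOp p i P).1 u ^ p = facetSum p (facetCond i) (facetFun i) P u :=
  supp_facetBody hp.le _ _ _ (facetFun_add i) (facetFun_mul i) P u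

theorem contraVal_facetOp (hp : 1 < p) (i : Fin 4) :
    ContraVal p (suppPow p (facetOp (n := n) p i)) := by
  obtain ⟨hc, hv⟩ := contravariant_valuation_of_sum hp (ι := Unit)
    (Φ := facetOp (n := n) p i) (w := fun _ => 1)
    (G := fun _ => facetSum p (facetCond i) (facetFun i))
    (fun P u => by simp [supp_facetOp hp])
    (fun _ => facetSum_image (facetCond_mul i) (facetFun_nonneg i) (facetFun_mul i))
    (fun _ P Q U I hU hI => facetSum_valuation _ _ _ hU hI)
  exact contraVal_suppPow hp hc hv

/-- The combination of the four operators in terms of support functions. -/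
theorem supp_combination (hp : 1 < p) {c₁ c₂ c₃ c₄ : ℝ} (h₁ : 0 ≤ c₁) (h₂ : 0 ≤ c₂) (h₃ : 0 ≤ c₃)
    (h₄ : 0 ≤ c₄) (P : Polytope n) (u : E n) :
    supp (lpAdd p (lpAdd p (lpAdd p (c₁ • projPosGt p P) (c₂ • projNegGt p P))
      (c₃ • projPosLt p P)) (c₄ • projNegLt p P)).1 u ^ p =
      ∑ i, ![c₁ ^ p, c₂ ^ p, c₃ ^ p, c₄ ^ p] i *
        facetSum p (facetCond i) (facetFun i) P u := by
  rw [Fin.sum_univ_four, ← supp_facetOp hp, ← supp_facetOp hp, ← supp_facetOp hp,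
    ← supp_facetOp hp, supp_lpAdd hp.le, supp_lpAdd hp.le, supp_lpAdd hp.le, supp_smul_body h₁,
    supp_smul_body h₂, supp_smul_body h₃, supp_smul_body h₄, Real.mul_rpow h₁ (supp_nonneg _ _),
    Real.mul_rpow h₂ (supp_nonneg _ _), Real.mul_rpow h₃ (supp_nonneg _ _),
    Real.mul_rpow h₄ (supp_nonneg _ _)]
  rfl

/-- The coefficients are read off from the values at `± e_k` on the two standard simplices. -/
theorem ContraVal.exists_coeff {Z : Set (E n) → E n → ℝ} (hZ : ContraVal p Z) (hn : 3 ≤ n)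
    (hp : 1 < p) : ∃ w : Fin 4 → ℝ, (∀ i, 0 ≤ w i) ∧ ∀ P : Polytope n, ∀ u,
      Z P.toSet u = ∑ i, w i * facetSum p (facetCond i) (facetFun i) P u := by
  have hn0 : n ≠ 0 := by omega
  have hp0 : p ≠ 0 := by linarith
  let k : Fin n := ⟨0, by omega⟩
  have hK : 0 < simplexConst n p := simplexConst_pos hn0
  have hp1 := hZ.le_simplex hn hp k (Or.inl rfl)
  have hm1 := hZ.le_simplex hn hp k (Or.inr rfl)
  set K := simplexConst n p
  set a₀ := Z (simplex {0} (stdB n)) ((1 : ℝ) • stdB n k)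
  set b₀ := Z (simplex {0} (stdB n)) ((-1 : ℝ) • stdB n k)
  set a₁ := Z (simplex ∅ (stdB n)) ((1 : ℝ) • stdB n k)
  set b₁ := Z (simplex ∅ (stdB n)) ((-1 : ℝ) • stdB n k)
  have ha0 : 0 ≤ a₀ := hZ.nonneg _ _
  have hb0 : 0 ≤ b₀ := hZ.nonneg _ _
  refine ⟨![a₀ / K, b₀ / K, (b₁ - b₀) / K, (a₁ - a₀) / K], ?_, ?_⟩
  · intro i
    fin_cases i
    exacts [div_nonneg ha0 hK.le, div_nonneg hb0 hK.le, div_nonneg (sub_nonneg.2 hm1) hK.le,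
      div_nonneg (sub_nonneg.2 hp1) hK.le]
  intro P u
  have hval : ∀ i (Q : Polytope n) u, suppPow p (facetOp p i) Q.toSet u =
      facetSum p (facetCond i) (facetFun i) Q u := fun i Q u => by
    rw [suppPow_toSet, supp_facetOp hp]
  simp only [← hval]
  refine hZ.eq_sum hn hp k (contraVal_facetOp hp) _ ?_ P.isPoly u
  intro o ho s hs
  obtain ⟨S, hS⟩ := (isPoly_simplex ho (stdB n)).exists_polytope
    ⟨stdB n k, subset_convexHull ℝ _ (Or.inr ⟨k, rfl⟩)⟩
  simp only [← hS, hval, Fin.sum_univ_four]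
  have e0 := facetSum_gt_simplex (p := p) hn0 ho (facetFun_nonneg 0) (facetFun_mul 0) hS s k
  have e1 := facetSum_gt_simplex (p := p) hn0 ho (facetFun_nonneg 1) (facetFun_mul 1) hS s k
  have z1 : max (1 : ℝ) 0 ^ p = 1 := by rw [max_eq_left zero_le_one, Real.one_rpow]
  have z2 : max (-1 : ℝ) 0 ^ p = 0 := by
    rw [max_eq_right (by norm_num), Real.zero_rpow hp0]
  have e0' : facetSum p (facetCond 0) (facetFun 0) S (s • stdB n k) = K * max s 0 ^ p := e0
  have e1' : facetSum p (facetCond 1) (facetFun 1) S (s • stdB n k) = K * max (-s) 0 ^ p := e1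
  rw [e0', e1']
  change _ = a₀ / K * _ + b₀ / K * _ + (b₁ - b₀) / K * _ + (a₁ - a₀) / K * _
  rcases Set.subset_singleton_iff_eq.1 ho with rfl | rfl
  · have e2 : facetSum p (facetCond 2) (facetFun 2) S (s • stdB n k) = K * max (-s) 0 ^ p :=
      facetSum_lt_simplex hn0 (facetFun_nonneg 2) (facetFun_mul 2) hS s k
    have e3 : facetSum p (facetCond 3) (facetFun 3) S (s • stdB n k) = K * max (- -s) 0 ^ p :=
      facetSum_lt_simplex hn0 (facetFun_nonneg 3) (facetFun_mul 3) hS s k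
    rw [e2, e3, hS]
    rcases hs with rfl | rfl
    · simp only [neg_neg, z1, z2]
      change a₁ = _
      field_simp
      ring
    · simp only [neg_neg, z1, z2]
      change b₁ = _
      field_simp
      ring
  · have e2 : facetSum p (facetCond 2) (facetFun 2) S (s • stdB n k) = 0 :=
      facetSum_lt_simplex_zero hn0 hS _
    have e3 : facetSum p (facetCond 3) (facetFun 3) S (s • stdB n k) = 0 :=
      facetSum_lt_simplex_zero hn0 hS _
    rw [e2, e3, hS]
    rcases hs with rfl | rfl
    · simp only [z1, z2]
      change a₀ = _
      field_simp
      ring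
    · simp only [neg_neg, z1, z2]
      change b₀ = _
      field_simp
      ring

end Classification

end SLContra

end

theorem mainTheorem2 (n : ℕ) (hn : 3 ≤ n) (p : ℝ) (hp : 1 < p)
    (Φ : SLContra.Polytope n → SLContra.ConvexBodyO n) :
    (SLContra.IsSLContravariant Φ ∧ SLContra.IsLpMinkowskiValuation p Φ) ↔
      ∃ c₁ c₂ c₃ c₄ : ℝ, 0 ≤ c₁ ∧ 0 ≤ c₂ ∧ 0 ≤ c₃ ∧ 0 ≤ c₄ ∧
        ∀ P : SLContra.Polytope n,
          Φ P = SLContra.lpAdd p (SLContra.lpAdd p (SLContra.lpAdd p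
              (c₁ • SLContra.projPosGt p P) (c₂ • SLContra.projNegGt p P))
              (c₃ • SLContra.projPosLt p P)) (c₄ • SLContra.projNegLt p P) := by
  have hp0 : p ≠ 0 := by linarith
  constructor
  · rintro ⟨hc, hv⟩
    obtain ⟨w, hw, h⟩ := (SLContra.contraVal_suppPow hp hc hv).exists_coeff hn hp
    have hw' := fun i => Real.rpow_nonneg (hw i) p⁻¹
    refine ⟨w 0 ^ p⁻¹, w 1 ^ p⁻¹, w 2 ^ p⁻¹, w 3 ^ p⁻¹, hw' 0, hw' 1, hw' 2, hw' 3, fun P => ?_⟩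
    refine SLContra.ConvexBodyO.ext_supp fun u => ?_
    refine (Real.rpow_left_inj (SLContra.supp_nonneg _ u) (SLContra.supp_nonneg _ u) hp0).1 ?_
    rw [SLContra.supp_combination hp (hw' 0) (hw' 1) (hw' 2) (hw' 3), ← SLContra.suppPow_toSet, h]
    refine Finset.sum_congr rfl fun i _ => ?_
    fin_cases i <;> simp [Real.rpow_inv_rpow (hw _) hp0]
  · rintro ⟨c₁, c₂, c₃, c₄, h₁, h₂, h₃, h₄, h⟩
    refine SLContra.contravariant_valuation_of_sum hp
      (fun P u => by rw [h P, SLContra.supp_combination hp h₁ h₂ h₃ h₄])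
      (fun i => SLContra.facetSum_image (SLContra.facetCond_mul i) (SLContra.facetFun_nonneg i)
        (SLContra.facetFun_mul i))
      (fun i P Q U I hU hI => SLContra.facetSum_valuation _ _ _ hU hI)
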